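/- **Setting.** Let $n\ge 1$, $m\ge 2$, let $\Omega\subset\mathbb R^n$ be a bounded open set, and let $M\subset\mathbb R^m$ be a smooth domain (open, connected, with $C^\infty$ boundary) whose complement $M^c=\mathbb R^m\setminus M$ is nonempty. Let $\rho$ be the signed distance to $\partial M$, positive in $M$, $\nu=\nabla\rho$ the unit normal to $\partial M$ pointing towards $M$, and $A_y(\xi,\zeta)=-D^2\rho(y)(\xi,\zeta)\,\nu(y)$ the normal-vector-valued second fundamental form of $\partial M$ at $y\in\partial M$. Write $A_u(Du,Du)=\sum_{i}A_u(\partial_iu,\partial_iu)$ and $|Du|^2=\sum_i|\partial_iu|^2$. For an open set $V\subset\mathbb R^n$, $W^{1,2}(V;\overline M)$ is the set of $u\in W^{1,2}(V;\mathbb R^m)$ with $u\in\overline M$ a.e. Maps are identified when they agree almost everywhere; $u$ is continuous at $x_0$ if one of its representatives is, and $\Sigma(u)$ is the set of points of $V$ where $u$ is not continuous. For $x_0\in V$ and $r>0$ put $u_{x_0,r}(x)=u(x_0+rx)$ whenever $x_0+rx\in V$. A map $\varphi$ is a tangent map of $u$ at $x_0$ if $u_{x_0,r_k}\rightharpoonup\varphi$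 weakly in $W^{1,2}_{\rm loc}(\mathbb R^n;\mathbb R^m)$ for some sequence $r_k\downarrow0$. **The class $\mathcal F$.** The classes $\mathcal F(V;\overline M)$, $V\subset\mathbb R^n$ bounded and open, are the largest classes of maps $u\in W^{1,2}(V;\overline M)$ such that each $u\in\mathcal F(V;\overline M)$ satisfies: 1. $u$ is a weak solution of $\Delta u=A_u(Du,Du)\,\chi_{u^{-1}(\partial M)}$ in $V$; 2. $r^{2-n}\int_{B_r(x_0)}|Du|^2\,dx\le R^{2-n}\int_{B_R(x_0)}|Du|^2\,dx$ whenever $x_0\in V$ and $0<r<R<\operatorname{dist}(x_0,\partial V)$; 3. for every $x_0\in V$, $u$ is continuous at $x_0$ if and only if $\lim_{r\downarrow0}r^{2-n}\int_{B_r(x_0)}|Du|^2\,dx=0$; 4. if $\varphi$ is a tangent map of $u$ at some $x_0\in V$, then there is a sequence $r_k\downarrow0$ with $u_{x_0,r_k}\to\varphi$ strongly in $W^{1,2}_{\rm loc}(\mathbb R^n;\mathbb R^m)$, and $\varphi\in\mathcal F(B_R;\overline M)$ for all $R>0$, where $B_R=B_R(0)\subset\mathbb R^n$. **Lemma.** Suppose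 that $M^c$ is convex and compact, and let $u\in\mathcal F(\Omega;\overline M)$. Then $\operatorname{dist}(u,M^c)$ is continuous and weakly subharmonic in $\Omega$, and it vanishes on $\Sigma(u)$. That is, there is a continuous function $d:\Omega\to\mathbb R$ with $d=\operatorname{dist}(u,M^c)$ a.e. in $\Omega$, with $d\in W^{1,2}_{\rm loc}(\Omega)$ and $\int_\Omega\nabla d\cdot\nabla\eta\,dx\le0$ for every $\eta\in C_c^\infty(\Omega)$ with $\eta\ge0$, and with $d=0$ on $\Sigma(u)$. -/

import Mathlib

open MeasureTheory Filter Topology Set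
open scoped ContDiff

noncomputable section

namespace ConstraintMap

/-- `ℝ^n` with its Euclidean norm. -/
abbrev Euc (n : ℕ) : Type := EuclideanSpace ℝ (Fin n)

section Sobolev

variable {n : ℕ} {G : Type*} [NormedAddCommGroup G] [NormedSpace ℝ G]

/-- Scalar test functions on `Ω`: the class `C_c^∞(Ω)`. -/
def IsTest (Ω : Set (Euc n)) (η : Euc n → ℝ) : Prop :=
  ContDiff ℝ ∞ η ∧ HasCompactSupport η ∧ tsupport η ⊆ Ω

/-- The classical partial derivative `∂_i η`. -/
def pderiv (i : Fin n) (η : Euc n → ℝ) (x : Euc n) : ℝ :=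
  fderiv ℝ η x (EuclideanSpace.single i 1)

/-- `g` is a weak `i`-th partial derivative of `u` on the open set `Ω`. -/
def HasWeakPartial (Ω : Set (Euc n)) (i : Fin n) (u g : Euc n → G) : Prop :=
  LocallyIntegrableOn u Ω ∧ LocallyIntegrableOn g Ω ∧
    ∀ η : Euc n → ℝ, IsTest Ω η →
      ∫ x in Ω, pderiv i η x • u x = - ∫ x in Ω, η x • g x

open Classical in
/-- The weak `i`-th partial derivative of `u` on `Ω`. It is determined up to null sets, and
everything below depends on it only up to null sets. It is `0` if there is no weak derivative. -/
def weakPartial (Ω : Set (Euc n)) (u : Euc n → G) (i : Fin n) : Euc n → G :=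
  if h : ∃ g, HasWeakPartial Ω i u g then h.choose else 0

/-- The Sobolev space `W^{1,2}(Ω; G)`. -/
def MemW12 (Ω : Set (Euc n)) (u : Euc n → G) : Prop :=
  MemLp u 2 (volume.restrict Ω) ∧
    ∀ i, ∃ g, HasWeakPartial Ω i u g ∧ MemLp g 2 (volume.restrict Ω)

/-- Weak solutions `u ∈ W^{1,2}(Ω; G)` of `Δ u = f` with `f ∈ L^1_loc(Ω; G)`. -/
def IsWeakSolution (Ω : Set (Euc n)) (u f : Euc n → G) : Prop :=
  MemW12 Ω u ∧ LocallyIntegrableOn f Ω ∧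
    ∀ η : Euc n → ℝ, IsTest Ω η →
      ∫ x in Ω, ∑ i, pderiv i η x • weakPartial Ω u i x = - ∫ x in Ω, η x • f x

/-- Weak subharmonicity: `w ∈ W^{1,2}_loc(Ω)` and `∫ ∇w · ∇η ≤ 0` for all nonnegative test
functions `η`. -/
def IsWeaklySubharmonic (Ω : Set (Euc n)) (w : Euc n → ℝ) : Prop :=
  LocallyIntegrableOn (fun x => w x ^ 2) Ω ∧
    ∃ g : Fin n → Euc n → ℝ,
      (∀ i, HasWeakPartial Ω i w (g i) ∧ LocallyIntegrableOn (fun x => g i x ^ 2) Ω) ∧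
      ∀ η : Euc n → ℝ, IsTest Ω η → (∀ x, 0 ≤ η x) →
        ∫ x in Ω, ∑ i, g i x * pderiv i η x ≤ 0

/-- Some representative of the class of `u` modulo null sets of `Ω` is continuous at `x₀`. -/
def EssContinuousAt (Ω : Set (Euc n)) (u : Euc n → G) (x₀ : Euc n) : Prop :=
  ∃ v : Euc n → G, v =ᵐ[volume.restrict Ω] u ∧ ContinuousAt v x₀

/-- The discontinuity set `Σ(u)`. -/
def discontinuitySet (Ω : Set (Euc n)) (u : Euc n → G) : Set (Euc n) :=
  {x₀ | x₀ ∈ Ω ∧ ¬ EssContinuousAt Ω u x₀}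

/-- The scaled energy `E(u,x₀,r) = r^{2-n} ∫_{B_r(x₀)} |Du|²`, for a map `u` on `Ω`, where
`|Du|² = ∑ i, |∂_i u|²`. -/
def scaledEnergy (Ω : Set (Euc n)) (u : Euc n → G) (x₀ : Euc n) (r : ℝ) : ℝ :=
  r ^ (2 - (n : ℤ)) * ∫ x in Metric.ball x₀ r, ∑ i, ‖weakPartial Ω u i x‖ ^ 2

/-- The rescaling `u_{x₀,r}(x) = u(x₀ + r x)`. -/
def rescale (u : Euc n → G) (x₀ : Euc n) (r : ℝ) : Euc n → G :=
  fun x => u (x₀ + r • x)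

/-- Strong convergence in `W^{1,2}(Ω; G)`. Finitely many members of the sequence do not
matter and need not be in the space. -/
def TendstoW12 (Ω : Set (Euc n)) (f : ℕ → Euc n → G) (φ : Euc n → G) : Prop :=
  MemW12 Ω φ ∧ (∀ᶠ k in atTop, MemW12 Ω (f k)) ∧
    Tendsto (fun k => eLpNorm (f k - φ) 2 (volume.restrict Ω)) atTop (𝓝 0) ∧
    ∀ i, Tendsto (fun k => eLpNorm (weakPartial Ω (f k) i - weakPartial Ω φ i) 2
      (volume.restrict Ω)) atTop (𝓝 0)

/-- Weak convergence in the Hilbert space `W^{1,2}(Ω; ℝ^m)`, that is, weak convergence in `L²`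
of the maps and of their weak partial derivatives. Finitely many members of the sequence do not
matter and need not be in the space. -/
def WeakTendstoW12 {m : ℕ} (Ω : Set (Euc n)) (f : ℕ → Euc n → Euc m) (φ : Euc n → Euc m) :
    Prop :=
  MemW12 Ω φ ∧ (∀ᶠ k in atTop, MemW12 Ω (f k)) ∧
    ∀ g : Euc n → Euc m, MemLp g 2 (volume.restrict Ω) →
      Tendsto (fun k => ∫ x in Ω, inner ℝ (f k x) (g x)) atTop
        (𝓝 (∫ x in Ω, inner ℝ (φ x) (g x))) ∧
      ∀ i, Tendsto (fun k => ∫ x in Ω, inner ℝ (weakPartial Ω (f k) i x) (g x)) atTop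
        (𝓝 (∫ x in Ω, inner ℝ (weakPartial Ω φ i x) (g x)))

/-- `φ` is a tangent map of `u` at `x₀`: some sequence of rescalings `u_{x₀,r_k}` with `r_k ↓ 0`
converges to `φ` weakly in `W^{1,2}_loc(ℝ^n; ℝ^m)`, that is, weakly in `W^{1,2}(B_R; ℝ^m)` for
every `R > 0`. -/
def IsTangentMap {m : ℕ} (u : Euc n → Euc m) (x₀ : Euc n) (φ : Euc n → Euc m) : Prop :=
  ∃ r : ℕ → ℝ, Tendsto r atTop (𝓝[>] 0) ∧
    ∀ R > 0, WeakTendstoW12 (Metric.ball 0 R) (fun k => rescale u x₀ (r k)) φ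

end Sobolev

section Target

variable {m : ℕ}

/-- A smooth domain of `ℝ^m`: open, connected, and near each of its boundary points the
superlevel set `{F > 0}` of a smooth function `F` without critical point there. -/
def IsSmoothDomain (M : Set (Euc m)) : Prop :=
  IsOpen M ∧ IsConnected M ∧
    ∀ y ∈ frontier M, ∃ F : Euc m → ℝ, ContDiff ℝ ∞ F ∧ fderiv ℝ F y ≠ 0 ∧
      ∀ᶠ z in 𝓝 y, (z ∈ M ↔ 0 < F z)

/-- The signed distance `ρ` to `∂M`, positive in `M`. -/
def signedDist (M : Set (Euc m)) (y : Euc m) : ℝ :=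
  Metric.infDist y Mᶜ - Metric.infDist y M

/-- The unit normal `ν = ∇ρ` to `∂M` pointing towards `M`, extended to a neighbourhood of `∂M`
by the gradient of the signed distance. -/
def unitNormal (M : Set (Euc m)) (y : Euc m) : Euc m :=
  gradient (signedDist M) y

/-- The (normal vector valued) second fundamental form of `∂M` at `y ∈ ∂M`,
`A_y(ξ,ζ) = -⟨dν_y(ξ), ζ⟩ ν(y) = -D²ρ(y)(ξ,ζ) ν(y)`. As `|∇ρ| = 1` near `∂M`, the value only
depends on the components of `ξ` and `ζ` tangent to `∂M`. -/
def secondFF (M : Set (Euc m)) (y ξ ζ : Euc m) : Euc m :=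
  -(inner ℝ (fderiv ℝ (unitNormal M) y ξ) ζ) • unitNormal M y

/-- The right-hand side `A_u(Du,Du) χ_{u⁻¹(∂M)}` of the Euler-Lagrange system, where
`A_u(Du,Du) = ∑ i, A_u(∂_i u, ∂_i u)`. -/
def curvatureTerm {n : ℕ} (M : Set (Euc m)) (Ω : Set (Euc n)) (u : Euc n → Euc m) :
    Euc n → Euc m :=
  (u ⁻¹' frontier M).indicator
    (fun x => ∑ i, secondFF M (u x) (weakPartial Ω u i x) (weakPartial Ω u i x))

/-- The conditions which define the class `𝓕(Ω; closure M)`, relative to a candidate `S` for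
this class in the requirement on tangent maps. -/
structure FConditions {n : ℕ} (M : Set (Euc m)) (S : Set (Euc n) → (Euc n → Euc m) → Prop)
    (Ω : Set (Euc n)) (u : Euc n → Euc m) : Prop where
  memW12 : MemW12 Ω u
  constraint : ∀ᵐ x ∂(volume.restrict Ω), u x ∈ closure M
  eulerLagrange : IsWeakSolution Ω u (curvatureTerm M Ω u)
  monotonicity : ∀ x₀ ∈ Ω, ∀ r R : ℝ, 0 < r → r < R → Metric.closedBall x₀ R ⊆ Ω →
    scaledEnergy Ω u x₀ r ≤ scaledEnergy Ω u x₀ R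
  continuity_iff : ∀ x₀ ∈ Ω, (EssContinuousAt Ω u x₀ ↔
    Tendsto (fun r => scaledEnergy Ω u x₀ r) (𝓝[>] 0) (𝓝 0))
  tangent_strong : ∀ x₀ ∈ Ω, ∀ φ : Euc n → Euc m, IsTangentMap u x₀ φ →
    ∃ r : ℕ → ℝ, Tendsto r atTop (𝓝[>] 0) ∧
      ∀ R > 0, TendstoW12 (Metric.ball 0 R) (fun k => rescale u x₀ (r k)) φ
  tangent_mem : ∀ x₀ ∈ Ω, ∀ φ : Euc n → Euc m, IsTangentMap u x₀ φ →
    ∀ R > 0, S (Metric.ball 0 R) φ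

/-- The class `𝓕(Ω; closure M)`. Its definition refers to itself, as tangent maps have to be in
the class again; it is the largest class which satisfies the conditions. -/
def MemF {n : ℕ} (M : Set (Euc m)) (Ω : Set (Euc n)) (u : Euc n → Euc m) : Prop :=
  ∃ S : Set (Euc n) → (Euc n → Euc m) → Prop,
    (∀ V v, S V v → FConditions M S V v) ∧ S Ω u

end Target

end ConstraintMap

end

/-! Write `K` for the closed convex set `Mᶜ`. The right-hand side of the equation is carried by `u ∈
∂M ⊆ K`. For convex `f` one has formally `Δ f(u) ≥ ⟨∇f(u), Δu⟩`, and this vanishes when `∇f = 0` on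
`K`. The choice `f = √(ε² + dist(·,K)²)` qualifies, and `ε → 0` makes `dist(u,K)` subharmonic in the
sense of distributions (`integral_lap_mul_infDist_nonneg`). The formal computation is carried out
for mollifications of `u`, with difference quotients in place of derivatives. Weak derivatives of
the distance in `L²` come from `|∫ ∂_iη f(u)| ≤ ∫ |η| |∂_iu|` for 1-Lipschitz `f` and from Riesz
representation (`exists_weakPartial_comp`).

Averages of a subharmonic function against a radial mollifier increase with the radius (`avg_mono`).
Their infimum `upperRep` is therefore an upper semicontinuous representative `d`. Where `u` is
continuous, so is `d`. Where `d` vanishes it is continuous as well, since `0 ≤ d` and `d` is upper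
semicontinuous. Everything thus reduces to `d = 0` on `Σ(u)` (`FConditions.upperRep_eq_zero`).

Let `x₀ ∈ Σ(u)` and suppose `c = d(x₀) > 0`. Near `x₀` the distance is at most `c + 1`, so `u` is
bounded there because `K` is bounded. With monotonicity of the energy, weak compactness yields a
tangent map `φ` (`exists_isTangentMap`), which is a strong limit of rescalings by the definition of
the class. Upper semicontinuity gives `dist(φ,K) ≤ c`, while the averages of `dist(u,K)` at `x₀`
converge to exactly `c`; hence `dist(φ,K) = c` a.e. in the unit ball (`infDist_blowup_eq`). So `φ`
avoids `K`, its equation reduces to `Δφ = 0`, and `φ` is continuous at `0`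
(`essContinuousAt_of_harmonic`). As `φ` belongs to the class, its scaled energy at `0` tends to
zero. But that energy is a limit of scaled energies of `u` at `x₀`, which stay above a positive
constant at a discontinuity point: a contradiction. -/

noncomputable section

namespace ConstraintMap

/-! ### Test functions, difference quotients and affine changes of variables. -/

section TestFunctions

variable {n : ℕ} {G : Type*} [NormedAddCommGroup G] [NormedSpace ℝ G]
  {Ω : Set (Euc n)} {η ψ : Euc n → ℝ}

/-- The `i`-th standard basis vector of `ℝ^n`. -/
def stdVec (i : Fin n) : Euc n := EuclideanSpace.single i 1

/-- The classical Laplacian. -/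
def lap (η : Euc n → ℝ) (x : Euc n) : ℝ := ∑ i, pderiv i (pderiv i η) x

/-- The symmetric second difference quotient in the direction `i`. -/
def secondDiff (i : Fin n) (h : ℝ) (f : Euc n → G) (x : Euc n) : G :=
  (h ^ 2)⁻¹ • (f (x + h • stdVec i) + f (x - h • stdVec i) - (2 : ℝ) • f x)

lemma norm_stdVec (i : Fin n) : ‖stdVec i‖ = 1 := by simp [stdVec]

lemma contDiff_pderiv (h : ContDiff ℝ ∞ η) (i : Fin n) : ContDiff ℝ ∞ (pderiv i η) :=
  (h.fderiv_right (m := ∞) (by simp)).clm_apply contDiff_const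

lemma IsTest.isTest_pderiv (h : IsTest Ω η) (i : Fin n) : IsTest Ω (pderiv i η) :=
  ⟨contDiff_pderiv h.1 i, h.2.1.fderiv_apply (𝕜 := ℝ) _,
    (tsupport_fderiv_apply_subset ℝ _).trans h.2.2⟩

lemma IsTest.mono {Ω' : Set (Euc n)} (h : IsTest Ω η) (hs : Ω ⊆ Ω') : IsTest Ω' η :=
  ⟨h.1, h.2.1, h.2.2.trans hs⟩

lemma IsTest.continuous (h : IsTest Ω η) : Continuous η := h.1.continuous

lemma IsTest.bounded (h : IsTest Ω η) : ∃ C, 0 ≤ C ∧ ∀ x, |η x| ≤ C := by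
  obtain ⟨C, hC⟩ := h.2.1.exists_bound_of_continuous h.continuous
  exact ⟨C, (norm_nonneg _).trans (hC 0), hC⟩

lemma IsTest.eq_zero (h : IsTest Ω η) {x : Euc n} (hx : x ∉ Ω) : η x = 0 :=
  image_eq_zero_of_notMem_tsupport fun hx' => hx (h.2.2 hx')

lemma IsTest.setIntegral_smul (h : IsTest Ω η) (u : Euc n → G) :
    ∫ x in Ω, η x • u x = ∫ x, η x • u x :=
  setIntegral_eq_integral_of_forall_compl_eq_zero fun x hx => by rw [h.eq_zero hx, zero_smul]

lemma IsTest.integrable_smul (h : IsTest Ω η) {u : Euc n → G} (hu : LocallyIntegrableOn u Ω) :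
    Integrable (fun x => η x • u x) := by
  have h1 : IntegrableOn u (tsupport η) := hu.integrableOn_compact_subset h.2.2 h.2.1
  have h2 : IntegrableOn (fun x => η x • u x) (tsupport η) :=
    h1.continuousOn_smul h.continuous.continuousOn h.2.1
  refine (integrableOn_iff_integrable_of_support_subset fun x hx => ?_).1 h2
  refine subset_tsupport _ fun h0 => hx ?_
  simp [h0]

lemma IsTest.lap_eq_zero (h : IsTest Ω η) {x : Euc n} (hx : x ∉ Ω) : lap η x = 0 :=
  Finset.sum_eq_zero fun i _ => ((h.isTest_pderiv i).isTest_pderiv i).eq_zero hx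

lemma IsTest.lap_isTest (h : IsTest Ω η) : IsTest Ω (lap η) := by
  have h1 : ContDiff ℝ ∞ (lap η) := ContDiff.sum fun i _ => contDiff_pderiv (contDiff_pderiv h.1 i) i
  have hs : tsupport (lap η) ⊆ tsupport η := by
    refine closure_minimal (fun x hx => ?_) (isClosed_tsupport _)
    by_contra hx'
    have ht : IsTest (tsupport η) η := ⟨h.1, h.2.1, subset_rfl⟩
    exact hx (ht.lap_eq_zero hx')
  exact ⟨h1, h.2.1.mono' ((subset_tsupport _).trans hs), hs.trans h.2.2⟩

lemma hasDerivAt_line (h : ContDiff ℝ ∞ ψ) (i : Fin n) (x : Euc n) (t : ℝ) :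
    HasDerivAt (fun s : ℝ => ψ (x + s • stdVec i)) (pderiv i ψ (x + t • stdVec i)) t := by
  have h1 : HasFDerivAt ψ (fderiv ℝ ψ (x + t • stdVec i)) (x + t • stdVec i) :=
    (h.differentiable (by simp) _).hasFDerivAt
  have h2 : HasDerivAt (fun s : ℝ => x + s • stdVec i) (stdVec i) t := by
    simpa using ((hasDerivAt_id t).smul_const (stdVec i)).const_add x
  exact h1.comp_hasDerivAt t h2

lemma exists_diff_eq (h : ContDiff ℝ ∞ ψ) (i : Fin n) (x : Euc n) {t : ℝ} (ht : 0 < t) :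
    ∃ s : ℝ, |s| ≤ t ∧ t⁻¹ * (ψ (x + t • stdVec i) - ψ x) = pderiv i ψ (x + s • stdVec i) := by
  obtain ⟨c, hc, hc'⟩ := exists_hasDerivAt_eq_slope (fun s : ℝ => ψ (x + s • stdVec i)) _ ht
    (fun s _ => (hasDerivAt_line h i x s).continuousAt.continuousWithinAt)
    (fun s _ => hasDerivAt_line h i x s)
  refine ⟨c, by rw [abs_of_pos hc.1]; exact hc.2.le, ?_⟩
  rw [hc']
  simp [div_eq_inv_mul]

/-- Cauchy's mean value theorem compares the even function `g(s) + g(-s)` with `s²` and produces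
`(g'(c) - g'(-c)) / 2c`; the ordinary mean value theorem on `[-c, c]` then produces a second
derivative. The resulting bound is uniform in the step size. -/
lemma exists_secondDiff_eq (h : ContDiff ℝ ∞ ψ) (i : Fin n) (x : Euc n) {t : ℝ} (ht : 0 < t) :
    ∃ s : ℝ, |s| ≤ t ∧ secondDiff i t ψ x = pderiv i (pderiv i ψ) (x + s • stdVec i) := by
  set g : ℝ → ℝ := fun s => ψ (x + s • stdVec i)
  set g' : ℝ → ℝ := fun s => pderiv i ψ (x + s • stdVec i)
  have hg : ∀ s, HasDerivAt g (g' s) s := hasDerivAt_line h i x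
  have hg' : ∀ s, HasDerivAt g' (pderiv i (pderiv i ψ) (x + s • stdVec i)) s :=
    hasDerivAt_line (contDiff_pderiv h i) i x
  have hq : ∀ s, HasDerivAt (fun s => g s + g (-s)) (g' s - g' (-s)) s := fun s => by
    have := (hg s).add ((hg (-s)).comp s (hasDerivAt_neg s))
    rw [mul_neg_one, ← sub_eq_add_neg] at this
    exact this
  obtain ⟨c, hc, hc'⟩ := exists_ratio_hasDerivAt_eq_ratio_slope (fun s => g s + g (-s)) _ ht
    (fun s _ => (hq s).continuousAt.continuousWithinAt) (fun s _ => hq s)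
    (fun s => s ^ 2) (fun s => 2 * s) (by fun_prop)
    (fun s _ => by simpa using hasDerivAt_pow 2 s)
  obtain ⟨b, hb, hb'⟩ := exists_hasDerivAt_eq_slope g' _ (show -c < c by linarith [hc.1])
    (fun s _ => (hg' s).continuousAt.continuousWithinAt) (fun s _ => hg' s)
  refine ⟨b, abs_le.2 ⟨by linarith [hb.1, hc.2], by linarith [hb.2, hc.2]⟩, ?_⟩
  have hc0 : c ≠ 0 := hc.1.ne'
  have e1 : secondDiff i t ψ x = (t ^ 2)⁻¹ * (g t + g (-t) - 2 * g 0) := by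
    simp [secondDiff, g, sub_eq_add_neg]
  rw [hb', e1]
  have e2 : g t + g (-t) - 2 * g 0 = t ^ 2 * (g' c - g' (-c)) / (2 * c) := by
    field_simp
    simp only [neg_zero] at hc'
    linarith
  rw [e2]
  field_simp
  ring

lemma tendsto_line (hψ : Continuous ψ) {ι : Type*} {l : Filter ι} {t s : ι → ℝ}
    (ht : Tendsto t l (𝓝 0)) (hs : ∀ k, |s k| ≤ t k) (i : Fin n) (x : Euc n) :
    Tendsto (fun k => ψ (x + s k • stdVec i)) l (𝓝 (ψ x)) := by
  have h1 : Tendsto s l (𝓝 0) := squeeze_zero_norm hs ht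
  have h2 : Tendsto (fun k => x + s k • stdVec i) l (𝓝 (x + (0 : ℝ) • stdVec i)) :=
    tendsto_const_nhds.add (h1.smul_const _)
  rw [zero_smul, add_zero] at h2
  exact (hψ.tendsto x).comp h2

lemma tendsto_secondDiff (h : ContDiff ℝ ∞ ψ) {t : ℕ → ℝ} (ht : Tendsto t atTop (𝓝 0))
    (hpos : ∀ k, 0 < t k) (i : Fin n) (x : Euc n) :
    Tendsto (fun k => secondDiff i (t k) ψ x) atTop (𝓝 (pderiv i (pderiv i ψ) x)) := by
  choose s hs hs' using fun k => exists_secondDiff_eq h i x (hpos k)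
  simp_rw [hs']
  exact tendsto_line (contDiff_pderiv (contDiff_pderiv h i) i).continuous ht hs i x

lemma tendsto_diff (h : ContDiff ℝ ∞ ψ) {t : ℕ → ℝ} (ht : Tendsto t atTop (𝓝 0))
    (hpos : ∀ k, 0 < t k) (i : Fin n) (x : Euc n) :
    Tendsto (fun k => (t k)⁻¹ * (ψ (x + t k • stdVec i) - ψ x)) atTop (𝓝 (pderiv i ψ x)) := by
  choose s hs hs' using fun k => exists_diff_eq h i x (hpos k)
  simp_rw [hs']
  exact tendsto_line (contDiff_pderiv h i).continuous ht hs i x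

/-- A test function composed with an affine map `y ↦ a + r y`. -/
lemma IsTest.comp_affine {Ω' : Set (Euc n)} (h : IsTest Ω η) (a : Euc n) {r : ℝ} (hr : r ≠ 0)
    (hs : ∀ y, a + r • y ∈ Ω → y ∈ Ω') : IsTest Ω' (fun y => η (a + r • y)) := by
  have e : (fun y => η (a + r • y)) = η ∘ ((Homeomorph.smulOfNeZero r hr).trans
    (Homeomorph.addLeft a)) := rfl
  refine ⟨h.1.comp (by fun_prop), ?_, ?_⟩
  · rw [e]; exact h.2.1.comp_homeomorph _
  · rw [e]
    intro y hy
    rw [tsupport_comp_eq_preimage] at hy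
    exact hs y (h.2.2 hy)

lemma pderiv_comp_affine (h : ContDiff ℝ ∞ η) (a : Euc n) (r : ℝ) (i : Fin n) (y : Euc n) :
    pderiv i (fun y => η (a + r • y)) y = r * pderiv i η (a + r • y) := by
  have h1 : HasFDerivAt η (fderiv ℝ η (a + r • y)) (a + r • y) :=
    (h.differentiable (by simp) _).hasFDerivAt
  have h2 : HasFDerivAt (fun y : Euc n => a + r • y) (r • ContinuousLinearMap.id ℝ (Euc n)) y :=
    ((hasFDerivAt_id y).const_smul r).const_add a
  have h3 : HasFDerivAt (fun y => η (a + r • y)) _ y := h1.comp y h2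
  simp [pderiv, h3.fderiv]

lemma integral_comp_affine (f : Euc n → G) (a : Euc n) {r : ℝ} (hr : 0 < r) :
    ∫ x, f (a + r • x) = (r ^ n)⁻¹ • ∫ x, f x := by
  have := Measure.integral_comp_smul_of_nonneg volume (fun y => f (a + y)) r (hR := hr.le)
  rw [this, integral_add_left_eq_self (fun y => f y) a]
  simp

end TestFunctions

/-! ### Uniqueness of weak derivatives and the equation in distributional form. -/

section WeakPartials

variable {n : ℕ} {G : Type*} [NormedAddCommGroup G] [NormedSpace ℝ G]
  {Ω : Set (Euc n)} {u g g' : Euc n → G} {i : Fin n}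

lemma HasWeakPartial.mono {Ω' : Set (Euc n)} (h : HasWeakPartial Ω i u g) (hs : Ω' ⊆ Ω) :
    HasWeakPartial Ω' i u g := by
  refine ⟨h.1.mono_set hs, h.2.1.mono_set hs, fun η hη => ?_⟩
  have := h.2.2 η (hη.mono hs)
  rwa [((hη.mono hs).isTest_pderiv i).setIntegral_smul, (hη.mono hs).setIntegral_smul,
    ← (hη.isTest_pderiv i).setIntegral_smul, ← hη.setIntegral_smul] at this

/-- This is the fundamental lemma of the calculus of variations; it frees later arguments from the
particular choice made in `weakPartial`. -/
lemma HasWeakPartial.ae_eq [CompleteSpace G] (hΩ : IsOpen Ω) (h : HasWeakPartial Ω i u g)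
    (h' : HasWeakPartial Ω i u g') : g =ᵐ[volume.restrict Ω] g' := by
  have h0 : ∀ᵐ x, x ∈ Ω → (g - g') x = 0 := by
    refine hΩ.ae_eq_zero_of_integral_contDiff_smul_eq_zero (h.2.1.sub h'.2.1) fun η h1 h2 h3 => ?_
    have hη : IsTest Ω η := ⟨h1, h2, h3⟩
    have e := (h.2.2 η hη).symm.trans (h'.2.2 η hη)
    rw [neg_inj, hη.setIntegral_smul, hη.setIntegral_smul] at e
    simp only [Pi.sub_apply, smul_sub]
    rw [integral_sub (hη.integrable_smul h.2.1) (hη.integrable_smul h'.2.1), e, sub_self]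
  filter_upwards [(ae_restrict_iff' hΩ.measurableSet).2 h0] with x hx
  exact sub_eq_zero.1 hx

lemma hasWeakPartial_weakPartial (h : ∃ g, HasWeakPartial Ω i u g) :
    HasWeakPartial Ω i u (weakPartial Ω u i) := by
  rw [weakPartial, dif_pos h]
  exact h.choose_spec

lemma HasWeakPartial.ae_eq_weakPartial [CompleteSpace G] (hΩ : IsOpen Ω)
    (h : HasWeakPartial Ω i u g) : weakPartial Ω u i =ᵐ[volume.restrict Ω] g :=
  (hasWeakPartial_weakPartial ⟨g, h⟩).ae_eq hΩ h

lemma MemW12.hasWeakPartial (h : MemW12 Ω u) (i : Fin n) :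
    HasWeakPartial Ω i u (weakPartial Ω u i) :=
  hasWeakPartial_weakPartial ⟨_, (h.2 i).choose_spec.1⟩

lemma MemW12.memLp_weakPartial [CompleteSpace G] (hΩ : IsOpen Ω) (h : MemW12 Ω u) (i : Fin n) :
    MemLp (weakPartial Ω u i) 2 (volume.restrict Ω) := by
  obtain ⟨g, hg, hg'⟩ := h.2 i
  exact (memLp_congr_ae (hg.ae_eq_weakPartial hΩ)).2 hg'

/-- The Euler-Lagrange equation with both derivatives on the test function. -/
lemma IsWeakSolution.integral_lap {f : Euc n → G} (h : IsWeakSolution Ω u f) {η : Euc n → ℝ}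
    (hη : IsTest Ω η) : ∫ x, lap η x • u x = ∫ x, η x • f x := by
  have h2 := h.2.2 η hη
  have hw := h.1.hasWeakPartial
  rw [integral_finsetSum _ fun i _ =>
    ((hη.isTest_pderiv i).integrable_smul (hw i).2.1).integrableOn, hη.setIntegral_smul] at h2
  have h3 : ∀ i, ∫ x in Ω, pderiv i η x • weakPartial Ω u i x
      = - ∫ x, pderiv i (pderiv i η) x • u x := fun i => by
    have := (hw i).2.2 _ (hη.isTest_pderiv i)
    rw [((hη.isTest_pderiv i).isTest_pderiv i).setIntegral_smul] at this
    rw [this, neg_neg]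
  simp_rw [h3, Finset.sum_neg_distrib, neg_inj] at h2
  rw [← h2, ← integral_finsetSum _ fun i _ =>
    ((hη.isTest_pderiv i).isTest_pderiv i).integrable_smul (hw i).1]
  simp_rw [lap, Finset.sum_smul]

end WeakPartials

end ConstraintMap

end

noncomputable section

namespace ConstraintMap

/-! ### A one-dimensional cutoff profile and its primitive. -/

section Profile

/-- A smooth profile which is positive on `(-∞, 1)` and vanishes on `[1, ∞)`. -/
def profile (t : ℝ) : ℝ := expNegInvGlue (1 - t)

/-- Half the primitive of the profile which vanishes on `[1, ∞)`. -/
def profileInt (t : ℝ) : ℝ := 2⁻¹ * ∫ s in t..1, profile s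

lemma contDiff_profile : ContDiff ℝ ∞ profile :=
  expNegInvGlue.contDiff.comp (contDiff_const.sub contDiff_id)

lemma profile_nonneg (t : ℝ) : 0 ≤ profile t := expNegInvGlue.nonneg _

lemma profile_pos {t : ℝ} (ht : t < 1) : 0 < profile t := expNegInvGlue.pos_of_pos (by linarith)

lemma profile_eq_zero {t : ℝ} (ht : 1 ≤ t) : profile t = 0 :=
  expNegInvGlue.zero_of_nonpos (by linarith)

lemma hasDerivAt_profile (t : ℝ) : HasDerivAt profile (deriv profile t) t :=
  (contDiff_profile.differentiable (by simp) t).hasDerivAt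

lemma continuous_deriv_profile : Continuous (deriv profile) :=
  contDiff_profile.continuous_deriv (by simp)

lemma deriv_profile_eq_zero {t : ℝ} (ht : 1 < t) : deriv profile t = 0 := by
  have : profile =ᶠ[𝓝 t] fun _ => 0 := by
    filter_upwards [lt_mem_nhds ht] with s hs using profile_eq_zero hs.le
  rw [this.deriv_eq, deriv_const]

lemma hasDerivAt_profileInt (t : ℝ) : HasDerivAt profileInt (-(2⁻¹ * profile t)) t := by
  have hc := contDiff_profile.continuous
  have := (intervalIntegral.integral_hasDerivAt_left (hc.intervalIntegrable t 1)
    (hc.stronglyMeasurableAtFilter _ _) hc.continuousAt).const_mul (2⁻¹ : ℝ)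
  rwa [mul_neg] at this

lemma contDiff_profileInt : ContDiff ℝ ∞ profileInt := by
  refine contDiff_infty_iff_deriv.2 ⟨fun t => (hasDerivAt_profileInt t).differentiableAt, ?_⟩
  have : deriv profileInt = fun t => -(2⁻¹ * profile t) :=
    funext fun t => (hasDerivAt_profileInt t).deriv
  rw [this]
  exact (contDiff_const.mul contDiff_profile).neg

lemma profileInt_eq_zero {t : ℝ} (ht : 1 ≤ t) : profileInt t = 0 := by
  rw [profileInt, intervalIntegral.integral_zero_ae, mul_zero]
  refine Eventually.of_forall fun s hs => profile_eq_zero ?_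
  rw [uIoc_of_ge ht] at hs
  exact hs.1.le

lemma profileInt_nonneg (t : ℝ) : 0 ≤ profileInt t := by
  rcases le_total 1 t with ht | ht
  · rw [profileInt_eq_zero ht]
  · exact mul_nonneg (by norm_num)
      (intervalIntegral.integral_nonneg ht fun s _ => profile_nonneg s)

/-- Both functions are continuous on `[0, 1]` and vanish beyond. They are the two terms in the
Laplacian of the radial potential. -/
lemma exists_bound_profile : ∃ C, 0 ≤ C ∧ ∀ t, 0 ≤ t → |profile t| ≤ C ∧ |t * deriv profile t| ≤ C := by
  obtain ⟨C, hC⟩ := isCompact_Icc.exists_bound_of_continuousOn (s := Icc (0 : ℝ) 1)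
    contDiff_profile.continuous.continuousOn
  obtain ⟨D, hD⟩ := isCompact_Icc.exists_bound_of_continuousOn (s := Icc (0 : ℝ) 1)
    (continuous_id.mul continuous_deriv_profile).continuousOn
  have hC0 : 0 ≤ C := (norm_nonneg _).trans (hC 0 (by simp))
  refine ⟨max C D, le_max_of_le_left hC0, fun t ht => ?_⟩
  rcases le_or_gt t 1 with h1 | h1
  · exact ⟨(hC t ⟨ht, h1⟩).trans (le_max_left _ _), (hD t ⟨ht, h1⟩).trans (le_max_right _ _)⟩
  · rw [profile_eq_zero h1.le, deriv_profile_eq_zero h1]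
    simp [hC0]

end Profile

/-! ### Radial potentials and the radial mollifier. -/

section Radial

variable {n : ℕ}

lemma pderiv_eq_of_hasDerivAt {η : Euc n → ℝ} (h : ContDiff ℝ ∞ η) {i : Fin n} {x : Euc n} {d : ℝ}
    (hd : HasDerivAt (fun t : ℝ => η (x + t • stdVec i)) d 0) : pderiv i η x = d := by
  have := hasDerivAt_line h i x 0
  rw [zero_smul, add_zero] at this
  exact this.unique hd

lemma norm_line_sq (z x : Euc n) (i : Fin n) (t : ℝ) :
    ‖z + t • stdVec i - x‖ ^ 2 = ‖z - x‖ ^ 2 + 2 * t * (z i - x i) + t ^ 2 := by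
  have : z + t • stdVec i - x = (z - x) + t • stdVec i := by abel
  rw [this, norm_add_sq_real, norm_smul, norm_stdVec, inner_smul_right]
  have h2 : inner ℝ (z - x) (stdVec i) = z i - x i := by
    simp [stdVec, EuclideanSpace.inner_single_right]
  rw [h2]
  simp
  ring

lemma hasDerivAt_norm_line_sq (z x : Euc n) (i : Fin n) (c : ℝ) :
    HasDerivAt (fun t : ℝ => c * ‖z + t • stdVec i - x‖ ^ 2) (c * (2 * (z i - x i))) 0 := by
  simp_rw [norm_line_sq]
  have h1 : HasDerivAt (fun t : ℝ => ‖z - x‖ ^ 2 + 2 * t * (z i - x i) + t ^ 2)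
      (2 * (z i - x i)) 0 := by
    have ha : HasDerivAt (fun t : ℝ => 2 * t * (z i - x i)) (2 * 1 * (z i - x i)) 0 :=
      ((hasDerivAt_id (0 : ℝ)).const_mul 2).mul_const _
    have := ((ha.const_add (‖z - x‖ ^ 2)).add (hasDerivAt_pow 2 (0 : ℝ)))
    refine HasDerivAt.congr_deriv (f := fun t : ℝ => ‖z - x‖ ^ 2 + 2 * t * (z i - x i) + t ^ 2)
      this ?_
    simp
  exact h1.const_mul c

lemma contDiff_radial {F : ℝ → ℝ} (hF : ContDiff ℝ ∞ F) (x : Euc n) (c : ℝ) :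
    ContDiff ℝ ∞ (fun z : Euc n => F (c * ‖z - x‖ ^ 2)) :=
  hF.comp (contDiff_const.mul ((contDiff_id.sub contDiff_const).norm_sq ℝ))

/-- The factor one half in `profileInt` cancels the 2 from differentiating the squared norm. -/
lemma pderiv_radial_profileInt (x : Euc n) (c : ℝ) (i : Fin n) :
    pderiv i (fun z => profileInt (c * ‖z - x‖ ^ 2))
      = fun z => -c * (profile (c * ‖z - x‖ ^ 2) * (z i - x i)) := by
  ext z
  refine pderiv_eq_of_hasDerivAt (contDiff_radial contDiff_profileInt x c) ?_
  have h2 : HasDerivAt profileInt _ (c * ‖z + (0 : ℝ) • stdVec i - x‖ ^ 2) :=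
    hasDerivAt_profileInt _
  have := h2.comp 0 (hasDerivAt_norm_line_sq z x i c)
  refine HasDerivAt.congr_deriv (f := fun t : ℝ => profileInt (c * ‖z + t • stdVec i - x‖ ^ 2))
    this ?_
  rw [zero_smul, add_zero]
  ring

lemma pderiv_pderiv_radial_profileInt (x : Euc n) (c : ℝ) (i : Fin n) (z : Euc n) :
    pderiv i (pderiv i (fun z => profileInt (c * ‖z - x‖ ^ 2))) z
      = -c * (profile (c * ‖z - x‖ ^ 2)
        + 2 * c * (z i - x i) ^ 2 * deriv profile (c * ‖z - x‖ ^ 2)) := by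
  refine pderiv_eq_of_hasDerivAt
    (contDiff_pderiv (contDiff_radial contDiff_profileInt x c) i) ?_
  rw [pderiv_radial_profileInt]
  have h2 : HasDerivAt profile _ (c * ‖z + (0 : ℝ) • stdVec i - x‖ ^ 2) := hasDerivAt_profile _
  have h3 := h2.comp 0 (hasDerivAt_norm_line_sq z x i c)
  have h4 : HasDerivAt (fun t : ℝ => (z + t • stdVec i) i - x i) 1 0 := by
    have : (fun t : ℝ => (z + t • stdVec i) i - x i) = fun t => z i + t - x i := by
      ext t; simp [stdVec]
    rw [this]
    exact ((hasDerivAt_id (0 : ℝ)).const_add _).sub_const _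
  have := (h3.mul h4).const_mul (-c)
  refine HasDerivAt.congr_deriv (f := fun t : ℝ => -c * (profile
    (c * ‖z + t • stdVec i - x‖ ^ 2) * ((z + t • stdVec i) i - x i))) this ?_
  simp only [Function.comp, zero_smul, add_zero]
  ring

/-- With `t = c |z - x|²`, the combination `n p(t) + 2 t p'(t)` of the profile `p` is, up to a
factor, also what differentiating `r⁻ⁿ p(|z|² / r²)` in `r` produces. This coincidence links the
Laplacian to the growth of averages. -/
lemma lap_radial_profileInt (x : Euc n) (c : ℝ) (z : Euc n) :
    lap (fun z => profileInt (c * ‖z - x‖ ^ 2)) z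
      = -c * (n * profile (c * ‖z - x‖ ^ 2)
        + 2 * (c * ‖z - x‖ ^ 2) * deriv profile (c * ‖z - x‖ ^ 2)) := by
  have hn : ‖z - x‖ ^ 2 = ∑ i, (z i - x i) ^ 2 := by
    rw [EuclideanSpace.norm_sq_eq]; simp
  simp_rw [lap, pderiv_pderiv_radial_profileInt]
  rw [← Finset.mul_sum, Finset.sum_add_distrib, Finset.sum_const, Finset.card_univ,
    Fintype.card_fin, nsmul_eq_mul]
  congr 2
  rw [← Finset.sum_mul, ← Finset.mul_sum, ← hn]
  ring

/-- The function `z ↦ H(|z - x|² / r²)` whose Laplacian drives the radial mollification. -/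
def radialPotential (r : ℝ) (x z : Euc n) : ℝ := profileInt ((r ^ 2)⁻¹ * ‖z - x‖ ^ 2)

lemma isTest_radial {F : ℝ → ℝ} (hF : ContDiff ℝ ∞ F) (hF0 : ∀ t, 1 ≤ t → F t = 0) {r : ℝ}
    (hr : 0 < r) {x : Euc n} {Ω : Set (Euc n)} (hx : Metric.closedBall x r ⊆ Ω) :
    IsTest Ω (fun z => F ((r ^ 2)⁻¹ * ‖z - x‖ ^ 2)) := by
  have hs : Function.support (fun z => F ((r ^ 2)⁻¹ * ‖z - x‖ ^ 2)) ⊆ Metric.closedBall x r := by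
    intro z hz
    by_contra hz'
    refine hz (hF0 _ ?_)
    rw [Metric.mem_closedBall, dist_eq_norm, not_le] at hz'
    rw [inv_mul_eq_div, le_div_iff₀ (by positivity), one_mul]
    gcongr
  have ht := closure_minimal hs Metric.isClosed_closedBall
  exact ⟨contDiff_radial hF x _, HasCompactSupport.of_support_subset_isCompact
    (isCompact_closedBall x r) hs, ht.trans hx⟩

lemma isTest_radialPotential {r : ℝ} (hr : 0 < r) {x : Euc n} {Ω : Set (Euc n)}
    (hx : Metric.closedBall x r ⊆ Ω) : IsTest Ω (radialPotential r x) :=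
  isTest_radial contDiff_profileInt (fun _ => profileInt_eq_zero) hr hx

/-- The integral of the radial profile. -/
def mollMass (n : ℕ) : ℝ := ∫ x : Euc n, profile (‖x‖ ^ 2)

/-- The radial mollifier of radius `r`. -/
def moll (r : ℝ) (z : Euc n) : ℝ :=
  (mollMass n)⁻¹ * ((r ^ n)⁻¹ * profile ((r ^ 2)⁻¹ * ‖z‖ ^ 2))

lemma isTest_moll {r : ℝ} (hr : 0 < r) {x : Euc n} {Ω : Set (Euc n)}
    (hx : Metric.closedBall x r ⊆ Ω) : IsTest Ω (fun y => moll r (x - y)) := by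
  have h : IsTest Ω (fun z => (fun t => (mollMass n)⁻¹ * ((r ^ n)⁻¹ * profile t))
      ((r ^ 2)⁻¹ * ‖z - x‖ ^ 2)) :=
    isTest_radial (contDiff_const.mul (contDiff_const.mul contDiff_profile))
      (fun t ht => by rw [profile_eq_zero ht]; simp) hr hx
  simp_rw [moll, norm_sub_rev x]
  exact h

lemma isTest_moll_zero {r : ℝ} (hr : 0 < r) : IsTest (univ : Set (Euc n)) (moll r) := by
  have h : IsTest (univ : Set (Euc n)) (fun z => (fun t => (mollMass n)⁻¹ * ((r ^ n)⁻¹ * profile t))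
      ((r ^ 2)⁻¹ * ‖z - 0‖ ^ 2)) :=
    isTest_radial (contDiff_const.mul (contDiff_const.mul contDiff_profile))
      (fun t ht => by rw [profile_eq_zero ht]; simp) hr (subset_univ _)
  simp_rw [sub_zero] at h
  exact h

lemma mollMass_pos : 0 < mollMass n := by
  have h : IsTest (univ : Set (Euc n)) (fun z => profile ((1 ^ 2 : ℝ)⁻¹ * ‖z - 0‖ ^ 2)) :=
    isTest_radial contDiff_profile (fun t ht => profile_eq_zero ht) one_pos (subset_univ _)
  have e : (fun z : Euc n => profile ((1 ^ 2 : ℝ)⁻¹ * ‖z - 0‖ ^ 2)) = fun z => profile (‖z‖ ^ 2) := by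
    simp
  rw [e] at h
  exact h.continuous.integral_pos_of_hasCompactSupport_nonneg_nonzero h.2.1
    (fun x => profile_nonneg _) (x := 0) (by
      simpa using (profile_pos (show (0 : ℝ) < 1 by norm_num)).ne')

lemma moll_nonneg {r : ℝ} (hr : 0 < r) (z : Euc n) : 0 ≤ moll r z :=
  mul_nonneg (inv_nonneg.2 mollMass_pos.le)
    (mul_nonneg (by positivity) (profile_nonneg _))

lemma moll_pos {r : ℝ} (hr : 0 < r) {z : Euc n} (hz : ‖z‖ < r) : 0 < moll r z := by
  refine mul_pos (inv_pos.2 mollMass_pos) (mul_pos (by positivity) (profile_pos ?_))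
  rw [inv_mul_eq_div, div_lt_one (by positivity)]
  gcongr

lemma moll_eq_zero {r : ℝ} (hr : 0 < r) {z : Euc n} (hz : r ≤ ‖z‖) : moll r z = 0 := by
  have : profile ((r ^ 2)⁻¹ * ‖z‖ ^ 2) = 0 := by
    apply profile_eq_zero
    rw [inv_mul_eq_div, le_div_iff₀ (by positivity), one_mul]
    gcongr
  rw [moll, this]; simp

lemma moll_neg (r : ℝ) (z : Euc n) : moll r (-z) = moll r z := by simp [moll]

lemma moll_smul {r s : ℝ} (hr : r ≠ 0) (z : Euc n) :
    moll s z = r ^ n * moll (r * s) (r • z) := by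
  simp only [moll, norm_smul, mul_pow, mul_inv, Real.norm_eq_abs, sq_abs]
  have : (r ^ 2)⁻¹ * (s ^ 2)⁻¹ * (r ^ 2 * ‖z‖ ^ 2) = (s ^ 2)⁻¹ * ‖z‖ ^ 2 := by
    field_simp
  rw [this]
  field_simp

lemma integral_moll {r : ℝ} (hr : 0 < r) : ∫ z : Euc n, moll r z = 1 := by
  have h1 : ∫ z : Euc n, moll 1 z = 1 := by
    simp only [moll, one_pow, inv_one, one_mul]
    rw [integral_const_mul]
    exact inv_mul_cancel₀ mollMass_pos.ne'
  have h2 := integral_comp_affine (fun z : Euc n => moll r z) 0 hr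
  simp only [zero_add] at h2
  have h3 : ∀ z : Euc n, moll r (r • z) = (r ^ n)⁻¹ * moll 1 z := fun z => by
    rw [moll_smul hr.ne' z (s := 1), mul_one]
    field_simp
  simp_rw [h3] at h2
  rw [integral_const_mul, h1, smul_eq_mul] at h2
  have : (r ^ n)⁻¹ ≠ 0 := by positivity
  exact (mul_left_cancel₀ this h2).symm

end Radial

/-! ### Monotonicity of averages in the radius. -/

section Averages

variable {n : ℕ} {G : Type*} [NormedAddCommGroup G] [NormedSpace ℝ G]

/-- The derivative of the mollifier with respect to its radius. -/
lemma hasDerivAt_moll {r : ℝ} (hr : 0 < r) (x y : Euc n) :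
    HasDerivAt (fun s => moll s (x - y))
      ((mollMass n)⁻¹ * ((r ^ n)⁻¹ * (r * lap (radialPotential r x) y))) r := by
  have h1 : HasDerivAt (fun s : ℝ => (s ^ 2)⁻¹ * ‖x - y‖ ^ 2)
      (-(2 * r) / (r ^ 2) ^ 2 * ‖x - y‖ ^ 2) r := by
    have := ((hasDerivAt_pow 2 r).inv (by positivity)).mul_const (‖x - y‖ ^ 2)
    simpa using this
  have h2 : HasDerivAt (fun s : ℝ => (s ^ n)⁻¹) (-(n * r ^ (n - 1)) / (r ^ n) ^ 2) r := by
    exact (hasDerivAt_pow n r).inv (by positivity)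
  have h3 := (h2.mul ((hasDerivAt_profile _).comp r h1)).const_mul (mollMass n)⁻¹
  refine h3.congr_deriv ?_
  unfold radialPotential
  rw [lap_radial_profileInt, norm_sub_rev y x]
  simp only [Function.comp]
  congr 1
  -- The derivative of `s ^ n` contains the truncated exponent `n - 1`, so dimension zero is
  -- separate.
  rcases n with _ | n
  · simp; field_simp
  · simp only [Nat.add_sub_cancel]
    field_simp
    ring

/-- Keeping the radius away from zero gives one constant for all centres, which is the domination
needed to differentiate averages under the integral sign. -/
lemma exists_bound_deriv_moll (n : ℕ) {r₀ : ℝ} (hr₀ : 0 < r₀) :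
    ∃ C, 0 ≤ C ∧ ∀ r, r₀ ≤ r → ∀ x y : Euc n,
      |(mollMass n)⁻¹ * ((r ^ n)⁻¹ * (r * lap (radialPotential r x) y))| ≤ C := by
  obtain ⟨C, hC0, hC⟩ := exists_bound_profile
  have hm := mollMass_pos (n := n)
  refine ⟨(mollMass n)⁻¹ * ((r₀ ^ n)⁻¹ * (r₀⁻¹ * (n * C + 2 * C))), by positivity,
    fun r hr x y => ?_⟩
  have hr' : 0 < r := hr₀.trans_le hr
  have ht : 0 ≤ (r ^ 2)⁻¹ * ‖y - x‖ ^ 2 := by positivity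
  obtain ⟨h1, h2⟩ := hC _ ht
  unfold radialPotential
  rw [lap_radial_profileInt]
  set t := (r ^ 2)⁻¹ * ‖y - x‖ ^ 2
  have e : r * (-(r ^ 2)⁻¹ * (n * profile t + 2 * t * deriv profile t))
      = -(r⁻¹ * (n * profile t + 2 * (t * deriv profile t))) := by
    field_simp
  rw [e, abs_mul, abs_mul, abs_neg, abs_mul, abs_of_pos (inv_pos.2 hm),
    abs_of_pos (show 0 < (r ^ n)⁻¹ by positivity), abs_of_pos (inv_pos.2 hr')]
  have h3 : |n * profile t + 2 * (t * deriv profile t)| ≤ n * C + 2 * C := by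
    refine (abs_add_le _ _).trans (add_le_add ?_ ?_)
    · rw [abs_mul, Nat.abs_cast]; gcongr
    · rw [abs_mul, abs_two]; gcongr
  gcongr

/-- The average of `w` around `x` with respect to the radial mollifier of radius `r`. -/
def avg (w : Euc n → G) (r : ℝ) (x : Euc n) : G := ∫ y, moll r (x - y) • w y

lemma avg_integrable {w : Euc n → G} (hw : Integrable w) {r : ℝ} (hr : 0 < r) (x : Euc n) :
    Integrable (fun y => moll r (x - y) • w y) :=
  (isTest_moll hr (subset_univ _)).integrable_smul (hw.locallyIntegrable.locallyIntegrableOn _)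

/-- The prefactor is positive and the potential is a nonnegative test function once the closed ball
lies in the domain. The sign of the distributional Laplacian of `w` therefore decides how its
averages vary with the radius. -/
lemma hasDerivAt_avg {w : Euc n → G} (hw : Integrable w) {r : ℝ} (hr : 0 < r) (x : Euc n) :
    HasDerivAt (fun s => avg w s x)
      (((mollMass n)⁻¹ * ((r ^ n)⁻¹ * r)) • ∫ y, lap (radialPotential r x) y • w y) r := by
  obtain ⟨C, hC0, hC⟩ := exists_bound_deriv_moll n (half_pos hr)
  have hmeas : ∀ s, 0 < s → Continuous fun y : Euc n => lap (radialPotential s x) y := fun s hs =>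
    (isTest_radialPotential hs (subset_univ _)).lap_isTest.continuous
  have h := (hasDerivAt_integral_of_dominated_loc_of_deriv_le (μ := (volume : Measure (Euc n)))
    (F := fun s y => moll s (x - y) • w y) (x₀ := r) (s := Ioi (r / 2))
    (F' := fun s y => ((mollMass n)⁻¹ * ((s ^ n)⁻¹ * (s * lap (radialPotential s x) y))) • w y)
    (bound := fun y => C * ‖w y‖) (Ioi_mem_nhds (half_lt_self hr)) ?_ ?_ ?_ ?_ ?_ ?_).2
  · refine h.congr_deriv ?_
    rw [← integral_smul]
    refine integral_congr_ae (Eventually.of_forall fun y => ?_)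
    simp only [smul_smul]
    congr 1
    ring
  · filter_upwards [lt_mem_nhds hr] with s hs
    exact (avg_integrable hw hs x).aestronglyMeasurable
  · exact avg_integrable hw hr x
  · refine AEStronglyMeasurable.smul ?_ hw.aestronglyMeasurable
    have := hmeas r hr
    exact Continuous.aestronglyMeasurable (by fun_prop)
  · refine Eventually.of_forall fun y s hs => ?_
    rw [norm_smul]
    exact mul_le_mul_of_nonneg_right (hC s (le_of_lt hs) x y) (norm_nonneg _)
  · exact hw.norm.const_mul C
  · refine Eventually.of_forall fun y s hs => ?_
    exact (hasDerivAt_moll ((half_pos hr).trans hs) x y).smul_const (w y)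

/-- The averages of a distributionally subharmonic function increase with the radius. -/
lemma avg_mono {w : Euc n → ℝ} (hw : Integrable w) {Ω : Set (Euc n)}
    (hsub : ∀ η, IsTest Ω η → (∀ x, 0 ≤ η x) → 0 ≤ ∫ x, lap η x • w x) {x : Euc n} {r R : ℝ}
    (hr : 0 < r) (hrR : r ≤ R) (hR : Metric.closedBall x R ⊆ Ω) : avg w r x ≤ avg w R x := by
  refine monotoneOn_of_deriv_nonneg (convex_Icc r R) (f := fun s => avg w s x) ?_ ?_ ?_
    ⟨le_rfl, hrR⟩ ⟨hrR, le_rfl⟩ hrR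
  · exact fun s hs => (hasDerivAt_avg hw (hr.trans_le hs.1) x).continuousAt.continuousWithinAt
  · intro s hs
    rw [interior_Icc] at hs
    exact (hasDerivAt_avg hw (hr.trans hs.1) x).differentiableAt.differentiableWithinAt
  · intro s hs
    rw [interior_Icc] at hs
    have hs0 := hr.trans hs.1
    rw [(hasDerivAt_avg hw hs0 x).deriv]
    have hm := mollMass_pos (n := n)
    refine mul_nonneg (by positivity) (hsub _ ?_ fun z => profileInt_nonneg _)
    exact isTest_radialPotential hs0 ((Metric.closedBall_subset_closedBall hs.2.le).trans hR)

/-- The averages of a distributionally harmonic function do not depend on the radius. -/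
lemma avg_eq_of_harmonic {w : Euc n → G} (hw : Integrable w) {Ω : Set (Euc n)}
    (hharm : ∀ η, IsTest Ω η → ∫ x, lap η x • w x = 0) {x : Euc n} {r R : ℝ}
    (hr : 0 < r) (hrR : r ≤ R) (hR : Metric.closedBall x R ⊆ Ω) : avg w R x = avg w r x := by
  refine constant_of_has_deriv_right_zero (f := fun s => avg w s x) (a := r) (b := R) ?_ ?_ R
    ⟨hrR, le_rfl⟩
  · exact fun s hs => (hasDerivAt_avg hw (hr.trans_le hs.1) x).continuousAt.continuousWithinAt
  · intro s hs
    have hs0 := hr.trans_le hs.1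
    have h := hasDerivAt_avg hw hs0 x
    rw [hharm _ (isTest_radialPotential hs0
      ((Metric.closedBall_subset_closedBall hs.2.le).trans hR)), smul_zero] at h
    exact h.hasDerivWithinAt

end Averages

end ConstraintMap

end

noncomputable section

namespace ConstraintMap

/-! ### Convolution and its difference quotients. -/

section Convolution

variable {n : ℕ} {G : Type*} [NormedAddCommGroup G] [NormedSpace ℝ G] {Ω : Set (Euc n)}
  {ψ : Euc n → ℝ} {f g : Euc n → G}

/-- The convolution of a test function with an integrable map. -/
def conv (ψ : Euc n → ℝ) (f : Euc n → G) (x : Euc n) : G := ∫ y, ψ (x - y) • f y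

lemma conv_integrable (hψ : IsTest Ω ψ) (hf : Integrable f) (x : Euc n) :
    Integrable (fun y => ψ (x - y) • f y) := by
  obtain ⟨C, hC0, hC⟩ := hψ.bounded
  have hc := hψ.continuous
  exact hf.bdd_smul C (Continuous.aestronglyMeasurable (by fun_prop))
    (Eventually.of_forall fun y => hC _)

lemma continuous_conv (hψ : IsTest Ω ψ) (hf : Integrable f) : Continuous (conv ψ f) := by
  obtain ⟨C, hC0, hC⟩ := hψ.bounded
  have hc := hψ.continuous
  refine continuous_of_dominated (bound := fun y => C * ‖f y‖) (fun x => ?_) (fun x => ?_)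
    (hf.norm.const_mul C) (Eventually.of_forall fun y => by fun_prop)
  · exact (conv_integrable hψ hf x).aestronglyMeasurable
  · exact Eventually.of_forall fun y => by
      rw [norm_smul]; exact mul_le_mul_of_nonneg_right (hC _) (norm_nonneg _)

lemma norm_conv_le {C : ℝ} (hC : ∀ x, |ψ x| ≤ C) (hf : Integrable f) (x : Euc n) :
    ‖conv ψ f x‖ ≤ C * ∫ y, ‖f y‖ := by
  rw [← integral_const_mul]
  refine norm_integral_le_of_norm_le (hf.norm.const_mul C) (Eventually.of_forall fun y => ?_)
  rw [norm_smul]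
  exact mul_le_mul_of_nonneg_right (hC _) (norm_nonneg _)

lemma conv_add (hψ : IsTest Ω ψ) (hf : Integrable f) (hg : Integrable g) (x : Euc n) :
    conv ψ (f + g) x = conv ψ f x + conv ψ g x := by
  simp only [conv, Pi.add_apply, smul_add]
  exact integral_add (conv_integrable hψ hf x) (conv_integrable hψ hg x)

/-- Young's inequality for `L¹`, from Tonelli and translation invariance. -/
lemma lintegral_conv_le (hψ : IsTest Ω ψ) (hf : Integrable f) :
    ∫⁻ x, ‖conv ψ f x‖ₑ ≤ (∫⁻ x, ‖ψ x‖ₑ) * ∫⁻ x, ‖f x‖ₑ := by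
  have hc := hψ.continuous
  calc ∫⁻ x, ‖conv ψ f x‖ₑ ≤ ∫⁻ x, ∫⁻ y, ‖ψ (x - y)‖ₑ * ‖f y‖ₑ := by
        refine lintegral_mono fun x => (enorm_integral_le_lintegral_enorm _).trans ?_
        exact le_of_eq (lintegral_congr fun y => enorm_smul _ _)
    _ = ∫⁻ y, ∫⁻ x, ‖ψ (x - y)‖ₑ * ‖f y‖ₑ := by
        refine lintegral_lintegral_swap ?_
        refine AEMeasurable.mul (f := fun p : Euc n × Euc n => ‖ψ (p.1 - p.2)‖ₑ)
          (g := fun p => ‖f p.2‖ₑ) ?_ ?_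
        · exact (Continuous.aestronglyMeasurable (f := fun p : Euc n × Euc n => ψ (p.1 - p.2))
            (by fun_prop)).enorm
        · exact (hf.aestronglyMeasurable.comp_snd).enorm
    _ = ∫⁻ y, (∫⁻ x, ‖ψ x‖ₑ) * ‖f y‖ₑ := by
        refine lintegral_congr fun y => ?_
        have hm : Measurable fun x => ‖ψ x‖ₑ := hc.measurable.enorm
        rw [lintegral_mul_const _ (by exact hm.comp (measurable_id.sub_const y))]
        congr 1
        exact lintegral_sub_right_eq_self (fun x => ‖ψ x‖ₑ) y
    _ = _ := lintegral_const_mul'' _ hf.aestronglyMeasurable.enorm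

lemma integrable_conv (hψ : IsTest Ω ψ) (hf : Integrable f) : Integrable (conv ψ f) := by
  refine ⟨(continuous_conv hψ hf).aestronglyMeasurable, (lintegral_conv_le hψ hf).trans_lt ?_⟩
  exact ENNReal.mul_lt_top (hψ.continuous.integrable_of_hasCompactSupport hψ.2.1).2 hf.2

/-- Uniformly bounded kernels are dominated by `C * ‖f‖`. Applied to difference quotients of the
kernel, this takes the place of differentiation under the integral sign. -/
lemma tendsto_conv {F : ℕ → Euc n → ℝ} (hF : ∀ k, Continuous (F k)) {C : ℝ}
    (hC : ∀ k x, |F k x| ≤ C) (hlim : ∀ x, Tendsto (fun k => F k x) atTop (𝓝 (ψ x)))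
    (hf : Integrable f) (x : Euc n) :
    Tendsto (fun k => conv (F k) f x) atTop (𝓝 (conv ψ f x)) := by
  refine tendsto_integral_of_dominated_convergence (fun y => C * ‖f y‖) (fun k => ?_)
    (hf.norm.const_mul C) (fun k => Eventually.of_forall fun y => ?_)
    (Eventually.of_forall fun y => (hlim _).smul_const _)
  · have := hF k
    exact AEStronglyMeasurable.smul (Continuous.aestronglyMeasurable (by fun_prop))
      hf.aestronglyMeasurable
  · rw [norm_smul]
    exact mul_le_mul_of_nonneg_right (hC _ _) (norm_nonneg _)

lemma IsTest.comp_add_const (hψ : IsTest Ω ψ) (a : Euc n) :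
    IsTest univ (fun x => ψ (x + a)) := by
  have := hψ.comp_affine (Ω' := univ) a one_ne_zero (fun _ _ => mem_univ _)
  simpa [add_comm] using this

/-- Difference quotients fall on the kernel, so the bounds for test functions carry over and
smoothness of the convolution itself need not be discussed. -/
lemma secondDiff_conv (hψ : IsTest Ω ψ) (hf : Integrable f) (i : Fin n) (h : ℝ) (x : Euc n) :
    secondDiff i h (conv ψ f) x = conv (secondDiff i h ψ) f x := by
  simp only [secondDiff, conv]
  have e1 : Integrable fun y => ψ (x + h • stdVec i - y) • f y := conv_integrable hψ hf _
  have e2 : Integrable fun y => ψ (x - h • stdVec i - y) • f y := conv_integrable hψ hf _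
  have e3 : Integrable fun y => (2 : ℝ) • ψ (x - y) • f y := (conv_integrable hψ hf _).smul _
  rw [← integral_smul, ← integral_add e1 e2, ← integral_sub (by exact e1.add e2) e3, ← integral_smul]
  refine integral_congr_ae (Eventually.of_forall fun y => ?_)
  simp only [show x - y + h • stdVec i = x + h • stdVec i - y by abel,
    show x - y - h • stdVec i = x - h • stdVec i - y by abel, smul_eq_mul]
  module

lemma continuous_secondDiff {E : Type*} [NormedAddCommGroup E] [NormedSpace ℝ E] {v : Euc n → E}
    (hv : Continuous v) (i : Fin n) (h : ℝ) : Continuous (secondDiff i h v) := by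
  unfold secondDiff
  fun_prop

lemma exists_bound_secondDiff (hψ : IsTest Ω ψ) (i : Fin n) :
    ∃ C, 0 ≤ C ∧ ∀ h, 0 < h → ∀ x, |secondDiff i h ψ x| ≤ C := by
  obtain ⟨C, hC0, hC⟩ := ((hψ.isTest_pderiv i).isTest_pderiv i).bounded
  refine ⟨C, hC0, fun h hh x => ?_⟩
  obtain ⟨s, _, hs⟩ := exists_secondDiff_eq hψ.1 i x hh
  rw [hs]
  exact hC _

lemma exists_bound_secondDiff_conv (hψ : IsTest Ω ψ) (hf : Integrable f) (i : Fin n) :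
    ∃ C, 0 ≤ C ∧ ∀ h, 0 < h → ∀ x, ‖secondDiff i h (conv ψ f) x‖ ≤ C := by
  obtain ⟨C, hC0, hC⟩ := exists_bound_secondDiff hψ i
  refine ⟨C * ∫ y, ‖f y‖, by positivity, fun h hh x => ?_⟩
  rw [secondDiff_conv hψ hf]
  exact norm_conv_le (hC h hh) hf x

lemma tendsto_secondDiff_conv (hψ : IsTest Ω ψ) (hf : Integrable f) {t : ℕ → ℝ}
    (ht : Tendsto t atTop (𝓝 0)) (hpos : ∀ k, 0 < t k) (i : Fin n) (x : Euc n) :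
    Tendsto (fun k => secondDiff i (t k) (conv ψ f) x) atTop
      (𝓝 (conv (pderiv i (pderiv i ψ)) f x)) := by
  obtain ⟨C, hC0, hC⟩ := exists_bound_secondDiff hψ i
  simp_rw [secondDiff_conv hψ hf]
  exact tendsto_conv (fun k => continuous_secondDiff hψ.continuous i _) (fun k => hC _ (hpos k))
    (tendsto_secondDiff hψ.1 ht hpos i) hf x

/-- The forward difference quotient in the direction `i`. -/
def fwdDiffQuot (i : Fin n) (h : ℝ) (f : Euc n → G) (x : Euc n) : G :=
  h⁻¹ • (f (x + h • stdVec i) - f x)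

lemma fwdDiffQuot_conv (hψ : IsTest Ω ψ) (hf : Integrable f) (i : Fin n) (h : ℝ) (x : Euc n) :
    fwdDiffQuot i h (conv ψ f) x = conv (fwdDiffQuot i h ψ) f x := by
  simp only [fwdDiffQuot, conv]
  have e1 : Integrable fun y => ψ (x + h • stdVec i - y) • f y := conv_integrable hψ hf _
  rw [← integral_sub e1 (conv_integrable hψ hf x), ← integral_smul]
  refine integral_congr_ae (Eventually.of_forall fun y => ?_)
  simp only [show x - y + h • stdVec i = x + h • stdVec i - y by abel, smul_eq_mul]
  module

lemma exists_bound_fwdDiffQuot (hψ : IsTest Ω ψ) (i : Fin n) :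
    ∃ C, 0 ≤ C ∧ ∀ h, 0 < h → ∀ x, |fwdDiffQuot i h ψ x| ≤ C := by
  obtain ⟨C, hC0, hC⟩ := (hψ.isTest_pderiv i).bounded
  refine ⟨C, hC0, fun h hh x => ?_⟩
  obtain ⟨s, _, hs⟩ := exists_diff_eq hψ.1 i x hh
  rw [fwdDiffQuot, smul_eq_mul, hs]
  exact hC _

lemma exists_bound_fwdDiffQuot_conv (hψ : IsTest Ω ψ) (hf : Integrable f) (i : Fin n) :
    ∃ C, 0 ≤ C ∧ ∀ h, 0 < h → ∀ x, ‖fwdDiffQuot i h (conv ψ f) x‖ ≤ C := by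
  obtain ⟨C, hC0, hC⟩ := exists_bound_fwdDiffQuot hψ i
  refine ⟨C * ∫ y, ‖f y‖, by positivity, fun h hh x => ?_⟩
  rw [fwdDiffQuot_conv hψ hf]
  exact norm_conv_le (hC h hh) hf x

lemma tendsto_fwdDiffQuot_conv (hψ : IsTest Ω ψ) (hf : Integrable f) {t : ℕ → ℝ}
    (ht : Tendsto t atTop (𝓝 0)) (hpos : ∀ k, 0 < t k) (i : Fin n) (x : Euc n) :
    Tendsto (fun k => fwdDiffQuot i (t k) (conv ψ f) x) atTop (𝓝 (conv (pderiv i ψ) f x)) := by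
  obtain ⟨C, hC0, hC⟩ := exists_bound_fwdDiffQuot hψ i
  simp_rw [fwdDiffQuot_conv hψ hf]
  refine tendsto_conv (fun k => ?_) (fun k => hC _ (hpos k))
    (tendsto_diff hψ.1 ht hpos i) hf x
  have := hψ.continuous
  unfold fwdDiffQuot
  fun_prop

end Convolution

/-! ### Convergence of mollifications in the mean and almost everywhere. -/

section Mollification

variable {n : ℕ} {G : Type*} [NormedAddCommGroup G] [NormedSpace ℝ G] {w : Euc n → G}

lemma avg_eq_conv (w : Euc n → G) (r : ℝ) : avg w r = conv (moll r) w := rfl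

lemma continuous_avg (hw : Integrable w) {r : ℝ} (hr : 0 < r) : Continuous (avg w r) :=
  continuous_conv (isTest_moll_zero hr) hw

lemma integrable_avg (hw : Integrable w) {r : ℝ} (hr : 0 < r) : Integrable (avg w r) :=
  integrable_conv (isTest_moll_zero hr) hw

lemma lintegral_moll {r : ℝ} (hr : 0 < r) : ∫⁻ z : Euc n, ‖moll r z‖ₑ = 1 := by
  have hi : Integrable (moll (n := n) r) :=
    (isTest_moll_zero hr).continuous.integrable_of_hasCompactSupport (isTest_moll_zero hr).2.1
  have h := ofReal_integral_norm_eq_lintegral_enorm hi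
  simp_rw [Real.norm_of_nonneg (moll_nonneg hr _)] at h
  rw [integral_moll hr, ENNReal.ofReal_one] at h
  exact h.symm

lemma integral_moll_sub {r : ℝ} (hr : 0 < r) (x : Euc n) : ∫ y : Euc n, moll r (x - y) = 1 := by
  rw [integral_sub_left_eq_self (fun z : Euc n => moll r z) volume x, integral_moll hr]

lemma integrable_moll_sub {r : ℝ} (hr : 0 < r) (x : Euc n) :
    Integrable (fun y : Euc n => moll r (x - y)) := by
  have h := isTest_moll (x := x) hr (subset_univ _)
  exact h.continuous.integrable_of_hasCompactSupport h.2.1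

/-- If `w` is within `ε` of a constant near `x`, so are its averages. -/
lemma norm_avg_sub_le [CompleteSpace G] (hw : Integrable w) {r : ℝ} (hr : 0 < r) (x : Euc n)
    (c : G) {ε : ℝ} (h : ∀ᵐ y, y ∈ Metric.ball x r → ‖w y - c‖ ≤ ε) : ‖avg w r x - c‖ ≤ ε := by
  have e : avg w r x - c = ∫ y, moll r (x - y) • (w y - c) := by
    simp_rw [smul_sub]
    rw [integral_sub (avg_integrable hw hr x) ((integrable_moll_sub hr x).smul_const c),
      integral_smul_const, integral_moll_sub hr, one_smul]
    rfl
  have e2 : ε = ∫ y : Euc n, moll r (x - y) * ε := by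
    rw [integral_mul_const, integral_moll_sub hr, one_mul]
  rw [e, e2]
  refine norm_integral_le_of_norm_le ((integrable_moll_sub hr x).mul_const ε) ?_
  filter_upwards [h] with y hy
  rw [norm_smul, Real.norm_of_nonneg (moll_nonneg hr _)]
  by_cases hxy : y ∈ Metric.ball x r
  · exact mul_le_mul_of_nonneg_left (hy hxy) (moll_nonneg hr _)
  · rw [moll_eq_zero hr (by rw [← dist_eq_norm, dist_comm]; simpa using hxy)]
    simp

/-- Mollifications converge in `L¹`. -/
lemma tendsto_lintegral_avg_sub [CompleteSpace G] (hw : Integrable w) :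
    Tendsto (fun r => ∫⁻ x, ‖avg w r x - w x‖ₑ) (𝓝[>] 0) (𝓝 0) := by
  rw [ENNReal.tendsto_nhds_zero]
  intro ε hε
  rcases eq_or_ne ε ⊤ with rfl | hεt
  · exact Eventually.of_forall fun _ => le_top
  have hε3 : ε / 3 ≠ 0 := (ENNReal.div_pos hε.ne' (by simp)).ne'
  -- Split `w = (w - g) + g` with `g` continuous of compact support: averaging contracts `L¹`, and
  -- for `g` the error is uniformly small and vanishes off a fixed compact set.
  obtain ⟨g, hgs, hg, hgc, hgi⟩ := hw.exists_hasCompactSupport_lintegral_sub_le hε3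
  set B := Metric.cthickening 1 (tsupport g)
  have hB : IsCompact B := hgs.cthickening
  have hBt : volume B < ⊤ := hB.measure_lt_top
  obtain ⟨κ, hκ0, hκ⟩ : ∃ κ : ℝ, 0 < κ ∧ ENNReal.ofReal κ * volume B ≤ ε / 3 := by
    have hq : 0 < ε / 3 / (volume B + 1) :=
      ENNReal.div_pos hε3 (ENNReal.add_lt_top.2 ⟨hBt, by simp⟩).ne
    obtain ⟨q, hq0, hq⟩ := ENNReal.lt_iff_exists_nnreal_btwn.1 hq
    refine ⟨q, by exact_mod_cast hq0, ?_⟩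
    rw [ENNReal.ofReal_coe_nnreal]
    calc (q : ENNReal) * volume B ≤ ε / 3 / (volume B + 1) * (volume B + 1) := by
          gcongr; exact le_self_add
      _ ≤ ε / 3 := by rw [mul_comm]; exact ENNReal.mul_div_le
  obtain ⟨δ, hδ0, hδ⟩ := Metric.uniformContinuous_iff.1
    (hgs.uniformContinuous_of_continuous hgc) κ hκ0
  have hr : ∀ᶠ r in 𝓝[>] (0 : ℝ), r ∈ Ioo 0 (min δ 1) := Ioo_mem_nhdsGT (by positivity)
  filter_upwards [hr] with r hr
  have hr0 : 0 < r := hr.1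
  have hw' : avg w r = fun x => avg (w - g) r x + avg g r x := by
    ext x
    rw [avg_eq_conv, avg_eq_conv, avg_eq_conv, ← conv_add (isTest_moll_zero hr0) (hw.sub hgi) hgi,
      sub_add_cancel]
  have h1 : ∫⁻ x, ‖avg (w - g) r x‖ₑ ≤ ε / 3 := by
    refine (lintegral_conv_le (isTest_moll_zero hr0) (hw.sub hgi)).trans ?_
    rw [lintegral_moll hr0, one_mul]
    exact hg
  have h2 : ∫⁻ x, ‖avg g r x - g x‖ₑ ≤ ε / 3 := by
    have hle : ∀ x, ‖avg g r x - g x‖ ≤ κ := fun x => norm_avg_sub_le hgi hr0 x (g x)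
      (Eventually.of_forall fun y hy => by
        rw [← dist_eq_norm]
        exact (hδ (lt_of_lt_of_le (Metric.mem_ball.1 hy) (hr.2.le.trans (min_le_left _ _)))).le)
    have hz : ∀ x, x ∉ B → avg g r x - g x = 0 := fun x hx => by
      have hy0 : ∀ y, dist y x ≤ 1 → g y = 0 := fun y hy => by
        by_contra hgy
        exact hx (Metric.mem_cthickening_of_dist_le x y 1 _ (subset_tsupport _ hgy)
          (by rwa [dist_comm]))
      have := norm_avg_sub_le hgi hr0 x (0 : G) (ε := 0) (Eventually.of_forall fun y hy => by
        rw [hy0 y ((Metric.mem_ball.1 hy).le.trans (hr.2.le.trans (min_le_right _ _)))]; simp)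
      rw [sub_zero, norm_le_zero_iff] at this
      rw [this, hy0 x (by simp), sub_zero]
    calc ∫⁻ x, ‖avg g r x - g x‖ₑ ≤ ∫⁻ x, B.indicator (fun _ => ENNReal.ofReal κ) x := by
          refine lintegral_mono fun x => ?_
          by_cases hx : x ∈ B
          · rw [indicator_of_mem hx, ← ofReal_norm]
            exact ENNReal.ofReal_le_ofReal (hle x)
          · rw [hz x hx]; simp
      _ = ENNReal.ofReal κ * volume B := lintegral_indicator_const hB.isClosed.measurableSet _
      _ ≤ ε / 3 := hκ
  have hm1 : AEMeasurable fun x => ‖avg (w - g) r x‖ₑ :=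
    (integrable_avg (hw.sub hgi) hr0).aestronglyMeasurable.enorm
  have hm2 : AEMeasurable fun x => ‖avg g r x - g x‖ₑ :=
    ((integrable_avg hgi hr0).sub hgi).aestronglyMeasurable.enorm
  calc ∫⁻ x, ‖avg w r x - w x‖ₑ
      ≤ ∫⁻ x, (‖avg (w - g) r x‖ₑ + ‖avg g r x - g x‖ₑ + ‖w x - g x‖ₑ) := by
        refine lintegral_mono fun x => ?_
        have : avg w r x - w x = avg (w - g) r x + (avg g r x - g x) - (w x - g x) := by
          rw [show avg w r x = avg (w - g) r x + avg g r x from congrFun hw' x]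
          generalize avg (w - g) r x = a
          abel
        rw [this]
        exact enorm_sub_le.trans (add_le_add_left (enorm_add_le _ _) _)
    _ = (∫⁻ x, ‖avg (w - g) r x‖ₑ) + (∫⁻ x, ‖avg g r x - g x‖ₑ) + ∫⁻ x, ‖w x - g x‖ₑ := by
        rw [lintegral_add_left' (by exact hm1.add hm2), lintegral_add_left' hm1]
    _ ≤ ε / 3 + ε / 3 + ε / 3 := add_le_add (add_le_add h1 h2) hg
    _ = ε := ENNReal.add_thirds ε

/-- The sequence of radii along which we mollify. -/
lemma tendsto_radii : Tendsto (fun k : ℕ => 1 / ((k : ℝ) + 1)) atTop (𝓝[>] 0) :=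
  tendsto_nhdsWithin_iff.2 ⟨tendsto_one_div_add_atTop_nhds_zero_nat,
    Eventually.of_forall fun k => by simp only [mem_Ioi]; positivity⟩

/-- Convergence in `L¹` implies convergence in measure, hence almost everywhere along a subsequence.
The shift by `N` is there because the radii are positive only eventually. -/
lemma exists_seq_avg_tendsto_ae [CompleteSpace G] (hw : Integrable w) {r : ℕ → ℝ}
    (hr : Tendsto r atTop (𝓝[>] 0)) :
    ∃ ns : ℕ → ℕ, StrictMono ns ∧
      ∀ᵐ x, Tendsto (fun k => avg w (r (ns k)) x) atTop (𝓝 (w x)) := by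
  obtain ⟨N, hN⟩ := eventually_atTop.1 ((tendsto_nhdsWithin_iff.1 hr).2)
  have h : TendstoInMeasure volume (fun k => avg w (r (k + N))) atTop w := by
    refine tendstoInMeasure_of_tendsto_eLpNorm (p := 1) one_ne_zero (fun k => ?_)
      hw.aestronglyMeasurable ?_
    · exact (integrable_avg hw (hN _ (by simp))).aestronglyMeasurable
    · simp_rw [eLpNorm_one_eq_lintegral_enorm, Pi.sub_apply]
      exact (tendsto_lintegral_avg_sub hw).comp (hr.comp (tendsto_add_atTop_nat N))
  obtain ⟨ns, h1, h2⟩ := h.exists_seq_tendsto_ae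
  exact ⟨fun k => ns k + N, fun a b hab => by simpa using h1 hab, h2⟩

end Mollification

end ConstraintMap

end

noncomputable section

namespace ConstraintMap

/-! ### Regularized distance to a convex set. -/

section Projection

variable {E : Type*} [NormedAddCommGroup E] [InnerProductSpace ℝ E]

/-- `f` is convex with continuous subgradient `g` of norm at most one. -/
structure IsSubgradient (f : E → ℝ) (g : E → E) : Prop where
  continuous : Continuous g
  norm_le : ∀ y, ‖g y‖ ≤ 1
  le : ∀ y z, inner ℝ (g y) (z - y) ≤ f z - f y

lemma IsSubgradient.abs_sub_le {f : E → ℝ} {g : E → E} (h : IsSubgradient f g) (y z : E) :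
    |f y - f z| ≤ ‖y - z‖ := by
  have key : ∀ y z, f y - f z ≤ ‖y - z‖ := fun y z => by
    have h1 := h.le y z
    have h2 : inner ℝ (g y) (y - z) ≤ ‖y - z‖ :=
      (real_inner_le_norm _ _).trans (mul_le_of_le_one_left (norm_nonneg _) (h.norm_le y))
    rw [← neg_sub y z, inner_neg_right] at h1
    linarith
  refine abs_le.2 ⟨?_, key y z⟩
  have := key z y
  rw [norm_sub_rev] at this
  linarith

lemma IsSubgradient.lipschitz {f : E → ℝ} {g : E → E} (h : IsSubgradient f g) :
    LipschitzWith 1 f :=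
  LipschitzWith.of_dist_le_mul fun y z => by
    simpa [Real.dist_eq, dist_eq_norm] using h.abs_sub_le y z

lemma IsSubgradient.continuous_fun {f : E → ℝ} {g : E → E} (h : IsSubgradient f g) :
    Continuous f := h.lipschitz.continuous

variable {K : Set E}

lemma exists_projection [CompleteSpace E] (hne : K.Nonempty) (hc : IsClosed K) (hconv : Convex ℝ K) :
    ∃ p : E → E, (∀ y, p y ∈ K) ∧ (∀ y, ∀ w ∈ K, inner ℝ (y - p y) (w - p y) ≤ 0) ∧
      ∀ y, ‖y - p y‖ = Metric.infDist y K := by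
  choose p hp hp' using exists_norm_eq_iInf_of_complete_convex hne hc.isComplete hconv
  refine ⟨p, hp, fun y => (norm_eq_iInf_iff_real_inner_le_zero hconv (hp y)).1 (hp' y), fun y => ?_⟩
  rw [hp', Metric.infDist_eq_iInf]
  simp [dist_eq_norm]

/-- The regularized distance to a set. -/
def regDist (K : Set E) (ε : ℝ) (y : E) : ℝ := √(ε ^ 2 + Metric.infDist y K ^ 2)

lemma infDist_le_regDist (ε : ℝ) (y : E) : Metric.infDist y K ≤ regDist K ε y :=
  Real.le_sqrt_of_sq_le (by nlinarith [sq_nonneg ε])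

lemma regDist_le {ε : ℝ} (hε : 0 ≤ ε) (y : E) : regDist K ε y ≤ Metric.infDist y K + ε := by
  have : 0 ≤ Metric.infDist y K := Metric.infDist_nonneg
  refine Real.sqrt_le_iff.2 ⟨by positivity, ?_⟩
  nlinarith

/-- The regularized distance to a convex set has a continuous subgradient which vanishes on the
set. -/
lemma exists_isSubgradient_regDist [CompleteSpace E] (hne : K.Nonempty) (hc : IsClosed K) (hconv : Convex ℝ K)
    {ε : ℝ} (hε : 0 < ε) :
    ∃ g : E → E, IsSubgradient (regDist K ε) g ∧ ∀ y ∈ K, g y = 0 := by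
  obtain ⟨p, hpK, hp, hpd⟩ := exists_projection hne hc hconv
  -- The projection is nonexpansive: add the variational inequalities at `y` and at `z`, then use
  -- Cauchy–Schwarz.
  have hpl : ∀ y z, ‖p y - p z‖ ≤ ‖y - z‖ := fun y z => by
    have h1 := hp y (p z) (hpK z)
    have h2 := hp z (p y) (hpK y)
    have h3 : ‖p y - p z‖ * ‖p y - p z‖ ≤ ‖y - z‖ * ‖p y - p z‖ := by
      refine le_trans ?_ (real_inner_le_norm (y - z) (p y - p z))
      rw [← real_inner_self_eq_norm_mul_norm]
      have e : inner ℝ (y - z) (p y - p z) = inner ℝ (p y - p z) (p y - p z)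
          - inner ℝ (y - p y) (p z - p y) - inner ℝ (z - p z) (p y - p z) := by
        have : p z - p y = -(p y - p z) := by abel
        rw [this, inner_neg_right, sub_neg_eq_add, ← inner_add_left, ← inner_sub_left]
        congr 1
        abel
      linarith
    rcases (norm_nonneg (p y - p z)).eq_or_lt' with h0 | h0
    · rw [h0]; exact norm_nonneg _
    · exact le_of_mul_le_mul_right h3 h0
  have hpc : Continuous p := (LipschitzWith.of_dist_le_mul (K := 1) fun y z => by
    simpa [dist_eq_norm] using hpl y z).continuous
  have hr : ∀ y, regDist K ε y = √(ε ^ 2 + ‖y - p y‖ ^ 2) := fun y => by rw [hpd]; rfl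
  have hpos : ∀ y, 0 < regDist K ε y := fun y => Real.sqrt_pos.2 (by positivity)
  have hsq : ∀ y, regDist K ε y ^ 2 = ε ^ 2 + ‖y - p y‖ ^ 2 := fun y => by
    rw [hr, Real.sq_sqrt (by positivity)]
  -- This is the gradient suggested by `½ ∇ dist² = y - p y`. Since `ε > 0` it is continuous across
  -- the boundary of `K`, unlike that of the distance.
  refine ⟨fun y => (regDist K ε y)⁻¹ • (y - p y), ⟨?_, fun y => ?_, fun y z => ?_⟩, fun y hy => ?_⟩
  · have hrc : Continuous (regDist K ε) := by
      have := Metric.continuous_infDist_pt K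
      unfold regDist; fun_prop
    exact (hrc.inv₀ fun y => (hpos y).ne').smul (continuous_id.sub hpc)
  · rw [norm_smul, norm_inv, Real.norm_of_nonneg (hpos y).le, inv_mul_le_one₀ (hpos y), hpd]
    exact infDist_le_regDist ε y
  · rw [real_inner_smul_left, inv_mul_le_iff₀ (hpos y)]
    have e : inner ℝ (y - p y) (z - y) = inner ℝ (y - p y) (z - p z)
        + inner ℝ (y - p y) (p z - p y) - ‖y - p y‖ ^ 2 := by
      rw [← real_inner_self_eq_norm_sq, ← inner_add_right, ← inner_sub_right]
      congr 1
      abel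
    have h1 := hp y (p z) (hpK z)
    have h2 : inner ℝ (y - p y) (z - p z) ≤ ‖y - p y‖ * ‖z - p z‖ := real_inner_le_norm _ _
    -- Cauchy–Schwarz in the plane for the vectors `(ε, ‖y - p y‖)` and `(ε, ‖z - p z‖)`.
    have h3 : ε ^ 2 + ‖y - p y‖ * ‖z - p z‖ ≤ regDist K ε y * regDist K ε z := by
      refine abs_le_of_sq_le_sq' ?_ (mul_nonneg (hpos y).le (hpos z).le) |>.2
      rw [mul_pow, hsq, hsq]
      nlinarith [sq_nonneg (ε * (‖y - p y‖ - ‖z - p z‖))]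
    have h4 := hsq y
    nlinarith
  · have : y - p y = 0 := by
      rw [← norm_eq_zero, hpd, Metric.infDist_zero_of_mem hy]
    simp [this]

end Projection

/-! ### Subharmonicity of convex functions of solutions. -/

section Subharmonic

lemma tendsto_integral_norm_avg_sub {n : ℕ} {G : Type*} [NormedAddCommGroup G] [NormedSpace ℝ G]
    [CompleteSpace G] {w : Euc n → G} (hw : Integrable w) :
    Tendsto (fun r => ∫ x, ‖avg w r x - w x‖) (𝓝[>] 0) (𝓝 0) := by
  have h := (ENNReal.tendsto_toReal (ENNReal.zero_ne_top)).comp (tendsto_lintegral_avg_sub hw)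
  rw [ENNReal.toReal_zero] at h
  refine h.congr' ?_
  filter_upwards [self_mem_nhdsWithin] with r hr
  exact (integral_norm_eq_lintegral_enorm
    ((integrable_avg hw hr).sub hw).aestronglyMeasurable).symm

/-- A Lipschitz function of an integrable map can be integrated against test functions. -/
lemma IsTest.integrable_mul_comp {n : ℕ} {G : Type*} [NormedAddCommGroup G] {Ω : Set (Euc n)}
    {η : Euc n → ℝ} (hη : IsTest Ω η) {f : G → ℝ} (hf : LipschitzWith 1 f) {v : Euc n → G}
    (hv : Integrable v) : Integrable fun x => η x * f (v x) := by
  have h1 : Integrable fun x => f (v x) - f 0 := by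
    refine hv.mono ((hf.continuous.comp_aestronglyMeasurable hv.aestronglyMeasurable).sub
      aestronglyMeasurable_const) (Eventually.of_forall fun x => ?_)
    have := hf.dist_le_mul (v x) 0
    simpa [dist_eq_norm] using this
  have h2 : LocallyIntegrable ((fun x => f (v x) - f 0) + fun _ => f 0) :=
    h1.locallyIntegrable.add (locallyIntegrable_const (f 0))
  have h3 : ((fun x => f (v x) - f 0) + fun _ => f 0) = fun x => f (v x) := by
    ext x; simp
  rw [h3] at h2
  exact hη.integrable_smul (h2.locallyIntegrableOn _)

variable {n m : ℕ} {Ω : Set (Euc n)}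

lemma secondDiff_eq_zero {η : Euc n → ℝ} {i : Fin n} {h : ℝ} (hh : |h| ≤ 1) {x : Euc n}
    (hx : x ∉ Metric.cthickening 1 (tsupport η)) : secondDiff i h η x = 0 := by
  have key : ∀ y, dist x y ≤ 1 → η y = 0 := fun y hy => by
    by_contra h0
    exact hx (Metric.mem_cthickening_of_dist_le x y 1 _ (subset_tsupport _ h0) hy)
  have e : ‖h • stdVec i‖ ≤ 1 := by rw [norm_smul, norm_stdVec, mul_one]; exact hh
  rw [secondDiff, key _ (by rw [dist_eq_norm]; simpa using e),
    key _ (by rw [dist_eq_norm]; simpa using e), key x (by simp)]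
  simp

/-- Summation by parts for symmetric second differences. -/
lemma integral_secondDiff_mul {η f : Euc n → ℝ} (hη : IsTest Ω η) (hf : Continuous f) (i : Fin n)
    (h : ℝ) : ∫ x, secondDiff i h η x * f x = ∫ x, η x * secondDiff i h f x := by
  set a := h • stdVec i
  have hi : ∀ b c : Euc n, Integrable fun x => η (x + b) * f (x + c) := fun b c => by
    have h1 := hη.comp_add_const b
    exact h1.integrable_smul (u := fun x => f (x + c))
      ((by fun_prop : Continuous fun x => f (x + c)).locallyIntegrable.locallyIntegrableOn _)
  have ht : ∀ b : Euc n, ∫ x, η (x + b) * f x = ∫ x, η x * f (x - b) := fun b => by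
    rw [← integral_sub_right_eq_self (fun x => η (x + b) * f x) b]
    simp
  have i1 := hi a 0
  have i2 := hi (-a) 0
  have i3 := hi 0 0
  have i4 := hi 0 a
  have i5 := hi 0 (-a)
  simp only [add_zero] at i1 i2 i3 i4 i5
  have e1 : ∀ x, secondDiff i h η x * f x
      = (h ^ 2)⁻¹ * (η (x + a) * f x + η (x + -a) * f x - 2 * (η x * f x)) := fun x => by
    simp only [secondDiff, smul_eq_mul, sub_eq_add_neg, a]; ring
  have e2 : ∀ x, η x * secondDiff i h f x
      = (h ^ 2)⁻¹ * (η x * f (x + a) + η x * f (x + -a) - 2 * (η x * f x)) := fun x => by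
    simp only [secondDiff, smul_eq_mul, sub_eq_add_neg, a]; ring
  simp_rw [e1, e2]
  rw [integral_const_mul, integral_const_mul, integral_sub (by exact i1.add i2) (i3.const_mul 2),
    integral_add i1 i2, integral_sub (by exact i4.add i5) (i3.const_mul 2), integral_add i4 i5, ht,
    ht]
  simp only [sub_eq_add_neg, neg_neg]
  ring

/-- The chain rule inequality for a convex function of a smooth map. -/
lemma integral_pderiv_pderiv_mul_comp_ge {f : Euc m → ℝ} {g : Euc m → Euc m}
    (hf : IsSubgradient f g) {ψ η : Euc n → ℝ} {U : Euc n → Euc m} (hψ : IsTest univ ψ)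
    (hU : Integrable U) (hη : IsTest Ω η) (hη0 : ∀ x, 0 ≤ η x) (i : Fin n) :
    ∫ x, η x * inner ℝ (g (conv ψ U x)) (conv (pderiv i (pderiv i ψ)) U x)
      ≤ ∫ x, pderiv i (pderiv i η) x * f (conv ψ U x) := by
  set v := conv ψ U
  have hv : Continuous v := continuous_conv hψ hU
  have hfv : Continuous fun x => f (v x) := hf.continuous_fun.comp hv
  have hgv : Continuous fun x => g (v x) := hf.continuous.comp hv
  set t : ℕ → ℝ := fun k => 1 / ((k : ℝ) + 1)
  have ht : Tendsto t atTop (𝓝 0) := tendsto_one_div_add_atTop_nhds_zero_nat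
  have htp : ∀ k, 0 < t k := fun k => by positivity
  have ht1 : ∀ k, |t k| ≤ 1 := fun k => by
    rw [abs_of_pos (htp k), div_le_one (by positivity)]
    linarith [Nat.cast_nonneg (α := ℝ) k]
  obtain ⟨C, hC0, hC⟩ := exists_bound_secondDiff hη i
  obtain ⟨D, hD0, hD⟩ := exists_bound_secondDiff_conv hψ hU i
  obtain ⟨A, hA0, hA⟩ := hψ.bounded
  have hfb : ∀ x, |f (v x)| ≤ |f 0| + A * ∫ y, ‖U y‖ := fun x => by
    have h1 := hf.abs_sub_le (v x) 0
    have h2 := norm_conv_le hA hU x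
    rw [sub_zero] at h1
    have h3 : |f (v x)| ≤ |f (v x) - f 0| + |f 0| := by simpa using abs_add_le (f (v x) - f 0) (f 0)
    linarith
  set B := Metric.cthickening 1 (tsupport η)
  have hB : IsCompact B := hη.2.1.cthickening
  have hL : Tendsto (fun k => ∫ x, secondDiff i (t k) η x * f (v x)) atTop
      (𝓝 (∫ x, pderiv i (pderiv i η) x * f (v x))) := by
    refine tendsto_integral_of_dominated_convergence
      (B.indicator fun _ => C * (|f 0| + A * ∫ y, ‖U y‖)) (fun k => ?_) ?_ (fun k => ?_) ?_
    · exact ((continuous_secondDiff hη.continuous i _).mul hfv).aestronglyMeasurable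
    · exact (integrableOn_const hB.measure_lt_top.ne).integrable_indicator
        hB.isClosed.measurableSet
    · refine Eventually.of_forall fun x => ?_
      by_cases hx : x ∈ B
      · rw [indicator_of_mem hx, norm_mul]
        exact mul_le_mul (hC _ (htp k) x) (hfb x) (norm_nonneg _) hC0
      · rw [indicator_of_notMem hx, secondDiff_eq_zero (ht1 k) hx]; simp
    · exact Eventually.of_forall fun x => (tendsto_secondDiff hη.1 ht htp i x).mul_const _
  have hηi : Integrable η := hη.continuous.integrable_of_hasCompactSupport hη.2.1
  have hR : Tendsto (fun k => ∫ x, η x * inner ℝ (g (v x)) (secondDiff i (t k) v x)) atTop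
      (𝓝 (∫ x, η x * inner ℝ (g (v x)) (conv (pderiv i (pderiv i ψ)) U x))) := by
    refine tendsto_integral_of_dominated_convergence (fun x => |η x| * D) (fun k => ?_)
      (hηi.norm.mul_const D) (fun k => ?_) ?_
    · exact (hη.continuous.mul
        (hgv.inner (continuous_secondDiff hv i _))).aestronglyMeasurable
    · refine Eventually.of_forall fun x => ?_
      rw [norm_mul, Real.norm_eq_abs]
      gcongr
      refine (norm_inner_le_norm _ _).trans ?_
      exact (mul_le_of_le_one_left (norm_nonneg _) (hf.norm_le _)).trans (hD _ (htp k) x)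
    · exact Eventually.of_forall fun x => (tendsto_const_nhds.inner
        (tendsto_secondDiff_conv hψ hU ht htp i x)).const_mul _
  refine le_of_tendsto_of_tendsto' hR hL fun k => ?_
  rw [integral_secondDiff_mul hη hfv]
  refine integral_mono ?_ ?_ fun x => ?_
  · have hc := hη.continuous.mul (hgv.inner (continuous_secondDiff hv i (t k)))
    exact hc.integrable_of_hasCompactSupport (hη.2.1.mul_right)
  · have hc := hη.continuous.mul (continuous_secondDiff hfv i (t k))
    exact hc.integrable_of_hasCompactSupport (hη.2.1.mul_right)
  -- Adding the subgradient inequalities at `v x` towards `v (x + t e_i)` and `v (x - t e_i)` bounds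
  -- the second difference of `f ∘ v` from below. No derivative of `f` beyond its subgradient is
  -- involved, and `0 ≤ η` preserves the sign.
  · refine mul_le_mul_of_nonneg_left ?_ (hη0 x)
    have h1 := hf.le (v x) (v (x + t k • stdVec i))
    have h2 := hf.le (v x) (v (x - t k • stdVec i))
    have e : inner ℝ (g (v x)) (secondDiff i (t k) v x) = (t k ^ 2)⁻¹ *
        (inner ℝ (g (v x)) (v (x + t k • stdVec i) - v x)
          + inner ℝ (g (v x)) (v (x - t k • stdVec i) - v x)) := by
      rw [secondDiff, real_inner_smul_right, ← inner_add_right]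
      congr 2
      rw [two_smul]
      abel
    rw [e, secondDiff, smul_eq_mul]
    have := htp k
    refine mul_le_mul_of_nonneg_left ?_ (by positivity)
    simp only [smul_eq_mul]
    linarith

lemma pderiv_comp_sub {ψ : Euc n → ℝ} (h : ContDiff ℝ ∞ ψ) (x : Euc n) (i : Fin n) :
    pderiv i (fun y => ψ (x - y)) = fun y => -pderiv i ψ (x - y) := by
  ext y
  have := pderiv_comp_affine h x (-1) i y
  simpa [sub_eq_add_neg] using this

lemma lap_comp_sub {ψ : Euc n → ℝ} (h : ContDiff ℝ ∞ ψ) (x y : Euc n) :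
    lap (fun y => ψ (x - y)) y = lap ψ (x - y) := by
  refine Finset.sum_congr rfl fun i _ => ?_
  have h1 := pderiv_comp_sub h x i
  have h2 := pderiv_comp_sub (contDiff_pderiv h i) x i
  rw [h1]
  have : pderiv i (fun y => -pderiv i ψ (x - y)) y = -pderiv i (fun y => pderiv i ψ (x - y)) y := by
    simp [pderiv, fderiv_fun_neg]
  rw [this, h2, neg_neg]

/-- A convex function of a solution of `Δ U = F` is subharmonic if its gradient is perpendicular
to `F`. -/
lemma integral_lap_mul_comp_nonneg {f : Euc m → ℝ} {g : Euc m → Euc m}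
    (hf : IsSubgradient f g) {U F : Euc n → Euc m} (hΩ : IsOpen Ω) (hU : Integrable U)
    (hF : LocallyIntegrableOn F Ω)
    (heq : ∀ η, IsTest Ω η → ∫ x, lap η x • U x = ∫ x, η x • F x)
    (hperp : ∀ x ∈ Ω, inner ℝ (g (U x)) (F x) = 0)
    {η : Euc n → ℝ} (hη : IsTest Ω η) (hη0 : ∀ x, 0 ≤ η x) :
    0 ≤ ∫ x, lap η x * f (U x) := by
  -- `F` is only locally integrable and has to be cut off before it is mollified. Cutting off to a
  -- compact `ρ`-neighbourhood of the support of `η` does not change its averages of radius below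
  -- `ρ` on that support.
  obtain ⟨ρ, hρ0, hρ⟩ := hη.2.1.exists_cthickening_subset_open hΩ hη.2.2
  set B := Metric.cthickening ρ (tsupport η)
  have hB : IsCompact B := hη.2.1.cthickening
  set Fb := B.indicator F
  have hFb : Integrable Fb :=
    (hF.integrableOn_compact_subset hρ hB).integrable_indicator hB.isClosed.measurableSet
  obtain ⟨ns, hns, hae⟩ := exists_seq_avg_tendsto_ae hU tendsto_radii
  set r : ℕ → ℝ := fun k => 1 / (((ns k : ℕ) : ℝ) + 1)
  have hr : Tendsto r atTop (𝓝[>] 0) := tendsto_radii.comp hns.tendsto_atTop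
  have hrp : ∀ k, 0 < r k := fun k => by positivity
  have hηi : Integrable η := hη.continuous.integrable_of_hasCompactSupport hη.2.1
  obtain ⟨C, hC0, hC⟩ := hη.bounded
  obtain ⟨D, hD0, hD⟩ := hη.lap_isTest.bounded
  have hfi : ∀ v : Euc n → Euc m, Integrable v → Integrable fun x => lap η x * f (v x) :=
    fun v hv => hη.lap_isTest.integrable_mul_comp hf.lipschitz hv
  have hL : Tendsto (fun k => ∫ x, lap η x * f (avg U (r k) x)) atTop
      (𝓝 (∫ x, lap η x * f (U x))) := by
    refine tendsto_iff_norm_sub_tendsto_zero.2 (squeeze_zero (fun _ => norm_nonneg _)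
      (fun k => ?_) (by simpa only [mul_zero] using ((tendsto_integral_norm_avg_sub hU).comp hr).const_mul D))
    rw [← integral_sub (hfi _ (integrable_avg hU (hrp k))) (hfi _ hU)]
    simp only [Function.comp]
    rw [← integral_const_mul]
    refine norm_integral_le_of_norm_le
      (((integrable_avg hU (hrp k)).sub hU).norm.const_mul D) (Eventually.of_forall fun x => ?_)
    rw [← mul_sub, norm_mul]
    exact mul_le_mul (hD x) (hf.abs_sub_le _ _) (norm_nonneg _) hD0
  have hgm : ∀ {v : Euc n → Euc m}, Integrable v → AEStronglyMeasurable (fun x => g (v x)) :=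
    fun hv => hf.continuous.comp_aestronglyMeasurable hv.aestronglyMeasurable
  have hηg : ∀ {v v' : Euc n → Euc m}, ∀ x, ‖η x * inner ℝ (g (v x)) (v' x)‖ ≤ C * ‖v' x‖ := by
    intro v v' x
    rw [norm_mul]
    exact mul_le_mul (hC x) ((norm_inner_le_norm _ _).trans
      (mul_le_of_le_one_left (norm_nonneg _) (hf.norm_le _))) (norm_nonneg _) hC0
  have hint : ∀ {v v' : Euc n → Euc m}, Integrable v → Integrable v' →
      Integrable fun x => η x * inner ℝ (g (v x)) (v' x) := fun {v v'} hv hv' =>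
    (hv'.norm.const_mul C).mono' (hη.continuous.aestronglyMeasurable.mul
      ((hgm hv).inner hv'.aestronglyMeasurable)) (Eventually.of_forall (hηg (v := v) (v' := v')))
  -- Both factors vary with `k`. With `Fb` frozen, dominated convergence handles the bounded
  -- continuous gradient; replacing the average of `Fb` by `Fb` costs an `L¹` error since the
  -- gradient has norm at most one.
  have hR : Tendsto (fun k => ∫ x, η x * inner ℝ (g (avg U (r k) x)) (avg Fb (r k) x)) atTop
      (𝓝 (∫ x, η x * inner ℝ (g (U x)) (Fb x))) := by
    have h1 : Tendsto (fun k => ∫ x, η x * inner ℝ (g (avg U (r k) x)) (Fb x)) atTop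
        (𝓝 (∫ x, η x * inner ℝ (g (U x)) (Fb x))) := by
      refine tendsto_integral_of_dominated_convergence (fun x => C * ‖Fb x‖) (fun k => ?_)
        (hFb.norm.const_mul C) (fun k => Eventually.of_forall (hηg (v := avg U (r k)))) ?_
      · exact (hint (integrable_avg hU (hrp k)) hFb).aestronglyMeasurable
      · filter_upwards [hae] with x hx
        exact (((hf.continuous.tendsto _).comp hx).inner tendsto_const_nhds).const_mul _
    have h2 : Tendsto (fun k => ∫ x, η x * inner ℝ (g (avg U (r k) x)) (avg Fb (r k) x - Fb x))
        atTop (𝓝 0) := by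
      refine squeeze_zero_norm (fun k => ?_)
        (by simpa only [mul_zero] using
          ((tendsto_integral_norm_avg_sub hFb).comp hr).const_mul C)
      simp only [Function.comp]
      rw [← integral_const_mul]
      exact norm_integral_le_of_norm_le
        (((integrable_avg hFb (hrp k)).sub hFb).norm.const_mul C) (Eventually.of_forall
          (hηg (v := avg U (r k)) (v' := fun x => avg Fb (r k) x - Fb x)))
    have h3 := h1.add h2
    rw [add_zero] at h3
    refine h3.congr fun k => ?_
    rw [← integral_add (hint (integrable_avg hU (hrp k)) hFb)
      (hint (v' := fun x => avg Fb (r k) x - Fb x) (integrable_avg hU (hrp k))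
        ((integrable_avg hFb (hrp k)).sub hFb))]
    refine integral_congr_ae (Eventually.of_forall fun x => ?_)
    simp only [← mul_add, ← inner_add_right, add_sub_cancel]
  have h0 : ∫ x, η x * inner ℝ (g (U x)) (Fb x) = 0 := by
    refine integral_eq_zero_of_ae (Eventually.of_forall fun x => ?_)
    change η x * inner ℝ (g (U x)) (Fb x) = 0
    by_cases hx : x ∈ tsupport η
    · rw [show Fb x = F x from indicator_of_mem (Metric.self_subset_cthickening _ hx) F,
        hperp x (hη.2.2 hx)]
      simp
    · rw [image_eq_zero_of_notMem_tsupport hx]; simp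
  rw [← h0]
  refine le_of_tendsto_of_tendsto hR hL ?_
  filter_upwards [hr.eventually (Ioo_mem_nhdsGT hρ0)] with k hk
  have hψ := isTest_moll_zero (n := n) (hrp k)
  -- On the support of `η`, the Laplacian of the mollified map is `U` paired with the Laplacian of
  -- the kernel centred at `x`. That kernel is an admissible test function, so the equation applies.
  have e1 : ∀ x, η x * inner ℝ (g (avg U (r k) x)) (avg Fb (r k) x) = ∑ i,
      η x * inner ℝ (g (avg U (r k) x)) (conv (pderiv i (pderiv i (moll (r k)))) U x) := by
    intro x
    rw [← Finset.mul_sum, ← inner_sum]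
    by_cases hx : x ∈ tsupport η
    · have e2 : ∑ i, conv (pderiv i (pderiv i (moll (r k)))) U x
          = ∫ y, lap (fun y => moll (r k) (x - y)) y • U y := by
        simp only [conv]
        rw [← integral_finsetSum _ fun i _ =>
          conv_integrable ((hψ.isTest_pderiv i).isTest_pderiv i) hU x]
        simp_rw [lap_comp_sub hψ.1, lap, Finset.sum_smul]
      have hsub : Metric.closedBall x (r k) ⊆ B :=
        (Metric.closedBall_subset_closedBall hk.2.le).trans
          (Metric.closedBall_subset_cthickening hx ρ)
      rw [e2, heq _ (isTest_moll (hrp k) (hsub.trans hρ))]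
      congr 2
      refine integral_congr_ae (Eventually.of_forall fun y => ?_)
      by_cases hy : y ∈ B
      · simp only [Fb, indicator_of_mem hy]
      · have : moll (r k) (x - y) = 0 := by
          refine moll_eq_zero (hrp k) (le_of_not_ge fun h => hy (hsub ?_))
          rwa [Metric.mem_closedBall, dist_comm, dist_eq_norm]
        simp only [this, zero_smul]
    · rw [image_eq_zero_of_notMem_tsupport hx, zero_mul, zero_mul]
  have e3 : ∀ x, lap η x * f (avg U (r k) x)
      = ∑ i, pderiv i (pderiv i η) x * f (avg U (r k) x) := fun x => Finset.sum_mul ..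
  simp_rw [e1, e3]
  rw [integral_finsetSum _ fun i _ => hint (integrable_avg hU (hrp k))
    (integrable_conv ((hψ.isTest_pderiv i).isTest_pderiv i) hU), integral_finsetSum]
  · exact Finset.sum_le_sum fun i _ => integral_pderiv_pderiv_mul_comp_ge hf hψ hU hη hη0 i
  · intro i _
    exact ((hη.isTest_pderiv i).isTest_pderiv i).integrable_smul
      (u := fun x => f (avg U (r k) x)) ((hf.continuous_fun.comp
        (continuous_avg hU (hrp k))).locallyIntegrable.locallyIntegrableOn _)

/-- The distance of a solution of `Δ U = F` to a convex set is subharmonic in the sense of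
distributions if `F` vanishes where `U` is outside of the set. -/
theorem integral_lap_mul_infDist_nonneg {K : Set (Euc m)} (hne : K.Nonempty) (hc : IsClosed K)
    (hconv : Convex ℝ K) {U F : Euc n → Euc m} (hΩ : IsOpen Ω) (hU : Integrable U)
    (hF : LocallyIntegrableOn F Ω)
    (heq : ∀ η, IsTest Ω η → ∫ x, lap η x • U x = ∫ x, η x • F x)
    (hFK : ∀ x ∈ Ω, U x ∉ K → F x = 0)
    {η : Euc n → ℝ} (hη : IsTest Ω η) (hη0 : ∀ x, 0 ≤ η x) :
    0 ≤ ∫ x, lap η x * Metric.infDist (U x) K := by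
  have hli : Integrable (lap η) :=
    hη.lap_isTest.continuous.integrable_of_hasCompactSupport hη.lap_isTest.2.1
  have hdi : Integrable fun x => lap η x * Metric.infDist (U x) K :=
    hη.lap_isTest.integrable_mul_comp (Metric.lipschitz_infDist_pt K) hU
  have key : ∀ ε : ℝ, 0 < ε → -(ε * ∫ x, |lap η x|) ≤ ∫ x, lap η x * Metric.infDist (U x) K := by
    intro ε hε
    obtain ⟨g, hg, hgK⟩ := exists_isSubgradient_regDist hne hc hconv hε
    -- Orthogonality is trivial: the gradient vanishes on `K`, and `F` vanishes where `U` is off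
    -- `K`.
    have h1 := integral_lap_mul_comp_nonneg hg hΩ hU hF heq (fun x hx => by
      by_cases hK : U x ∈ K
      · rw [hgK _ hK, inner_zero_left]
      · rw [hFK x hx hK, inner_zero_right]) hη hη0
    have h2 : ∫ x, lap η x * regDist K ε (U x)
        ≤ ∫ x, (lap η x * Metric.infDist (U x) K + ε * |lap η x|) := by
      refine integral_mono (hη.lap_isTest.integrable_mul_comp hg.lipschitz hU)
        (hdi.add (hli.abs.const_mul ε)) fun x => ?_
      have h3 : regDist K ε (U x) - Metric.infDist (U x) K ≤ ε := by
        linarith [regDist_le (K := K) hε.le (U x)]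
      have h4 : 0 ≤ regDist K ε (U x) - Metric.infDist (U x) K :=
        sub_nonneg.2 (infDist_le_regDist ε (U x))
      have h5 : lap η x * (regDist K ε (U x) - Metric.infDist (U x) K) ≤ |lap η x| * ε :=
        mul_le_mul (le_abs_self _) h3 h4 (abs_nonneg _)
      simp only
      linarith
    rw [integral_add hdi (hli.abs.const_mul ε), integral_const_mul] at h2
    linarith
  refine le_of_forall_pos_le_add fun ε hε => ?_
  have hI : 0 ≤ ∫ x, |lap η x| := integral_nonneg fun _ => abs_nonneg _
  have h := key (ε / (1 + ∫ x, |lap η x|)) (by positivity)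
  have h2 : ε / (1 + ∫ x, |lap η x|) * ∫ x, |lap η x| ≤ ε := by
    rw [div_mul_eq_mul_div, div_le_iff₀ (by positivity)]
    nlinarith
  linarith

end Subharmonic

end ConstraintMap

end

noncomputable section

namespace ConstraintMap

/-! ### Riesz representation of functionals on a space mapped into a Hilbert space. -/

section Riesz

/-- The bound lets `l` factor through the range of `ι`, Hahn–Banach extends it to `H`, and Riesz
represents the extension. Density of the range is not needed, as only existence of `g` is claimed.
-/
lemma exists_riesz_representation {T H : Type*} [AddCommGroup T] [Module ℝ T]
    [NormedAddCommGroup H] [InnerProductSpace ℝ H] [CompleteSpace H] (ι : T →ₗ[ℝ] H)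
    (l : T →ₗ[ℝ] ℝ) (C : ℝ) (hC : ∀ t, |l t| ≤ C * ‖ι t‖) :
    ∃ g : H, ∀ t, l t = inner ℝ g (ι t) := by
  obtain ⟨s, hs⟩ := ι.rangeRestrict.exists_rightInverse_of_surjective ι.range_rangeRestrict
  have hs' : ∀ y, ι (s y) = y := fun y => congrArg Subtype.val (LinearMap.congr_fun hs y)
  obtain ⟨L, hL, -⟩ := exists_extension_norm_eq (LinearMap.range ι)
    ((l.comp s).mkContinuous C fun y => by
      have := hC (s y)
      rw [hs'] at this
      exact this)
  refine ⟨(InnerProductSpace.toDual ℝ H).symm L, fun t => ?_⟩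
  rw [InnerProductSpace.toDual_symm_apply]
  have h1 := hL (ι.rangeRestrict t)
  -- The bound makes `l` vanish on the kernel of `ι`, so the linear section `s` does not affect the
  -- values.
  have h2 : l (t - s (ι.rangeRestrict t)) = 0 := by
    have := hC (t - s (ι.rangeRestrict t))
    rw [map_sub ι, hs', show ((ι.rangeRestrict t : LinearMap.range ι) : H) = ι t from rfl, sub_self, norm_zero, mul_zero] at this
    exact abs_nonpos_iff.1 this
  rw [map_sub, sub_eq_zero] at h2
  rw [h2]
  exact h1.symm

end Riesz

/-! ### Weak derivatives of Lipschitz functions of Sobolev maps. -/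

section Gradient

variable {n m : ℕ} {Ω : Set (Euc n)}

/-- The space of test functions. -/
def testSpace (Ω : Set (Euc n)) : Submodule ℝ (Euc n → ℝ) where
  carrier := {η | IsTest Ω η}
  zero_mem' := ⟨contDiff_const, HasCompactSupport.zero, by simp [tsupport]⟩
  add_mem' := fun {a b} ha hb => ⟨ha.1.add hb.1, ha.2.1.add hb.2.1,
    (closure_mono (Function.support_add a b)).trans
      (by rw [closure_union]; exact union_subset ha.2.2 hb.2.2)⟩
  smul_mem' := fun c a ha => ⟨contDiff_const.smul ha.1, ha.2.1.smul_left (f := fun _ => c),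
    (closure_mono (Function.support_const_smul_subset c a)).trans ha.2.2⟩

lemma pderiv_add {η ψ : Euc n → ℝ} (h : ContDiff ℝ ∞ η) (h' : ContDiff ℝ ∞ ψ) (i : Fin n)
    (x : Euc n) : pderiv i (η + ψ) x = pderiv i η x + pderiv i ψ x := by
  rw [pderiv, fderiv_add (h.differentiable (by simp) x) (h'.differentiable (by simp) x)]
  rfl

lemma pderiv_smul {η : Euc n → ℝ} (h : ContDiff ℝ ∞ η) (c : ℝ) (i : Fin n)
    (x : Euc n) : pderiv i (c • η) x = c * pderiv i η x := by
  rw [pderiv, fderiv_const_smul (h.differentiable (by simp) x)]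
  rfl

lemma continuous_fwdDiffQuot {G : Type*} [NormedAddCommGroup G] [NormedSpace ℝ G]
    {v : Euc n → G} (hv : Continuous v) (i : Fin n) (h : ℝ) : Continuous (fwdDiffQuot i h v) := by
  unfold fwdDiffQuot
  fun_prop

/-- The chain rule inequality for a Lipschitz function of a smooth map. -/
lemma abs_integral_pderiv_mul_comp_conv_le {f : Euc m → ℝ} (hf : LipschitzWith 1 f)
    {ψ η : Euc n → ℝ} {U : Euc n → Euc m} (hψ : IsTest univ ψ)
    (hU : Integrable U) (hη : IsTest Ω η) (i : Fin n) :
    |∫ x, pderiv i η x * f (conv ψ U x)| ≤ ∫ x, |η x| * ‖conv (pderiv i ψ) U x‖ := by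
  set v := conv ψ U
  have hv : Continuous v := continuous_conv hψ hU
  have hfv : Continuous fun x => f (v x) := hf.continuous.comp hv
  set t : ℕ → ℝ := fun k => 1 / ((k : ℝ) + 1)
  have ht : Tendsto t atTop (𝓝 0) := tendsto_one_div_add_atTop_nhds_zero_nat
  have htp : ∀ k, 0 < t k := fun k => by positivity
  have ht1 : ∀ k, t k ≤ 1 := fun k => by
    rw [div_le_one (by positivity)]
    linarith [Nat.cast_nonneg (α := ℝ) k]
  obtain ⟨C, hC0, hC⟩ := exists_bound_fwdDiffQuot hη i
  obtain ⟨C', hC0', hC'⟩ := hη.bounded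
  obtain ⟨D, hD0, hD⟩ := exists_bound_fwdDiffQuot_conv hψ hU i
  obtain ⟨A, hA0, hA⟩ := hψ.bounded
  have hfb : ∀ x, |f (v x)| ≤ |f 0| + A * ∫ y, ‖U y‖ := fun x => by
    have h1 := hf.dist_le_mul (v x) 0
    have h2 := norm_conv_le hA hU x
    rw [dist_zero_right, Real.dist_eq, NNReal.coe_one, one_mul] at h1
    have h3 : |f (v x)| ≤ |f (v x) - f 0| + |f 0| := by simpa using abs_add_le (f (v x) - f 0) (f 0)
    linarith
  set B := Metric.cthickening 1 (tsupport η)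
  have hB : IsCompact B := hη.2.1.cthickening
  have hz : ∀ k x, x ∉ B → η (x + t k • stdVec i) = 0 ∧ η x = 0 := fun k x hx => by
    have key : ∀ y, dist x y ≤ 1 → η y = 0 := fun y hy => by
      by_contra h0
      exact hx (Metric.mem_cthickening_of_dist_le x y 1 _ (subset_tsupport _ h0) hy)
    refine ⟨key _ ?_, key x (by simp)⟩
    rw [dist_eq_norm]
    simpa [norm_smul, norm_stdVec, abs_of_pos (htp k)] using ht1 k
  have hBi : ∀ c : ℝ, Integrable (B.indicator fun _ => c) := fun c =>
    (integrableOn_const hB.measure_lt_top.ne).integrable_indicator hB.isClosed.measurableSet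
  have hηc := hη.continuous
  have hL : Tendsto (fun k => ∫ x, fwdDiffQuot i (t k) η x * f (v x)) atTop
      (𝓝 (∫ x, pderiv i η x * f (v x))) := by
    refine tendsto_integral_of_dominated_convergence
      (B.indicator fun _ => C * (|f 0| + A * ∫ y, ‖U y‖)) (fun k => ?_) (hBi _) (fun k => ?_) ?_
    · exact ((continuous_fwdDiffQuot hηc i _).mul hfv).aestronglyMeasurable
    · refine Eventually.of_forall fun x => ?_
      by_cases hx : x ∈ B
      · rw [indicator_of_mem hx, norm_mul]
        exact mul_le_mul (hC _ (htp k) x) (hfb x) (norm_nonneg _) hC0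
      · rw [indicator_of_notMem hx, fwdDiffQuot, (hz k x hx).1, (hz k x hx).2]; simp
    · exact Eventually.of_forall fun x => (tendsto_diff hη.1 ht htp i x).mul_const _
  have hR : Tendsto (fun k => ∫ x, |η (x + t k • stdVec i)| * ‖fwdDiffQuot i (t k) v x‖) atTop
      (𝓝 (∫ x, |η x| * ‖conv (pderiv i ψ) U x‖)) := by
    refine tendsto_integral_of_dominated_convergence
      (B.indicator fun _ => C' * D) (fun k => ?_) (hBi _) (fun k => ?_) ?_
    · have := continuous_fwdDiffQuot hv i (t k)
      exact Continuous.aestronglyMeasurable (by fun_prop)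
    · refine Eventually.of_forall fun x => ?_
      by_cases hx : x ∈ B
      · rw [indicator_of_mem hx, norm_mul, norm_norm, Real.norm_eq_abs, abs_abs]
        exact mul_le_mul (hC' _) (hD _ (htp k) x) (norm_nonneg _) hC0'
      · rw [indicator_of_notMem hx, (hz k x hx).1]; simp
    · exact Eventually.of_forall fun x => (tendsto_line hηc ht
        (fun k => (abs_of_pos (htp k)).le) i x).abs.mul
        (tendsto_fwdDiffQuot_conv hψ hU ht htp i x).norm
  refine le_of_tendsto_of_tendsto' hL.abs hR fun k => ?_
  set a := t k • stdVec i
  have i1 : Integrable fun x => η (x + a) * f (v x) :=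
    (hη.comp_add_const a).integrable_smul (u := fun x => f (v x))
      (hfv.locallyIntegrable.locallyIntegrableOn _)
  have i2 : Integrable fun x => η x * f (v x) :=
    hη.integrable_smul (u := fun x => f (v x)) (hfv.locallyIntegrable.locallyIntegrableOn _)
  have i3 : Integrable fun x => η (x + a) * f (v (x + a)) := i2.comp_add_right a
  -- Discrete integration by parts: translation moves the difference onto `f ∘ v` and leaves the
  -- shifted weight `η (x + a)`, which is why that weight appears in `hR`.
  have e1 : ∫ x, fwdDiffQuot i (t k) η x * f (v x)
      = ∫ x, η (x + a) * ((t k)⁻¹ * (f (v x) - f (v (x + a)))) := by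
    have e2 : ∫ x, η (x + a) * f (v (x + a)) = ∫ x, η x * f (v x) :=
      integral_add_right_eq_self (fun x => η x * f (v x)) a
    have e3 : ∀ x, fwdDiffQuot i (t k) η x * f (v x)
        = (t k)⁻¹ * (η (x + a) * f (v x) - η x * f (v x)) := fun x => by
      simp only [fwdDiffQuot, smul_eq_mul, a]; ring
    have e4 : ∀ x, η (x + a) * ((t k)⁻¹ * (f (v x) - f (v (x + a))))
        = (t k)⁻¹ * (η (x + a) * f (v x) - η (x + a) * f (v (x + a))) := fun x => by ring
    simp_rw [e3, e4]
    rw [integral_const_mul, integral_const_mul, integral_sub i1 i2, integral_sub i1 i3, e2]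
  rw [e1, ← Real.norm_eq_abs]
  refine norm_integral_le_of_norm_le ?_ (Eventually.of_forall fun x => ?_)
  · have hc : Continuous fun x => |η (x + a)| * ‖fwdDiffQuot i (t k) v x‖ := by
      have := continuous_fwdDiffQuot hv i (t k)
      fun_prop
    exact hc.integrable_of_hasCompactSupport
      ((hη.comp_add_const a).2.1.comp_left (g := abs) abs_zero).mul_right
  · rw [norm_mul, norm_mul, Real.norm_eq_abs]
    refine mul_le_mul_of_nonneg_left ?_ (abs_nonneg _)
    have h1 := hf.dist_le_mul (v (x + a)) (v x)
    rw [Real.dist_eq, NNReal.coe_one, one_mul, dist_eq_norm] at h1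
    rw [fwdDiffQuot, norm_smul, Real.norm_eq_abs (_ - _), abs_sub_comm]
    exact mul_le_mul_of_nonneg_left h1 (norm_nonneg _)

/-- The smooth inequality is applied to the averages of `U`. On the support of `η` and for small
radii their derivatives are averages of `V`, and both sides converge by `L¹` convergence. -/
lemma abs_integral_pderiv_mul_comp_le {f : Euc m → ℝ} (hf : LipschitzWith 1 f)
    {η : Euc n → ℝ} {U V : Euc n → Euc m} (hΩ : IsOpen Ω) (hU : Integrable U) (hV : Integrable V)
    (i : Fin n) (hUV : ∀ η, IsTest Ω η → ∫ x, pderiv i η x • U x = - ∫ x, η x • V x)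
    (hη : IsTest Ω η) :
    |∫ x, pderiv i η x * f (U x)| ≤ ∫ x, |η x| * ‖V x‖ := by
  obtain ⟨ρ, hρ0, hρ⟩ := hη.2.1.exists_cthickening_subset_open hΩ hη.2.2
  obtain ⟨C, hC0, hC⟩ := hη.bounded
  obtain ⟨D, hD0, hD⟩ := (hη.isTest_pderiv i).bounded
  have hfi : ∀ v : Euc n → Euc m, Integrable v → Integrable fun x => pderiv i η x * f (v x) :=
    fun v hv => (hη.isTest_pderiv i).integrable_mul_comp hf hv
  have hηi : ∀ v : Euc n → Euc m, Integrable v → Integrable fun x => |η x| * ‖v x‖ := fun v hv =>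
    hv.norm.bdd_mul hη.continuous.abs.aestronglyMeasurable
      (Eventually.of_forall fun x => by rw [Real.norm_eq_abs, abs_abs]; exact hC x)
  have hL : Tendsto (fun r => ∫ x, pderiv i η x * f (avg U r x)) (𝓝[>] 0)
      (𝓝 (∫ x, pderiv i η x * f (U x))) := by
    refine tendsto_iff_norm_sub_tendsto_zero.2 (squeeze_zero' (Eventually.of_forall
      fun _ => norm_nonneg _) ?_ (by
        simpa only [mul_zero] using (tendsto_integral_norm_avg_sub hU).const_mul D))
    filter_upwards [self_mem_nhdsWithin] with r hr
    rw [← integral_sub (hfi _ (integrable_avg hU hr)) (hfi _ hU), ← integral_const_mul]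
    refine norm_integral_le_of_norm_le
      (((integrable_avg hU hr).sub hU).norm.const_mul D) (Eventually.of_forall fun x => ?_)
    rw [← mul_sub, norm_mul]
    have := hf.dist_le_mul (avg U r x) (U x)
    rw [Real.dist_eq, NNReal.coe_one, one_mul, dist_eq_norm] at this
    exact mul_le_mul (hD x) this (norm_nonneg _) hD0
  have hR : Tendsto (fun r => ∫ x, |η x| * ‖avg V r x‖) (𝓝[>] 0)
      (𝓝 (∫ x, |η x| * ‖V x‖)) := by
    refine tendsto_iff_norm_sub_tendsto_zero.2 (squeeze_zero' (Eventually.of_forall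
      fun _ => norm_nonneg _) ?_ (by
        simpa only [mul_zero] using (tendsto_integral_norm_avg_sub hV).const_mul C))
    filter_upwards [self_mem_nhdsWithin] with r hr
    rw [← integral_sub (hηi _ (integrable_avg hV hr)) (hηi _ hV), ← integral_const_mul]
    refine norm_integral_le_of_norm_le
      (((integrable_avg hV hr).sub hV).norm.const_mul C) (Eventually.of_forall fun x => ?_)
    rw [← mul_sub, norm_mul, Real.norm_eq_abs, abs_abs]
    exact mul_le_mul (hC x) (abs_norm_sub_norm_le _ _) (norm_nonneg _) hC0
  refine le_of_tendsto_of_tendsto hL.abs hR ?_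
  filter_upwards [Ioo_mem_nhdsGT hρ0] with r hr
  refine (abs_integral_pderiv_mul_comp_conv_le hf (isTest_moll_zero hr.1) hU hη i).trans_eq ?_
  refine integral_congr_ae (Eventually.of_forall fun x => ?_)
  by_cases hx : x ∈ tsupport η
  · have hsub : Metric.closedBall x r ⊆ Ω :=
      ((Metric.closedBall_subset_closedBall hr.2.le).trans
        (Metric.closedBall_subset_cthickening hx ρ)).trans hρ
    have h1 := hUV _ (isTest_moll hr.1 hsub)
    rw [pderiv_comp_sub (isTest_moll_zero hr.1).1] at h1
    simp only [neg_smul] at h1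
    rw [integral_neg, neg_inj] at h1
    simp only [conv, avg]
    rw [h1]
  · simp only [image_eq_zero_of_notMem_tsupport hx, abs_zero, zero_mul]

/-- Lipschitz functions of Sobolev maps have weak derivatives in `L²`. -/
lemma exists_weakPartial_comp {f : Euc m → ℝ} (hf : LipschitzWith 1 f)
    {U V : Euc n → Euc m} (hΩ : IsOpen Ω) (hU : Integrable U) (hV : Integrable V)
    (hV2 : MemLp V 2) (i : Fin n)
    (hUV : ∀ η, IsTest Ω η → ∫ x, pderiv i η x • U x = - ∫ x, η x • V x) :
    ∃ g : Euc n → ℝ, MemLp g 2 ∧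
      ∀ η, IsTest Ω η → ∫ x, pderiv i η x * f (U x) = - ∫ x, η x * g x := by
  have hmem : ∀ η : testSpace Ω, MemLp (η : Euc n → ℝ) 2 := fun η =>
    Continuous.memLp_of_hasCompactSupport (η.2 : IsTest Ω _).continuous (η.2 : IsTest Ω _).2.1
  let ι : testSpace Ω →ₗ[ℝ] Lp ℝ 2 (volume : Measure (Euc n)) :=
    { toFun := fun η => (hmem η).toLp _
      map_add' := fun a b => MemLp.toLp_add (hmem a) (hmem b)
      map_smul' := fun c a => MemLp.toLp_const_smul c (hmem a) }
  have hfi : ∀ η : testSpace Ω, Integrable fun x => pderiv i η x * f (U x) := fun η =>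
    ((η.2 : IsTest Ω _).isTest_pderiv i).integrable_mul_comp hf hU
  let l : testSpace Ω →ₗ[ℝ] ℝ :=
    { toFun := fun η => ∫ x, pderiv i η x * f (U x)
      map_add' := fun a b => by
        rw [← integral_add (hfi a) (hfi b)]
        refine integral_congr_ae (Eventually.of_forall fun x => ?_)
        simp only [Submodule.coe_add, pderiv_add (a.2 : IsTest Ω _).1 (b.2 : IsTest Ω _).1, add_mul]
      map_smul' := fun c a => by
        rw [RingHom.id_apply, smul_eq_mul, ← integral_const_mul]
        refine integral_congr_ae (Eventually.of_forall fun x => ?_)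
        simp only [Submodule.coe_smul, pderiv_smul (a.2 : IsTest Ω _).1, mul_assoc] }
  -- By Cauchy–Schwarz, `∫ |η| ‖V‖` is at most the product of the `L²` norms, which is the bound
  -- required by the Riesz argument.
  obtain ⟨g, hg⟩ := exists_riesz_representation ι l ‖hV2.norm.toLp _‖ fun η => by
    refine (abs_integral_pderiv_mul_comp_le hf hΩ hU hV i hUV η.2).trans ?_
    have h1 : ∫ x, |(η : Euc n → ℝ) x| * ‖V x‖
        = inner ℝ (hV2.norm.toLp _) ((hmem η).norm.toLp _) := by
      rw [L2.inner_def]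
      refine integral_congr_ae ?_
      filter_upwards [hV2.norm.coeFn_toLp, (hmem η).norm.coeFn_toLp] with x hx hx'
      rw [hx, hx']
      simp
    rw [h1]
    refine (real_inner_le_norm _ _).trans_eq ?_
    congr 1
    simp only [ι, LinearMap.coe_mk, AddHom.coe_mk, Lp.norm_toLp, eLpNorm_norm]
  refine ⟨fun x => -g x, (Lp.memLp g).neg, fun η hη => ?_⟩
  have h1 := hg ⟨η, hη⟩
  have h2 : ∫ x, pderiv i η x * f (U x) = inner ℝ g (ι ⟨η, hη⟩) := h1
  rw [h2, L2.inner_def, ← integral_neg]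
  refine integral_congr_ae ?_
  filter_upwards [(hmem ⟨η, hη⟩).coeFn_toLp] with x hx
  simp only [ι, LinearMap.coe_mk, AddHom.coe_mk, hx]
  simp

/-- Needed to pass from the distance of the given map to its continuous representative. -/
lemma IsWeaklySubharmonic.congr {v w : Euc n → ℝ} (hΩ : IsOpen Ω)
    (h : IsWeaklySubharmonic Ω v) (hvw : w =ᵐ[volume.restrict Ω] v) : IsWeaklySubharmonic Ω w := by
  have hl : ∀ {f f' : Euc n → ℝ}, f' =ᵐ[volume.restrict Ω] f → LocallyIntegrableOn f Ω →
      LocallyIntegrableOn f' Ω := fun {f f'} hff hf => by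
    rw [locallyIntegrableOn_iff hΩ.isLocallyClosed] at hf ⊢
    exact fun k hk hkc => (hf k hk hkc).congr_fun_ae (ae_restrict_of_ae_restrict_of_subset hk hff.symm)
  obtain ⟨h1, g, hg, hη⟩ := h
  refine ⟨hl (hvw.mono fun x hx => by simp only [hx]) h1, g, fun i => ⟨⟨hl hvw (hg i).1.1,
    (hg i).1.2.1, fun η hη => ?_⟩, (hg i).2⟩, hη⟩
  rw [← (hg i).1.2.2 η hη]
  exact integral_congr_ae (hvw.mono fun x hx => by simp only [hx])

lemma memLp_infDist {u : Euc n → Euc m} {K : Set (Euc m)} {μ : Measure (Euc n)} [IsFiniteMeasure μ]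
    (hne : K.Nonempty) (hu : MemLp u 2 μ) : MemLp (fun x => Metric.infDist (u x) K) 2 μ := by
  obtain ⟨y, hy⟩ := hne
  refine MemLp.mono (g := fun x => ‖u x - y‖) (hu.sub (memLp_const y)).norm
    ((Metric.continuous_infDist_pt K).comp_aestronglyMeasurable hu.1) (Eventually.of_forall fun x => ?_)
  rw [Real.norm_of_nonneg Metric.infDist_nonneg, norm_norm, ← dist_eq_norm]
  exact Metric.infDist_le_dist_of_mem hy

/-- The distance of a Sobolev map to a set is weakly subharmonic if it is subharmonic in the sense
of distributions. -/
theorem isWeaklySubharmonic_infDist {u : Euc n → Euc m} {K : Set (Euc m)} (hΩ : IsOpen Ω)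
    (hΩb : Bornology.IsBounded Ω) (hne : K.Nonempty) (hu : MemW12 Ω u)
    (hsub : ∀ η, IsTest Ω η → (∀ x, 0 ≤ η x) → 0 ≤ ∫ x, lap η x * Metric.infDist (u x) K) :
    IsWeaklySubharmonic Ω (fun x => Metric.infDist (u x) K) := by
  have : IsFiniteMeasure (volume.restrict Ω) := ⟨by
    rw [Measure.restrict_apply_univ]; exact hΩb.measure_lt_top⟩
  have hd := memLp_infDist hne hu.1
  have hU : Integrable (Ω.indicator u) :=
    (integrable_indicator_iff hΩ.measurableSet).2 (hu.1.integrable (by norm_num))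
  have hV2 : ∀ i, MemLp (Ω.indicator (weakPartial Ω u i)) 2 := fun i =>
    (memLp_indicator_iff_restrict hΩ.measurableSet).2 (hu.memLp_weakPartial hΩ i)
  have hV : ∀ i, Integrable (Ω.indicator (weakPartial Ω u i)) := fun i =>
    (integrable_indicator_iff hΩ.measurableSet).2
      ((hu.memLp_weakPartial hΩ i).integrable (by norm_num))
  have hind : ∀ {η : Euc n → ℝ} {v : Euc n → Euc m}, IsTest Ω η →
      ∫ x, η x • Ω.indicator v x = ∫ x in Ω, η x • v x := fun {η v} hη => by
    rw [← hη.setIntegral_smul]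
    exact setIntegral_congr_fun hΩ.measurableSet fun x hx => by simp only [indicator_of_mem hx]
  -- Extension by zero need not be Sobolev on the whole space, but only test functions supported in
  -- `Ω` are used.
  choose g hg hg' using fun i => exists_weakPartial_comp (Metric.lipschitz_infDist_pt K) hΩ hU
    (hV i) (hV2 i) i fun η hη => by
      rw [hind (hη.isTest_pderiv i), hind hη]
      exact (hu.hasWeakPartial i).2.2 η hη
  have hdist : ∀ {η : Euc n → ℝ}, IsTest Ω η →
      ∫ x, η x * Metric.infDist (Ω.indicator u x) K = ∫ x, η x * Metric.infDist (u x) K :=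
    fun {η} hη => integral_congr_ae (Eventually.of_forall fun x => by
      by_cases hx : x ∈ Ω
      · simp only [indicator_of_mem hx]
      · simp only [hη.eq_zero hx, zero_mul])
  have hdl : LocallyIntegrableOn (fun x => Metric.infDist (u x) K) Ω :=
    IntegrableOn.locallyIntegrableOn (hd.integrable (by norm_num))
  have hgl : ∀ i, LocallyIntegrableOn (g i) Ω := fun i =>
    ((hg i).locallyIntegrable (by norm_num)).locallyIntegrableOn _
  refine ⟨IntegrableOn.locallyIntegrableOn hd.integrable_sq, g, fun i => ⟨⟨hdl, hgl i,
    fun η hη => ?_⟩, ((hg i).integrable_sq).locallyIntegrable.locallyIntegrableOn _⟩,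
    fun η hη hη0 => ?_⟩
  · rw [(hη.isTest_pderiv i).setIntegral_smul, hη.setIntegral_smul]
    simp only [smul_eq_mul]
    rw [← hdist (hη.isTest_pderiv i)]
    exact hg' i η hη
  · have hi : ∀ i, Integrable fun x => g i x * pderiv i η x := fun i => by
      have := (hη.isTest_pderiv i).integrable_smul (hgl i)
      simpa only [smul_eq_mul, mul_comm] using this
    rw [setIntegral_eq_integral_of_forall_compl_eq_zero, integral_finsetSum _ fun i _ => hi i]
    -- A second integration by parts turns the Dirichlet pairing into minus the distributional
    -- Laplacian.
    · have h1 : ∀ i, ∫ x, g i x * pderiv i η x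
          = -∫ x, pderiv i (pderiv i η) x * Metric.infDist (u x) K := fun i => by
        rw [← hdist ((hη.isTest_pderiv i).isTest_pderiv i), hg' i _ (hη.isTest_pderiv i), neg_neg]
        simp_rw [mul_comm]
      simp_rw [h1, Finset.sum_neg_distrib]
      have h3 : ∀ i, Integrable fun x => pderiv i (pderiv i η) x * Metric.infDist (u x) K := fun i =>
        ((hη.isTest_pderiv i).isTest_pderiv i).integrable_smul hdl
      rw [← integral_finsetSum _ fun i _ => h3 i]
      have h2 := hsub η hη hη0
      simp_rw [lap, Finset.sum_mul] at h2
      linarith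
    · intro x hx
      exact Finset.sum_eq_zero fun i _ => by rw [(hη.isTest_pderiv i).eq_zero hx, mul_zero]

end Gradient

end ConstraintMap

end

noncomputable section

namespace ConstraintMap

/-! ### The upper semicontinuous representative; continuity of harmonic maps. -/

section UpperRepresentative

variable {n : ℕ} {Ω : Set (Euc n)} {w : Euc n → ℝ}

/-- Nonnegative integrable functions which are subharmonic on `Ω` in the sense of distributions. -/
structure IsDistribSubharmonic (Ω : Set (Euc n)) (w : Euc n → ℝ) : Prop where
  isOpen : IsOpen Ω
  integrable : Integrable w
  nonneg : ∀ x, 0 ≤ w x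
  lap_nonneg : ∀ η, IsTest Ω η → (∀ x, 0 ≤ η x) → 0 ≤ ∫ x, lap η x • w x

/-- The upper semicontinuous representative of a subharmonic function: the infimum of its
averages. -/
def upperRep (Ω : Set (Euc n)) (w : Euc n → ℝ) (x : Euc n) : ℝ :=
  sInf ((fun r => avg w r x) '' {r | 0 < r ∧ Metric.closedBall x r ⊆ Ω})

namespace IsDistribSubharmonic

lemma avg_nonneg (h : IsDistribSubharmonic Ω w) {r : ℝ} (hr : 0 < r) (x : Euc n) :
    0 ≤ avg w r x :=
  integral_nonneg fun y => mul_nonneg (moll_nonneg hr _) (h.nonneg y)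

lemma bddBelow (h : IsDistribSubharmonic Ω w) (x : Euc n) :
    BddBelow ((fun r => avg w r x) '' {r | 0 < r ∧ Metric.closedBall x r ⊆ Ω}) :=
  ⟨0, by rintro _ ⟨r, hr, rfl⟩; exact h.avg_nonneg hr.1 x⟩

lemma upperRep_nonneg (h : IsDistribSubharmonic Ω w) (x : Euc n) : 0 ≤ upperRep Ω w x :=
  Real.sInf_nonneg (by rintro _ ⟨r, hr, rfl⟩; exact h.avg_nonneg hr.1 x)

lemma upperRep_le (h : IsDistribSubharmonic Ω w) {x : Euc n} {r : ℝ} (hr : 0 < r)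
    (hx : Metric.closedBall x r ⊆ Ω) : upperRep Ω w x ≤ avg w r x :=
  csInf_le (h.bddBelow x) ⟨r, ⟨hr, hx⟩, rfl⟩

lemma exists_avg_lt (h : IsDistribSubharmonic Ω w) {x : Euc n} (hx : x ∈ Ω) {ε : ℝ} (hε : 0 < ε) :
    ∃ r, 0 < r ∧ Metric.closedBall x r ⊆ Ω ∧ avg w r x < upperRep Ω w x + ε := by
  obtain ⟨ρ, hρ, hρ'⟩ := Metric.nhds_basis_closedBall.mem_iff.1 (h.isOpen.mem_nhds hx)
  obtain ⟨_, ⟨r, hr, rfl⟩, hlt⟩ := exists_lt_of_csInf_lt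
    (s := (fun r => avg w r x) '' {r | 0 < r ∧ Metric.closedBall x r ⊆ Ω})
    ⟨_, ρ, ⟨hρ, hρ'⟩, rfl⟩ (lt_add_of_pos_right _ hε)
  exact ⟨r, hr.1, hr.2, hlt⟩

/-- Averages increase with the radius, so their infimum is their limit as the radius shrinks. -/
lemma tendsto_avg (h : IsDistribSubharmonic Ω w) {x : Euc n} (hx : x ∈ Ω) :
    Tendsto (fun r => avg w r x) (𝓝[>] 0) (𝓝 (upperRep Ω w x)) := by
  refine Metric.tendsto_nhds.2 fun ε hε => ?_
  obtain ⟨r, hr, hrΩ, hlt⟩ := h.exists_avg_lt hx hε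
  filter_upwards [Ioo_mem_nhdsGT hr] with s hs
  have h1 := h.upperRep_le hs.1 ((Metric.closedBall_subset_closedBall hs.2.le).trans hrΩ)
  have h2 := avg_mono h.integrable h.lap_nonneg hs.1 hs.2.le hrΩ
  rw [Real.dist_eq, abs_of_nonneg (by linarith)]
  linarith

/-- The upper representative is upper semicontinuous. -/
lemma eventually_upperRep_lt (h : IsDistribSubharmonic Ω w) {x : Euc n} (hx : x ∈ Ω) {ε : ℝ}
    (hε : 0 < ε) : ∀ᶠ y in 𝓝 x, upperRep Ω w y < upperRep Ω w x + ε := by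
  obtain ⟨r, hr, hrΩ, hlt⟩ := h.exists_avg_lt hx hε
  -- With half the radius, closed balls around points `y` near `x` stay inside the ball already
  -- known to lie in `Ω`, and the average of fixed radius is continuous in `y`.
  have hr2 : 0 < r / 2 := half_pos hr
  have hlt' : avg w (r / 2) x < upperRep Ω w x + ε :=
    (avg_mono h.integrable h.lap_nonneg hr2 (half_le_self hr.le) hrΩ).trans_lt hlt
  filter_upwards [(continuous_avg h.integrable hr2).continuousAt.eventually_lt_const hlt',
    Metric.ball_mem_nhds x hr2] with y hy hyb
  refine (h.upperRep_le hr2 (subset_trans (Metric.closedBall_subset_closedBall' ?_) hrΩ)).trans_lt hy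
  have := Metric.mem_ball.1 hyb
  linarith

lemma ae_eq (h : IsDistribSubharmonic Ω w) : ∀ᵐ x, x ∈ Ω → upperRep Ω w x = w x := by
  obtain ⟨ns, hns, hae⟩ := exists_seq_avg_tendsto_ae h.integrable tendsto_radii
  filter_upwards [hae] with x hx hxΩ
  exact tendsto_nhds_unique
    ((h.tendsto_avg hxΩ).comp (tendsto_radii.comp hns.tendsto_atTop)) hx

/-- Upper semicontinuity bounds nearby values from above by `ε`, nonnegativity from below by zero.
-/
lemma continuousAt_of_eq_zero (h : IsDistribSubharmonic Ω w) {x : Euc n} (hx : x ∈ Ω)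
    (h0 : upperRep Ω w x = 0) : ContinuousAt (upperRep Ω w) x := by
  refine Metric.tendsto_nhds.2 fun ε hε => ?_
  filter_upwards [h.eventually_upperRep_lt hx hε] with y hy
  have := h.upperRep_nonneg y
  rw [h0] at hy ⊢
  rw [Real.dist_eq, sub_zero, abs_of_nonneg this]
  linarith

/-- The upper representative is continuous where `w` has an essential limit. -/
lemma continuousAt_of_essLimit (h : IsDistribSubharmonic Ω w) {x : Euc n} (hx : x ∈ Ω) {c : ℝ}
    (hc : ∀ ε > 0, ∃ δ > 0, ∀ᵐ y, y ∈ Metric.ball x δ → |w y - c| ≤ ε) :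
    ContinuousAt (upperRep Ω w) x := by
  have key : ∀ ε > 0, ∃ δ > 0, ∀ y ∈ Metric.ball x δ, |upperRep Ω w y - c| ≤ ε := fun ε hε => by
    obtain ⟨δ, hδ, hae⟩ := hc ε hε
    obtain ⟨ρ, hρ, hρ'⟩ := Metric.isOpen_iff.1 h.isOpen x hx
    refine ⟨min (δ / 2) ρ, by positivity, fun y hy => ?_⟩
    have hy1 : dist y x < δ / 2 := (Metric.mem_ball.1 hy).trans_le (min_le_left _ _)
    have hyΩ : y ∈ Ω := hρ' ((Metric.mem_ball.1 hy).trans_le (min_le_right _ _))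
    refine le_of_tendsto ((h.tendsto_avg hyΩ).sub_const c).abs ?_
    filter_upwards [Ioo_mem_nhdsGT (half_pos hδ)] with r hr
    refine norm_avg_sub_le h.integrable hr.1 y c ?_
    filter_upwards [hae] with z hz hzy
    refine hz (Metric.mem_ball.2 ?_)
    have := dist_triangle z y x
    have := Metric.mem_ball.1 hzy
    linarith [hr.2]
  have hxc : upperRep Ω w x = c := by
    refine sub_eq_zero.1 (abs_nonpos_iff.1 (le_of_forall_pos_le_add fun ε hε => ?_))
    obtain ⟨δ, hδ, hk⟩ := key ε hε
    linarith [hk x (Metric.mem_ball_self hδ)]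
  refine Metric.tendsto_nhds.2 fun ε hε => ?_
  obtain ⟨δ, hδ, hk⟩ := key (ε / 2) (half_pos hε)
  filter_upwards [Metric.ball_mem_nhds x hδ] with y hy
  rw [hxc, Real.dist_eq]
  linarith [hk y hy]

/-- Upper semicontinuity passes to `w` itself almost everywhere. This gives local boundedness of the
map near a point and the upper bound on its blow-ups. -/
lemma exists_ae_le (h : IsDistribSubharmonic Ω w) {x : Euc n} (hx : x ∈ Ω) {ε : ℝ} (hε : 0 < ε) :
    ∃ δ > 0, Metric.closedBall x δ ⊆ Ω ∧
      ∀ᵐ y, y ∈ Metric.closedBall x δ → w y ≤ upperRep Ω w x + ε := by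
  obtain ⟨δ, hδ, hδ'⟩ := Metric.nhds_basis_closedBall.mem_iff.1
    (inter_mem (h.isOpen.mem_nhds hx) (h.eventually_upperRep_lt hx hε))
  refine ⟨δ, hδ, hδ'.trans inter_subset_left, ?_⟩
  filter_upwards [h.ae_eq] with y hy hyb
  rw [← hy (hδ' hyb).1]
  exact le_of_lt (hδ' hyb).2

end IsDistribSubharmonic

/-- Weakly harmonic maps are continuous. -/
lemma essContinuousAt_of_harmonic {G : Type*} [NormedAddCommGroup G] [NormedSpace ℝ G]
    [CompleteSpace G] (hΩ : IsOpen Ω) {φ : Euc n → G} (hφ : IntegrableOn φ Ω)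
    (hharm : ∀ η, IsTest Ω η → ∫ x, lap η x • φ x = 0) {x : Euc n} (hx : x ∈ Ω) :
    EssContinuousAt Ω φ x := by
  classical
  obtain ⟨ρ, hρ, hρΩ⟩ := Metric.isOpen_iff.1 hΩ x hx
  set w := Ω.indicator φ
  have hw : Integrable w := (integrable_indicator_iff hΩ.measurableSet).2 hφ
  have hwh : ∀ η, IsTest Ω η → ∫ x, lap η x • w x = 0 := fun η hη => by
    rw [← hharm η hη]
    refine integral_congr_ae (Eventually.of_forall fun y => ?_)
    by_cases hy : y ∈ Ω
    · simp only [w, indicator_of_mem hy]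
    · simp only [hη.lap_eq_zero hy, zero_smul]
  have hρ2 : 0 < ρ / 2 := half_pos hρ
  obtain ⟨ns, hns, hae⟩ := exists_seq_avg_tendsto_ae hw tendsto_radii
  -- Near `x` the average of radius `ρ / 2` equals all smaller averages, which converge to `φ`
  -- almost everywhere along a sequence; and it is continuous.
  refine ⟨fun y => if y ∈ Metric.ball x (ρ / 2) then avg w (ρ / 2) y else φ y, ?_, ?_⟩
  · rw [EventuallyEq, ae_restrict_iff' hΩ.measurableSet]
    filter_upwards [hae] with y hy hyΩ
    split_ifs with hyb
    · have hsub : Metric.closedBall y (ρ / 2) ⊆ Ω := fun z hz => hρΩ <| by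
        have h1 := Metric.mem_closedBall.1 hz
        have h2 := Metric.mem_ball.1 hyb
        have h3 := dist_triangle z y x
        exact Metric.mem_ball.2 (by linarith)
      have hr := (tendsto_radii.comp hns.tendsto_atTop).eventually (Ioo_mem_nhdsGT hρ2)
      have h4 : w y = φ y := indicator_of_mem hyΩ φ
      rw [← h4]
      refine tendsto_nhds_unique (tendsto_const_nhds.congr' ?_) hy
      filter_upwards [hr] with k hk
      exact avg_eq_of_harmonic hw hwh hk.1 hk.2.le hsub
    · rfl
  · refine (continuous_avg hw hρ2).continuousAt.congr ?_
    filter_upwards [Metric.ball_mem_nhds x hρ2] with y hy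
    rw [if_pos hy]

end UpperRepresentative

end ConstraintMap

end

noncomputable section

namespace ConstraintMap

/-! ### Weak compactness in local `L²`. -/

section WeakCompactness

variable {n : ℕ} {H : Type*} [NormedAddCommGroup H] [InnerProductSpace ℝ H]

/-- Bounded sequences in a separable Hilbert space have weakly convergent subsequences. -/
lemma exists_weak_subseq_limit {E : Type*} [NormedAddCommGroup E] [InnerProductSpace ℝ E]
    [CompleteSpace E] [TopologicalSpace.SeparableSpace E] (f : ℕ → E) (C : ℝ)
    (hf : ∀ k, ‖f k‖ ≤ C) :
    ∃ ns : ℕ → ℕ, StrictMono ns ∧ ∃ φ : E, ∀ g : E,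
      Tendsto (fun k => inner ℝ (f (ns k)) g) atTop (𝓝 (inner ℝ φ g)) := by
  obtain ⟨L, -, ns, hns, hL⟩ := WeakDual.isSeqCompact_closedBall ℝ E
    (0 : StrongDual ℝ E) C (x := fun k => StrongDual.toWeakDual (InnerProductSpace.toDual ℝ E (f k)))
    (fun k => by
      rw [mem_preimage, mem_closedBall_zero_iff]
      exact ((InnerProductSpace.toDual ℝ E).norm_map (f k)).trans_le (hf k))
  refine ⟨ns, hns, (InnerProductSpace.toDual ℝ E).symm (WeakDual.toStrongDual L), fun g => ?_⟩
  rw [InnerProductSpace.toDual_symm_apply]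
  exact ((WeakDual.eval_continuous g).tendsto L).comp hL

/-- Integer part of the norm. -/
def shell (x : Euc n) : ℕ := ⌊‖x‖⌋₊

lemma measurable_shell : Measurable (shell (n := n)) := Nat.measurable_floor.comp measurable_norm

lemma shell_lt {x : Euc n} {j : ℕ} (hx : x ∈ Metric.ball 0 (j : ℝ)) : shell x < j :=
  (Nat.floor_lt (norm_nonneg _)).2 (mem_ball_zero_iff.1 hx)

lemma mem_ball_of_shell (x : Euc n) : x ∈ Metric.ball 0 ((shell x + 1 : ℕ) : ℝ) := by
  rw [mem_ball_zero_iff]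
  exact_mod_cast Nat.lt_floor_add_one ‖x‖

lemma exists_bound_shell (θ : ℕ → ℝ) (j : ℕ) :
    ∃ C, ∀ x : Euc n, x ∈ Metric.ball 0 (j : ℝ) → |θ (shell x)| ≤ C := by
  refine ⟨∑ i ∈ Finset.range j, |θ i|, fun x hx => ?_⟩
  exact Finset.single_le_sum (f := fun i => |θ i|) (fun i _ => abs_nonneg _)
    (Finset.mem_range.2 (shell_lt hx))

lemma memLp_shell_smul (θ : ℕ → ℝ) (j : ℕ) {f : Euc n → H}
    (hf : MemLp f 2 (volume.restrict (Metric.ball 0 (j : ℝ)))) :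
    MemLp (fun x => θ (shell x) • f x) 2 (volume.restrict (Metric.ball 0 (j : ℝ))) := by
  obtain ⟨C, hC⟩ := exists_bound_shell (n := n) θ j
  have hm : Measurable fun x : Euc n => θ (shell x) := (measurable_of_countable θ).comp measurable_shell
  refine hf.of_le_mul (c := C) (hm.aestronglyMeasurable.smul hf.1) ?_
  filter_upwards [ae_restrict_mem Metric.isOpen_ball.measurableSet] with x hx
  rw [norm_smul]
  exact mul_le_mul_of_nonneg_right (hC x hx) (norm_nonneg _)

/-- Weights which make a locally bounded sequence bounded in `L²`. -/
lemma integral_weight_le (b : ℕ → ℝ) {k : ℕ} {f : Euc n → H}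
    (hf : MemLp f 2 (volume.restrict (Metric.ball 0 (k : ℝ))))
    (hb : ∀ j : ℕ, j ≤ k → ∫ x in Metric.ball 0 (j : ℝ), ‖f x‖ ^ 2 ≤ b j) :
    let F := (Metric.ball 0 (k : ℝ)).indicator
      (fun x => √((1 / 2) ^ shell x / (1 + |b (shell x + 1)|)) • f x)
    MemLp F 2 ∧ ∫ x, ‖F x‖ ^ 2 ≤ 2 := by
  intro F
  -- Shell `i` lies in the ball of radius `i + 1`, where the mass is at most `b (i + 1)` once `i + 1
  -- ≤ k`. Its weighted contribution is thus at most `2⁻ⁱ`, and these sum to 2.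
  set a : ℕ → ℝ := fun i => (1 / 2) ^ i / (1 + |b (i + 1)|)
  have ha : ∀ i, 0 ≤ a i := fun i => by positivity
  have hF : MemLp F 2 := (memLp_indicator_iff_restrict Metric.isOpen_ball.measurableSet).2
    (memLp_shell_smul (fun i => √(a i)) k hf)
  refine ⟨hF, ?_⟩
  rw [integral_eq_lintegral_of_nonneg_ae (Eventually.of_forall fun x => by positivity)
    (by exact hF.1.norm.pow 2)]
  refine ENNReal.toReal_le_of_le_ofReal (by norm_num) ?_
  have hsh : ∀ i, MeasurableSet {x : Euc n | shell x = i} := fun i =>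
    measurable_shell (measurableSet_singleton i)
  have hcover : (⋃ i, {x : Euc n | shell x = i}) = univ := by
    ext x; simp
  rw [← setLIntegral_univ, ← hcover, lintegral_iUnion hsh (fun i j hij => by
    refine Set.disjoint_left.2 fun x hx hx' => hij ?_
    exact (mem_ofPred.1 hx).symm.trans hx')]
  have hterm : ∀ i, ∫⁻ x in {x : Euc n | shell x = i}, ENNReal.ofReal (‖F x‖ ^ 2)
      ≤ 2⁻¹ ^ i := fun i => by
    by_cases hik : i + 1 ≤ k
    · have hsub : {x : Euc n | shell x = i} ⊆ Metric.ball 0 ((i + 1 : ℕ) : ℝ) := fun x hx => by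
        rw [← mem_ofPred.1 hx]; exact mem_ball_of_shell x
      have hint : IntegrableOn (fun x => ‖f x‖ ^ 2) (Metric.ball 0 ((i + 1 : ℕ) : ℝ)) := by
        refine IntegrableOn.mono_set (t := Metric.ball 0 (k : ℝ)) ?_
          (Metric.ball_subset_ball (by exact_mod_cast hik))
        exact (memLp_two_iff_integrable_sq_norm hf.1).1 hf
      calc ∫⁻ x in {x : Euc n | shell x = i}, ENNReal.ofReal (‖F x‖ ^ 2)
          ≤ ∫⁻ x in {x : Euc n | shell x = i}, ENNReal.ofReal (a i) * ENNReal.ofReal (‖f x‖ ^ 2) := by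
            refine setLIntegral_mono' (hsh i) fun x hx => ?_
            rw [← ENNReal.ofReal_mul (ha i)]
            refine ENNReal.ofReal_le_ofReal ?_
            by_cases hxk : x ∈ Metric.ball 0 (k : ℝ)
            · simp only [F, indicator_of_mem hxk, norm_smul, mul_pow]
              rw [Real.norm_of_nonneg (Real.sqrt_nonneg _), Real.sq_sqrt (ha _),
                mem_ofPred.1 hx]
            · rw [show F x = 0 from indicator_of_notMem hxk _, norm_zero, zero_pow two_ne_zero]
              exact mul_nonneg (ha i) (by positivity)
        _ = ENNReal.ofReal (a i) * ∫⁻ x in {x : Euc n | shell x = i}, ENNReal.ofReal (‖f x‖ ^ 2) :=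
            lintegral_const_mul' _ _ ENNReal.ofReal_ne_top
        _ ≤ ENNReal.ofReal (a i) * ∫⁻ x in Metric.ball 0 ((i + 1 : ℕ) : ℝ),
              ENNReal.ofReal (‖f x‖ ^ 2) := by
            gcongr
        _ ≤ ENNReal.ofReal (a i) * ENNReal.ofReal (b (i + 1)) := by
            gcongr
            rw [← ofReal_integral_eq_lintegral_ofReal hint
              (Eventually.of_forall fun x => by positivity)]
            exact ENNReal.ofReal_le_ofReal (hb _ hik)
        _ ≤ ENNReal.ofReal ((1 / 2) ^ i) := by
            rw [← ENNReal.ofReal_mul (ha i)]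
            refine ENNReal.ofReal_le_ofReal ?_
            rw [div_mul_eq_mul_div, div_le_iff₀ (by positivity)]
            gcongr
            linarith [le_abs_self (b (i + 1))]
        _ = 2⁻¹ ^ i := by
            rw [ENNReal.ofReal_pow (by norm_num), one_div, ENNReal.ofReal_inv_of_pos (by norm_num)]
            simp
    · have : ∫⁻ x in {x : Euc n | shell x = i}, ENNReal.ofReal (‖F x‖ ^ 2) = 0 := by
        rw [setLIntegral_congr_fun (g := fun _ => 0) (hsh i) fun x hx => ?_, lintegral_zero]
        have hxk : x ∉ Metric.ball 0 (k : ℝ) := fun h => hik (by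
          have := shell_lt h
          rw [mem_ofPred.1 hx] at this
          exact this)
        simp [F, indicator_of_notMem hxk]
      rw [this]; exact zero_le
  calc _ ≤ ∑' i, (2⁻¹ : ENNReal) ^ i := ENNReal.tsum_le_tsum hterm
    _ = 2 := by rw [ENNReal.tsum_geometric, ENNReal.one_sub_inv_two, inv_inv]
    _ = ENNReal.ofReal 2 := by simp

/-- Weak sequential compactness in `L²_loc(ℝ^n)`. -/
theorem exists_weak_limit_loc [CompleteSpace H] [TopologicalSpace.SeparableSpace H] (b : ℕ → ℝ)
    (F : ℕ → Euc n → H)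
    (hF : ∀ k, MemLp (F k) 2 (volume.restrict (Metric.ball 0 (k : ℝ))))
    (hb : ∀ k j : ℕ, j ≤ k → ∫ x in Metric.ball 0 (j : ℝ), ‖F k x‖ ^ 2 ≤ b j) :
    ∃ ns : ℕ → ℕ, StrictMono ns ∧ ∃ φ : Euc n → H, ∀ j : ℕ,
      MemLp φ 2 (volume.restrict (Metric.ball 0 (j : ℝ))) ∧
      ∀ g : Euc n → H, MemLp g 2 (volume.restrict (Metric.ball 0 (j : ℝ))) →
        Tendsto (fun k => ∫ x in Metric.ball 0 (j : ℝ), inner ℝ (F (ns k) x) (g x)) atTop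
          (𝓝 (∫ x in Metric.ball 0 (j : ℝ), inner ℝ (φ x) (g x))) := by
  have : Fact ((2 : ENNReal) ≠ ⊤) := ⟨by simp⟩
  set a : ℕ → ℝ := fun i => (1 / 2) ^ i / (1 + |b (i + 1)|)
  have ha : ∀ i, 0 < a i := fun i => by positivity
  set θ : ℕ → ℝ := fun i => √(a i)
  have hθ : ∀ i, θ i ≠ 0 := fun i => (Real.sqrt_pos.2 (ha i)).ne'
  have hΨ := fun k => integral_weight_le b (hF k) (hb k)
  have hnorm : ∀ k, ‖(hΨ k).1.toLp‖ ≤ 2 := fun k => by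
    have h1 : ‖(hΨ k).1.toLp‖ ^ 2 ≤ 2 := by
      rw [← real_inner_self_eq_norm_sq, L2.inner_def]
      refine le_trans (le_of_eq (integral_congr_ae ?_)) (hΨ k).2
      filter_upwards [(hΨ k).1.coeFn_toLp] with x hx
      rw [hx, real_inner_self_eq_norm_sq]
    nlinarith [norm_nonneg ((hΨ k).1.toLp)]
  obtain ⟨ns, hns, φ, hφ⟩ := exists_weak_subseq_limit (fun k => (hΨ k).1.toLp) 2 hnorm
  refine ⟨ns, hns, fun x => (θ (shell x))⁻¹ • φ x, fun j => ?_⟩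
  have hB : MeasurableSet (Metric.ball (0 : Euc n) (j : ℝ)) := Metric.isOpen_ball.measurableSet
  refine ⟨memLp_shell_smul (fun i => (θ i)⁻¹) j ((Lp.memLp φ).restrict _), fun g hg => ?_⟩
  -- The weight is undone on the test field. This keeps it in `L²`, because on a fixed ball the
  -- weight takes only finitely many values, none of them zero.
  have hg' : MemLp ((Metric.ball 0 (j : ℝ)).indicator fun x => (θ (shell x))⁻¹ • g x) 2 :=
    (memLp_indicator_iff_restrict hB).2 (memLp_shell_smul (fun i => (θ i)⁻¹) j hg)
  have key : ∀ (f : Lp H 2 (volume : Measure (Euc n))),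
      inner ℝ f hg'.toLp = ∫ x in Metric.ball 0 (j : ℝ), inner ℝ ((θ (shell x))⁻¹ • f x) (g x) := by
    intro f
    rw [L2.inner_def, ← integral_indicator hB]
    refine integral_congr_ae ?_
    filter_upwards [hg'.coeFn_toLp] with x hx
    rw [hx]
    by_cases hxj : x ∈ Metric.ball 0 (j : ℝ)
    · rw [indicator_of_mem hxj, indicator_of_mem hxj, real_inner_smul_right, real_inner_smul_left]
    · rw [indicator_of_notMem hxj, indicator_of_notMem hxj, inner_zero_right]
  have h1 := hφ hg'.toLp
  rw [key φ] at h1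
  refine h1.congr' ?_
  filter_upwards [eventually_ge_atTop j] with k hk
  rw [key]
  refine setIntegral_congr_ae hB ?_
  filter_upwards [(hΨ (ns k)).1.coeFn_toLp] with x hx hxj
  have hxk : x ∈ Metric.ball 0 ((ns k : ℕ) : ℝ) :=
    Metric.ball_subset_ball (by exact_mod_cast hk.trans (hns.id_le k)) hxj
  rw [hx, indicator_of_mem hxk, smul_smul, inv_mul_cancel₀ (hθ _), one_smul]

end WeakCompactness

end ConstraintMap

end

noncomputable section

namespace ConstraintMap

/-! ### Behaviour of Sobolev maps and energies under rescaling. -/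

section Rescaling

variable {n : ℕ} {G : Type*} [NormedAddCommGroup G] [NormedSpace ℝ G]
  {x₀ : Euc n} {r R : ℝ}

lemma map_affine (x₀ : Euc n) (hr : 0 < r) :
    Measure.map (fun x : Euc n => x₀ + r • x) volume = ENNReal.ofReal ((r ^ n)⁻¹) • volume := by
  have h : (fun x : Euc n => x₀ + r • x) = (fun x => x₀ + x) ∘ (fun x => r • x) := rfl
  rw [h, ← Measure.map_map (measurable_const_add _) (measurable_const_smul _),
    Measure.map_addHaar_smul _ hr.ne', Measure.map_smul, map_add_left_eq_self, finrank_euclideanSpace,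
    Fintype.card_fin, abs_of_pos (by positivity)]

lemma memLp_rescale {p : ENNReal} {f : Euc n → G} (hf : MemLp f p) (x₀ : Euc n) (hr : 0 < r) :
    MemLp (rescale f x₀ r) p := by
  refine MemLp.comp_of_map (f := fun x : Euc n => x₀ + r • x) ?_
    (Continuous.aemeasurable (by fun_prop))
  rw [map_affine x₀ hr]
  exact hf.smul_measure ENNReal.ofReal_ne_top

lemma mem_ball_affine (hr : 0 < r) {x : Euc n} :
    x₀ + r • x ∈ Metric.ball x₀ (r * R) ↔ x ∈ Metric.ball 0 R := by
  rw [Metric.mem_ball, Metric.mem_ball, dist_eq_norm, dist_zero_right, add_sub_cancel_left,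
    norm_smul, Real.norm_of_nonneg hr.le, mul_lt_mul_iff_right₀ hr]

lemma rescale_indicator {E : Type*} [Zero E] (f : Euc n → E) (hr : 0 < r) (x : Euc n) :
    (Metric.ball x₀ (r * R)).indicator f (x₀ + r • x)
      = (Metric.ball 0 R).indicator (fun x => f (x₀ + r • x)) x := by
  by_cases hx : x ∈ Metric.ball 0 R
  · rw [indicator_of_mem hx, indicator_of_mem ((mem_ball_affine hr).2 hx)]
  · rw [indicator_of_notMem hx, indicator_of_notMem fun h => hx ((mem_ball_affine hr).1 h)]

lemma memLp_rescale_ball {p : ENNReal} {f : Euc n → G} (hr : 0 < r)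
    (hf : MemLp f p (volume.restrict (Metric.ball x₀ (r * R)))) :
    MemLp (rescale f x₀ r) p (volume.restrict (Metric.ball 0 R)) := by
  rw [← memLp_indicator_iff_restrict Metric.isOpen_ball.measurableSet] at hf ⊢
  convert memLp_rescale hf x₀ hr using 1
  ext1 x
  exact (rescale_indicator f hr x).symm

lemma setIntegral_rescale (f : Euc n → G) (hr : 0 < r) :
    ∫ x in Metric.ball 0 R, f (x₀ + r • x)
      = (r ^ n)⁻¹ • ∫ y in Metric.ball x₀ (r * R), f y := by
  rw [← integral_indicator Metric.isOpen_ball.measurableSet,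
    ← integral_indicator Metric.isOpen_ball.measurableSet, ← integral_comp_affine _ x₀ hr]
  simp_rw [rescale_indicator f hr]

lemma ae_rescale {P : Euc n → Prop} (hr : 0 < r)
    (h : ∀ᵐ y, y ∈ Metric.ball x₀ (r * R) → P y) :
    ∀ᵐ x : Euc n, x ∈ Metric.ball 0 R → P (x₀ + r • x) := by
  have hT : AEMeasurable (fun x : Euc n => x₀ + r • x) := Continuous.aemeasurable (by fun_prop)
  have h1 : ∀ᵐ y ∂(Measure.map (fun x : Euc n => x₀ + r • x) volume),
      y ∈ Metric.ball x₀ (r * R) → P y := by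
    rw [map_affine x₀ hr]
    exact Measure.ae_smul_measure h _
  filter_upwards [ae_of_ae_map hT h1] with x hx hxR
  exact hx ((mem_ball_affine hr).2 hxR)

lemma isFiniteMeasure_ball (x : Euc n) (R : ℝ) :
    IsFiniteMeasure (volume.restrict (Metric.ball x R)) :=
  ⟨by rw [Measure.restrict_apply_univ]; exact measure_ball_lt_top⟩

/-- Test functions are transported by the inverse affine map `y ↦ a + r⁻¹ y`; the chain rule factor
`r⁻¹` on the test side becomes the factor `r` on the derivative. -/
lemma HasWeakPartial.rescale {u g : Euc n → G} {i : Fin n} (hr : 0 < r)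
    (hu : MemLp u 2 (volume.restrict (Metric.ball x₀ (r * R))))
    (hg : MemLp g 2 (volume.restrict (Metric.ball x₀ (r * R))))
    (h : HasWeakPartial (Metric.ball x₀ (r * R)) i u g) :
    HasWeakPartial (Metric.ball 0 R) i (rescale u x₀ r) (r • ConstraintMap.rescale g x₀ r) := by
  have := isFiniteMeasure_ball (0 : Euc n) R
  refine ⟨IntegrableOn.locallyIntegrableOn ((memLp_rescale_ball hr hu).integrable (by norm_num)),
    IntegrableOn.locallyIntegrableOn
      (((memLp_rescale_ball hr hg).integrable (by norm_num)).smul r), fun η hη => ?_⟩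
  have hr' : r ≠ 0 := hr.ne'
  set a : Euc n := -(r⁻¹ • x₀)
  have hinv : ∀ x : Euc n, a + r⁻¹ • (x₀ + r • x) = x := fun x => by
    rw [smul_add, smul_smul, inv_mul_cancel₀ hr', one_smul]
    simp [a]
  have hinv' : ∀ y : Euc n, x₀ + r • (a + r⁻¹ • y) = y := fun y => by
    rw [smul_add, smul_smul, mul_inv_cancel₀ hr', one_smul]
    simp [a, smul_smul, mul_inv_cancel₀ hr']
  have hη' : IsTest (Metric.ball x₀ (r * R)) (fun y => η (a + r⁻¹ • y)) :=
    hη.comp_affine a (inv_ne_zero hr') fun y hy => by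
      rw [← hinv' y]; exact (mem_ball_affine hr).2 hy
  have h1 := h.2.2 _ hη'
  rw [(hη'.isTest_pderiv i).setIntegral_smul, hη'.setIntegral_smul] at h1
  simp only [pderiv_comp_affine hη.1] at h1
  rw [(hη.isTest_pderiv i).setIntegral_smul, hη.setIntegral_smul]
  have e1 := integral_comp_affine (fun y => (r⁻¹ * pderiv i η (a + r⁻¹ • y)) • u y) x₀ hr
  have e2 := integral_comp_affine (fun y => η (a + r⁻¹ • y) • g y) x₀ hr
  simp only [hinv] at e1 e2
  rw [h1, smul_neg, ← e2] at e1
  have e3 : ∫ x, pderiv i η x • ConstraintMap.rescale u x₀ r x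
      = r • ∫ x, (r⁻¹ * pderiv i η x) • u (x₀ + r • x) := by
    rw [← integral_smul]
    refine integral_congr_ae (Eventually.of_forall fun x => ?_)
    simp only [smul_smul, mul_inv_cancel_left₀ hr']
    rfl
  have e4 : ∫ x, η x • (r • ConstraintMap.rescale g x₀ r) x
      = r • ∫ x, η x • g (x₀ + r • x) := by
    rw [← integral_smul]
    refine integral_congr_ae (Eventually.of_forall fun x => ?_)
    simp only [Pi.smul_apply, ConstraintMap.rescale]
    rw [smul_comm]
  rw [e3, e4, e1, smul_neg]

variable [CompleteSpace G] {Ω : Set (Euc n)} {u : Euc n → G}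

lemma MemW12.rescale (hΩ : IsOpen Ω) (hu : MemW12 Ω u) (hr : 0 < r)
    (hR : Metric.ball x₀ (r * R) ⊆ Ω) : MemW12 (Metric.ball 0 R) (rescale u x₀ r) ∧
      ∀ i, weakPartial (Metric.ball 0 R) (ConstraintMap.rescale u x₀ r) i
        =ᵐ[volume.restrict (Metric.ball 0 R)] r • ConstraintMap.rescale (weakPartial Ω u i) x₀ r := by
  have h1 : MemLp u 2 (volume.restrict (Metric.ball x₀ (r * R))) :=
    hu.1.mono_measure (Measure.restrict_mono hR le_rfl)
  have h2 : ∀ i, MemLp (weakPartial Ω u i) 2 (volume.restrict (Metric.ball x₀ (r * R))) := fun i =>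
    (hu.memLp_weakPartial hΩ i).mono_measure (Measure.restrict_mono hR le_rfl)
  have h3 := fun i => HasWeakPartial.rescale hr h1 (h2 i) ((hu.hasWeakPartial i).mono hR)
  exact ⟨⟨memLp_rescale_ball hr h1, fun i => ⟨_, h3 i, (memLp_rescale_ball hr (h2 i)).const_smul r⟩⟩,
    fun i => (h3 i).ae_eq_weakPartial Metric.isOpen_ball⟩

lemma setIntegral_energy_rescale (hΩ : IsOpen Ω) (hu : MemW12 Ω u) (hr : 0 < r)
    (hR : Metric.ball x₀ (r * R) ⊆ Ω) {s : ℝ} (hs : s ≤ R) :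
    ∫ x in Metric.ball 0 s, ∑ i, ‖weakPartial (Metric.ball 0 R) (rescale u x₀ r) i x‖ ^ 2
      = r ^ (2 - (n : ℤ)) * ∫ y in Metric.ball x₀ (r * s), ∑ i, ‖weakPartial Ω u i y‖ ^ 2 := by
  have h1 : ∫ x in Metric.ball 0 s, ∑ i, ‖weakPartial (Metric.ball 0 R) (rescale u x₀ r) i x‖ ^ 2
      = ∫ x in Metric.ball 0 s, r ^ 2 * ∑ i, ‖weakPartial Ω u i (x₀ + r • x)‖ ^ 2 := by
    refine integral_congr_ae ?_
    have h2 := ae_all_iff.2 (hu.rescale hΩ hr hR).2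
    filter_upwards [ae_restrict_of_ae_restrict_of_subset (Metric.ball_subset_ball hs) h2] with x hx
    rw [Finset.mul_sum]
    refine Finset.sum_congr rfl fun i _ => ?_
    rw [hx i, Pi.smul_apply, norm_smul, mul_pow, Real.norm_eq_abs, sq_abs]
    rfl
  rw [h1, integral_const_mul, setIntegral_rescale (fun y => ∑ i, ‖weakPartial Ω u i y‖ ^ 2) hr,
    smul_eq_mul, ← mul_assoc]
  congr 1
  rw [zpow_sub₀ hr.ne']
  simp [div_eq_mul_inv]

/-- The squared gradient contributes `r²` and the volume `r⁻ⁿ`; the exponent `2 - n` absorbs both.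
-/
lemma scaledEnergy_rescale (hΩ : IsOpen Ω) (hu : MemW12 Ω u) (hr : 0 < r)
    (hR : Metric.ball x₀ (r * R) ⊆ Ω) {s : ℝ} (hs : s ≤ R) :
    scaledEnergy (Metric.ball 0 R) (rescale u x₀ r) 0 s = scaledEnergy Ω u x₀ (r * s) := by
  rw [scaledEnergy, scaledEnergy, setIntegral_energy_rescale hΩ hu hr hR hs, mul_zpow]
  ring

lemma scaledEnergy_nonneg {s : ℝ} (hs : 0 ≤ s) : 0 ≤ scaledEnergy Ω u x₀ s :=
  mul_nonneg (zpow_nonneg hs _) (integral_nonneg fun x => Finset.sum_nonneg fun i _ => by positivity)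

end Rescaling

end ConstraintMap

end

noncomputable section

namespace ConstraintMap

/-! ### Existence of tangent maps. -/

section TangentMaps

variable {n m : ℕ}

/-- Weak sequential compactness in `L²_loc(ℝ^n)` for finitely many sequences at once. -/
lemma exists_weak_limit_loc_family {ι : Type} [Fintype ι] (b : ι → ℕ → ℝ)
    (F : ι → ℕ → Euc n → Euc m)
    (hF : ∀ o k, MemLp (F o k) 2 (volume.restrict (Metric.ball 0 (k : ℝ))))
    (hb : ∀ o, ∀ k j : ℕ, j ≤ k → ∫ x in Metric.ball 0 (j : ℝ), ‖F o k x‖ ^ 2 ≤ b o j) :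
    ∃ ns : ℕ → ℕ, StrictMono ns ∧ ∃ φ : ι → Euc n → Euc m, ∀ o, ∀ R : ℝ,
      MemLp (φ o) 2 (volume.restrict (Metric.ball 0 R)) ∧
      ∀ g : Euc n → Euc m, MemLp g 2 (volume.restrict (Metric.ball 0 R)) →
        Tendsto (fun k => ∫ x in Metric.ball 0 R, inner ℝ (F o (ns k) x) (g x)) atTop
          (𝓝 (∫ x in Metric.ball 0 R, inner ℝ (φ o x) (g x))) := by
  classical
  -- All sequences are bundled into a single Hilbert-valued one, so that one subsequence serves them
  -- all.
  let Φ : ℕ → Euc n → PiLp 2 (fun _ : ι => Euc m) := fun k x => WithLp.toLp 2 fun o => F o k x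
  have hΦ : ∀ k, MemLp (Φ k) 2 (volume.restrict (Metric.ball 0 (k : ℝ))) := fun k =>
    MemLp.of_eval_piLp fun o => hF o k
  have hΦb : ∀ k j : ℕ, j ≤ k → ∫ x in Metric.ball 0 (j : ℝ), ‖Φ k x‖ ^ 2 ≤ ∑ o, b o j := by
    intro k j hjk
    have e : ∀ x, ‖Φ k x‖ ^ 2 = ∑ o, ‖F o k x‖ ^ 2 := fun x => PiLp.norm_sq_eq_of_L2 _ _
    have hjk' : (j : ℝ) ≤ k := by exact_mod_cast hjk
    simp_rw [e]
    rw [integral_finsetSum]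
    · exact Finset.sum_le_sum fun o _ => hb o k j hjk
    · intro o _
      exact (((hF o k).mono_measure (Measure.restrict_mono
        (Metric.ball_subset_ball hjk') le_rfl))).integrable_norm_pow two_ne_zero
  obtain ⟨ns, hns, φ, hφ⟩ := exists_weak_limit_loc _ Φ hΦ hΦb
  refine ⟨ns, hns, fun o x => φ x o, fun o R => ?_⟩
  obtain ⟨j, hj⟩ := exists_nat_ge R
  have hsub : Metric.ball (0 : Euc n) R ⊆ Metric.ball 0 (j : ℝ) := Metric.ball_subset_ball hj
  refine ⟨((hφ j).1.eval_piLp o).mono_measure (Measure.restrict_mono hsub le_rfl), fun g hg => ?_⟩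
  have hB : MeasurableSet (Metric.ball (0 : Euc n) R) := Metric.isOpen_ball.measurableSet
  set g' : Euc n → PiLp 2 (fun _ : ι => Euc m) := fun x =>
    WithLp.toLp 2 (Pi.single o ((Metric.ball 0 R).indicator g x))
  have hg' : MemLp g' 2 (volume.restrict (Metric.ball 0 (j : ℝ))) := by
    refine MemLp.of_eval_piLp fun o' => ?_
    by_cases ho : o' = o
    · subst ho
      simp only [g', Pi.single_eq_same]
      exact ((memLp_indicator_iff_restrict hB).2 hg).restrict _
    · simp only [g', Pi.single_eq_of_ne ho]
      exact MemLp.zero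
  have key : ∀ ψ : Euc n → PiLp 2 (fun _ : ι => Euc m),
      ∫ x in Metric.ball 0 (j : ℝ), inner ℝ (ψ x) (g' x)
        = ∫ x in Metric.ball 0 R, inner ℝ (ψ x o) (g x) := fun ψ => by
    have h1 : ∀ x, inner ℝ (ψ x) (g' x)
        = (Metric.ball 0 R).indicator (fun x => inner ℝ (ψ x o) (g x)) x := fun x => by
      rw [PiLp.inner_apply, Finset.sum_eq_single o]
      · by_cases hx : x ∈ Metric.ball 0 R
        · simp [g', indicator_of_mem hx]
        · simp [g', indicator_of_notMem hx]
      · intro o' _ ho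
        simp [g', Pi.single_eq_of_ne ho]
      · simp
    simp_rw [h1]
    rw [setIntegral_indicator hB, inter_eq_self_of_subset_right hsub]
  have h2 := (hφ j).2 g' hg'
  simp_rw [key] at h2
  exact h2

/-- Locally bounded maps with monotone energy have tangent maps. -/
theorem exists_isTangentMap {Ω : Set (Euc n)} (hΩ : IsOpen Ω) {u : Euc n → Euc m}
    (hu : MemW12 Ω u) {x₀ : Euc n} {ρ C : ℝ} (hρ : 0 < ρ) (hball : Metric.closedBall x₀ ρ ⊆ Ω)
    (hC : ∀ᵐ y, y ∈ Metric.ball x₀ ρ → ‖u y‖ ≤ C)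
    (hmono : ∀ r, 0 < r → r < ρ → scaledEnergy Ω u x₀ r ≤ scaledEnergy Ω u x₀ ρ) :
    ∃ φ, IsTangentMap u x₀ φ := by
  -- With `r k = ρ / (k + 1)` one has `r k * k < ρ`, so the `k`-th rescaling is controlled on the
  -- whole ball of radius `k`.
  set r : ℕ → ℝ := fun k => ρ * (1 / ((k : ℝ) + 1))
  have hr : ∀ k, 0 < r k := fun k => by positivity
  have hrk : ∀ {k : ℕ} {s : ℝ}, s ≤ k → r k * s < ρ := fun {k s} hs => by
    have hk : (0 : ℝ) < (k : ℝ) + 1 := by positivity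
    simp only [r, mul_one_div]
    rw [div_mul_eq_mul_div, div_lt_iff₀ hk]
    exact mul_lt_mul_of_pos_left (by linarith) hρ
  have hr0 : Tendsto r atTop (𝓝[>] 0) := by
    refine tendsto_nhdsWithin_iff.2 ⟨?_, Eventually.of_forall hr⟩
    have := tendsto_one_div_add_atTop_nhds_zero_nat (𝕜 := ℝ).const_mul ρ
    rwa [mul_zero] at this
  have hbs : ∀ {k : ℕ} {s : ℝ}, s ≤ k → Metric.ball x₀ (r k * s) ⊆ Ω := fun hs =>
    (Metric.ball_subset_ball (hrk hs).le).trans (Metric.ball_subset_closedBall.trans hball)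
  have hW := fun k : ℕ => hu.rescale hΩ (hr k) (hbs (le_refl (k : ℝ)))
  -- `none` indexes the rescaled map and `some i` its `i`-th weak derivative.
  set F : Option (Fin n) → ℕ → Euc n → Euc m := fun o k => o.elim (rescale u x₀ (r k))
    (weakPartial (Metric.ball 0 (k : ℝ)) (rescale u x₀ (r k)))
  have hF : ∀ o k, MemLp (F o k) 2 (volume.restrict (Metric.ball 0 (k : ℝ))) := by
    rintro (_ | i) k
    · exact (hW k).1.1
    · exact (hW k).1.memLp_weakPartial Metric.isOpen_ball i
  -- The maps are bounded through the sup bound, the derivatives through monotonicity of the scaled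
  -- energy.
  set b : Option (Fin n) → ℕ → ℝ := fun o j => o.elim (C ^ 2 * volume.real (Metric.ball (0 : Euc n) j))
    fun _ => (j : ℝ) ^ ((n : ℤ) - 2) * scaledEnergy Ω u x₀ ρ
  have hb : ∀ o, ∀ k j : ℕ, j ≤ k → ∫ x in Metric.ball 0 (j : ℝ), ‖F o k x‖ ^ 2 ≤ b o j := by
    rintro (_ | i) k j hjk
    · have hjk' : (j : ℝ) ≤ k := by exact_mod_cast hjk
      have h1 : ∀ᵐ x : Euc n, x ∈ Metric.ball 0 (j : ℝ) → ‖rescale u x₀ (r k) x‖ ≤ C :=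
        ae_rescale (hr k) (by
          filter_upwards [hC] with y hy hyb
          exact hy (Metric.ball_subset_ball (hrk hjk').le hyb))
      have := isFiniteMeasure_ball (0 : Euc n) j
      calc ∫ x in Metric.ball 0 (j : ℝ), ‖rescale u x₀ (r k) x‖ ^ 2
          ≤ ∫ x in Metric.ball (0 : Euc n) (j : ℝ), C ^ 2 := by
            refine integral_mono_of_nonneg (Eventually.of_forall fun x => by positivity)
              (integrable_const _) ?_
            filter_upwards [(ae_restrict_iff' Metric.isOpen_ball.measurableSet).2 h1] with x hx
            exact pow_le_pow_left₀ (norm_nonneg _) hx 2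
        _ = C ^ 2 * volume.real (Metric.ball (0 : Euc n) j) := by
            rw [setIntegral_const, smul_eq_mul, mul_comm]
    -- The powers of `j` below cancel only for `j ≠ 0`; at `j = 0` the ball is empty.
    · rcases Nat.eq_zero_or_pos j with rfl | hj
      · simp only [Nat.cast_zero, Metric.ball_zero, setIntegral_empty, b, Option.elim]
        exact mul_nonneg (zpow_nonneg le_rfl _) (scaledEnergy_nonneg hρ.le)
      have hj' : (0 : ℝ) < j := by exact_mod_cast hj
      have hjk' : (j : ℝ) ≤ k := by exact_mod_cast hjk
      have h1 := scaledEnergy_rescale (x₀ := x₀) hΩ hu (hr k) (hbs (le_refl (k : ℝ))) hjk'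
      have h2 := hmono _ (mul_pos (hr k) hj') (hrk hjk')
      rw [← h1, scaledEnergy] at h2
      have hint : ∀ i, IntegrableOn (fun x => ‖weakPartial (Metric.ball 0 (k : ℝ))
          (rescale u x₀ (r k)) i x‖ ^ 2) (Metric.ball 0 (j : ℝ)) := fun i =>
        ((hF (some i) k).mono_measure (Measure.restrict_mono
          (Metric.ball_subset_ball hjk') le_rfl)).integrable_norm_pow two_ne_zero
      calc ∫ x in Metric.ball 0 (j : ℝ), ‖F (some i) k x‖ ^ 2
          ≤ ∫ x in Metric.ball 0 (j : ℝ), ∑ i, ‖weakPartial (Metric.ball 0 (k : ℝ))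
              (rescale u x₀ (r k)) i x‖ ^ 2 := by
            refine integral_mono (hint i) (integrable_finsetSum _ fun i _ => hint i) fun x => ?_
            exact Finset.single_le_sum (f := fun i => ‖weakPartial (Metric.ball 0 (k : ℝ))
              (rescale u x₀ (r k)) i x‖ ^ 2) (fun i _ => by positivity) (Finset.mem_univ i)
        _ = (j : ℝ) ^ ((n : ℤ) - 2) * ((j : ℝ) ^ (2 - (n : ℤ)) * ∫ x in Metric.ball 0 (j : ℝ),
              ∑ i, ‖weakPartial (Metric.ball 0 (k : ℝ)) (rescale u x₀ (r k)) i x‖ ^ 2) := by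
            rw [← mul_assoc, ← zpow_add₀ hj'.ne']
            simp
        _ ≤ (j : ℝ) ^ ((n : ℤ) - 2) * scaledEnergy Ω u x₀ ρ :=
            mul_le_mul_of_nonneg_left h2 (zpow_nonneg hj'.le _)
  obtain ⟨ns, hns, φ, hφ⟩ := exists_weak_limit_loc_family b F hF hb
  refine ⟨φ none, fun k => r (ns k), hr0.comp hns.tendsto_atTop, fun R hR => ?_⟩
  have hfin := isFiniteMeasure_ball (0 : Euc n) R
  have hlarge : ∀ᶠ k in atTop, R ≤ ((ns k : ℕ) : ℝ) := by
    obtain ⟨N, hN⟩ := exists_nat_ge R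
    filter_upwards [eventually_ge_atTop N] with k hk
    exact hN.trans (by exact_mod_cast hk.trans (hns.id_le k))
  -- Paired with a fixed vector `e`, integration by parts involves only inner products with fixed
  -- `L²` fields, so it survives weak limits.
  have hpart : ∀ i, HasWeakPartial (Metric.ball 0 R) i (φ none) (φ (some i)) := fun i => by
    refine ⟨IntegrableOn.locallyIntegrableOn ((hφ none R).1.integrable (by norm_num)),
      IntegrableOn.locallyIntegrableOn ((hφ (some i) R).1.integrable (by norm_num)),
      fun η hη => ?_⟩
    have hi : ∀ {ζ : Euc n → ℝ} {v : Euc n → Euc m}, IsTest (Metric.ball 0 R) ζ →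
        MemLp v 2 (volume.restrict (Metric.ball 0 R)) →
        Integrable (fun x => ζ x • v x) (volume.restrict (Metric.ball 0 R)) := fun hζ hv =>
      (hζ.integrable_smul (IntegrableOn.locallyIntegrableOn (hv.integrable (by norm_num)))).restrict
    have hin : ∀ {ζ : Euc n → ℝ} {v : Euc n → Euc m} (e : Euc m), IsTest (Metric.ball 0 R) ζ →
        MemLp v 2 (volume.restrict (Metric.ball 0 R)) →
        inner ℝ (∫ x in Metric.ball 0 R, ζ x • v x) e
          = ∫ x in Metric.ball 0 R, inner ℝ (v x) (ζ x • e) := fun {ζ v} e hζ hv => by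
      rw [real_inner_comm, ← integral_inner (hi hζ hv)]
      refine integral_congr_ae (Eventually.of_forall fun x => ?_)
      simp only
      rw [real_inner_smul_right, real_inner_smul_right, real_inner_comm]
    have htest : ∀ {ζ : Euc n → ℝ} (e : Euc m), IsTest (Metric.ball 0 R) ζ →
        MemLp (fun x => ζ x • e) 2 (volume.restrict (Metric.ball 0 R)) := fun {ζ} e hζ =>
      (Continuous.memLp_of_hasCompactSupport (f := fun x => ζ x • e)
        (hζ.continuous.smul continuous_const) hζ.2.1.smul_right).restrict _
    refine ext_inner_right ℝ fun e => ?_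
    rw [inner_neg_left, hin e (hη.isTest_pderiv i) (hφ none R).1, hin e hη (hφ (some i) R).1]
    have l1 := (hφ none R).2 _ (htest e (hη.isTest_pderiv i))
    have l2 := ((hφ (some i) R).2 _ (htest e hη)).neg
    refine tendsto_nhds_unique (l1.congr' ?_) l2
    filter_upwards [hlarge] with k hk
    have hsub : Metric.ball (0 : Euc n) R ⊆ Metric.ball 0 ((ns k : ℕ) : ℝ) :=
      Metric.ball_subset_ball hk
    have hm := fun o => (hF o (ns k)).mono_measure (Measure.restrict_mono hsub le_rfl)
    rw [← hin e (hη.isTest_pderiv i) (hm none), ← hin e hη (hm (some i)), ← inner_neg_left]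
    congr 1
    exact (((hW (ns k)).1.hasWeakPartial i).mono hsub).2.2 η hη
  refine ⟨⟨(hφ none R).1, fun i => ⟨_, hpart i, (hφ (some i) R).1⟩⟩, ?_, fun g hg =>
    ⟨(hφ none R).2 g hg, fun i => ?_⟩⟩
  · filter_upwards [hlarge] with k hk
    exact (hu.rescale hΩ (hr (ns k)) (hbs hk)).1
  · have l := (hφ (some i) R).2 g hg
    have e0 : ∫ x in Metric.ball 0 R, inner ℝ (weakPartial (Metric.ball 0 R) (φ none) i x) (g x)
        = ∫ x in Metric.ball 0 R, inner ℝ (φ (some i) x) (g x) := by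
      refine integral_congr_ae ?_
      filter_upwards [(hpart i).ae_eq_weakPartial Metric.isOpen_ball] with x hx
      rw [hx]
    rw [e0]
    refine l.congr' ?_
    filter_upwards [hlarge] with k hk
    refine integral_congr_ae ?_
    have hsub : Metric.ball (0 : Euc n) R ⊆ Metric.ball 0 ((ns k : ℕ) : ℝ) :=
      Metric.ball_subset_ball hk
    filter_upwards [(((hW (ns k)).1.hasWeakPartial i).mono hsub).ae_eq_weakPartial
      Metric.isOpen_ball] with x hx
    rw [hx]
    rfl

end TangentMaps

end ConstraintMap

end

noncomputable section

namespace ConstraintMap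

/-! ### Energy and distance along blow-ups. -/

section BlowUp

variable {n m : ℕ}

lemma tendsto_integral_norm_sq {α E : Type*} [MeasurableSpace α] {μ : Measure α}
    [NormedAddCommGroup E] [InnerProductSpace ℝ E] {f : ℕ → α → E} {g : α → E}
    (hf : ∀ k, MemLp (f k) 2 μ) (hg : MemLp g 2 μ)
    (h : Tendsto (fun k => eLpNorm (f k - g) 2 μ) atTop (𝓝 0)) :
    Tendsto (fun k => ∫ x, ‖f k x‖ ^ 2 ∂μ) atTop (𝓝 (∫ x, ‖g x‖ ^ 2 ∂μ)) := by
  have e : ∀ {f : α → E} (hf : MemLp f 2 μ), ‖hf.toLp‖ ^ 2 = ∫ x, ‖f x‖ ^ 2 ∂μ := fun hf => by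
    rw [← real_inner_self_eq_norm_sq, L2.inner_def]
    refine integral_congr_ae ?_
    filter_upwards [hf.coeFn_toLp] with x hx
    rw [hx, real_inner_self_eq_norm_sq]
  have h1 := (Lp.tendsto_Lp_iff_tendsto_eLpNorm'' f hf g hg).2 h
  simpa only [e] using h1.norm.pow 2

/-- Strong convergence of maps implies convergence of the energies. -/
lemma TendstoW12.tendsto_scaledEnergy {f : ℕ → Euc n → Euc m} {φ : Euc n → Euc m} {R s : ℝ}
    (h : TendstoW12 (Metric.ball 0 R) f φ) (hs : s ≤ R) :
    Tendsto (fun k => scaledEnergy (Metric.ball 0 R) (f k) 0 s) atTop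
      (𝓝 (scaledEnergy (Metric.ball 0 R) φ 0 s)) := by
  obtain ⟨N, hN⟩ := eventually_atTop.1 h.2.1
  have hB : IsOpen (Metric.ball (0 : Euc n) R) := Metric.isOpen_ball
  have hle : volume.restrict (Metric.ball (0 : Euc n) s) ≤ volume.restrict (Metric.ball 0 R) :=
    Measure.restrict_mono (Metric.ball_subset_ball hs) le_rfl
  have hf : ∀ i k, MemLp (weakPartial (Metric.ball 0 R) (f (k + N)) i) 2
      (volume.restrict (Metric.ball 0 s)) := fun i k =>
    ((hN (k + N) (Nat.le_add_left N k)).memLp_weakPartial hB i).mono_measure hle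
  have hg : ∀ i, MemLp (weakPartial (Metric.ball 0 R) φ i) 2
      (volume.restrict (Metric.ball 0 s)) := fun i =>
    (h.1.memLp_weakPartial hB i).mono_measure hle
  refine (tendsto_add_atTop_iff_nat N).1 ?_
  refine Tendsto.const_mul _ ?_
  simp_rw [integral_finsetSum _ fun i _ => (hf i _).integrable_norm_pow two_ne_zero,
    integral_finsetSum _ fun i _ => (hg i).integrable_norm_pow two_ne_zero]
  refine tendsto_finsetSum _ fun i _ => tendsto_integral_norm_sq (hf i) (hg i) ?_
  exact tendsto_of_tendsto_of_tendsto_of_le_of_le tendsto_const_nhds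
    ((h.2.2.2 i).comp (tendsto_add_atTop_nat N)) (fun _ => zero_le)
    (fun k => eLpNorm_mono_measure _ hle)

/-- Averages of a function are averages over the unit ball of its rescalings. -/
lemma avg_eq_setIntegral_rescale (w : Euc n → ℝ) {r : ℝ} (hr : 0 < r) (x₀ : Euc n) :
    avg w r x₀ = ∫ x in Metric.ball 0 1, moll 1 x * w (x₀ + r • x) := by
  have h1 := integral_comp_affine (fun y => moll r (x₀ - y) • w y) x₀ hr
  have h2 : ∀ x : Euc n, moll r (x₀ - (x₀ + r • x)) • w (x₀ + r • x)
      = (r ^ n)⁻¹ * (moll 1 x * w (x₀ + r • x)) := fun x => by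
    rw [sub_add_cancel_left, moll_neg, moll_smul (s := 1) hr.ne' x, mul_one, smul_eq_mul]
    field_simp
  simp_rw [h2] at h1
  rw [integral_const_mul, smul_eq_mul] at h1
  have h3 := mul_left_cancel₀ (by positivity) h1
  rw [setIntegral_eq_integral_of_forall_compl_eq_zero fun x hx => ?_]
  · exact h3.symm
  · rw [moll_eq_zero one_pos (by simpa using hx), zero_mul]

lemma setIntegral_moll_one : ∫ x in Metric.ball (0 : Euc n) 1, moll 1 x = 1 := by
  rw [setIntegral_eq_integral_of_forall_compl_eq_zero fun x hx => ?_]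
  · exact integral_moll one_pos
  · exact moll_eq_zero one_pos (by simpa using hx)

set_option maxHeartbeats 800000 in
/-- Blow-ups of the distance function at a point are constant. -/
lemma infDist_blowup_eq {Ω : Set (Euc n)} {u φ : Euc n → Euc m} {K : Set (Euc m)} {x₀ : Euc n}
    (hw : IsDistribSubharmonic Ω (Ω.indicator fun x => Metric.infDist (u x) K)) (hx₀ : x₀ ∈ Ω)
    {r : ℕ → ℝ} (hr : Tendsto r atTop (𝓝[>] 0))
    (hφ : TendstoW12 (Metric.ball 0 1) (fun k => rescale u x₀ (r k)) φ) :
    ∀ᵐ x, x ∈ Metric.ball (0 : Euc n) 1 → Metric.infDist (φ x) K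
      = upperRep Ω (Ω.indicator fun x => Metric.infDist (u x) K) x₀ := by
  set w := Ω.indicator fun x => Metric.infDist (u x) K
  set c := upperRep Ω w x₀
  have hB : MeasurableSet (Metric.ball (0 : Euc n) 1) := Metric.isOpen_ball.measurableSet
  have := isFiniteMeasure_ball (0 : Euc n) 1
  -- The bound `c + 1` near `x₀` supplies the dominating function for the rescaled distances.
  obtain ⟨δ, hδ, hδΩ, hδw⟩ := hw.exists_ae_le hx₀ one_pos
  obtain ⟨N, hN⟩ := eventually_atTop.1
    ((hr.eventually (Ioo_mem_nhdsGT hδ)).and hφ.2.1)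
  have hr' : Tendsto (fun k => r (k + N)) atTop (𝓝[>] 0) := hr.comp (tendsto_add_atTop_nat N)
  have hconv : TendstoInMeasure (volume.restrict (Metric.ball 0 1))
      (fun k => rescale u x₀ (r (k + N))) atTop φ :=
    tendstoInMeasure_of_tendsto_eLpNorm (p := 2) two_ne_zero
      (fun k => (hN _ (Nat.le_add_left N k)).2.1.1) hφ.1.1.1
      (hφ.2.2.1.comp (tendsto_add_atTop_nat N))
  obtain ⟨ns, hns, hae⟩ := hconv.exists_seq_tendsto_ae
  set t : ℕ → ℝ := fun k => r (ns k + N)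
  have ht : Tendsto t atTop (𝓝[>] 0) := hr'.comp hns.tendsto_atTop
  have htδ : ∀ k, t k ∈ Ioo 0 δ := fun k => (hN _ (Nat.le_add_left N _)).1
  have hcont := Metric.continuous_infDist_pt K
  have hlim : ∀ᵐ x ∂(volume.restrict (Metric.ball 0 1)),
      Tendsto (fun k => Metric.infDist (u (x₀ + t k • x)) K) atTop (𝓝 (Metric.infDist (φ x) K)) := by
    filter_upwards [hae] with x hx
    exact (hcont.tendsto _).comp hx
  have hbound : ∀ ε : ℝ, 0 < ε → ∃ δ' : ℝ, 0 < δ' ∧ ∀ s ∈ Ioo (0 : ℝ) δ',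
      ∀ᵐ x ∂(volume.restrict (Metric.ball (0 : Euc n) 1)),
      Metric.infDist (u (x₀ + s • x)) K ≤ c + ε := fun ε hε => by
    obtain ⟨δ', hδ', hsub, hle⟩ := hw.exists_ae_le hx₀ hε
    refine ⟨δ', hδ', fun s hs => (ae_restrict_iff' hB).2 (ae_rescale (R := 1) hs.1
      (P := fun y => Metric.infDist (u y) K ≤ c + ε) ?_)⟩
    filter_upwards [hle] with y hy hyb
    have hyb' : y ∈ Metric.closedBall x₀ δ' := Metric.ball_subset_closedBall
      (Metric.ball_subset_ball (by rw [mul_one]; exact hs.2.le) hyb)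
    have := hy hyb'
    rwa [show w y = Metric.infDist (u y) K from indicator_of_mem (hsub hyb') _] at this
  have hle : ∀ᵐ x ∂(volume.restrict (Metric.ball 0 1)), Metric.infDist (φ x) K ≤ c := by
    have h1 : ∀ j : ℕ, ∀ᵐ x ∂(volume.restrict (Metric.ball 0 1)),
        Metric.infDist (φ x) K ≤ c + 1 / ((j : ℝ) + 1) := fun j => by
      obtain ⟨δ', hδ', hs⟩ := hbound (1 / ((j : ℝ) + 1)) (by positivity)
      obtain ⟨k₀, hk₀⟩ := eventually_atTop.1 (ht.eventually (Ioo_mem_nhdsGT hδ'))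
      have h2 : ∀ k, ∀ᵐ x ∂(volume.restrict (Metric.ball 0 1)), k₀ ≤ k →
          Metric.infDist (u (x₀ + t k • x)) K ≤ c + 1 / ((j : ℝ) + 1) := fun k => by
        by_cases hk : k₀ ≤ k
        · filter_upwards [hs _ (hk₀ k hk)] with x hx _ using hx
        · exact Eventually.of_forall fun x h => absurd h hk
      filter_upwards [hlim, ae_all_iff.2 h2] with x hx hx2
      exact le_of_tendsto hx (eventually_atTop.2 ⟨k₀, hx2⟩)
    filter_upwards [ae_all_iff.2 h1] with x hx
    have h2 : Tendsto (fun j : ℕ => c + 1 / ((j : ℝ) + 1)) atTop (𝓝 (c + 0)) :=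
      tendsto_one_div_add_atTop_nhds_zero_nat.const_add c
    rw [add_zero] at h2
    exact ge_of_tendsto' h2 hx
  have hmoll : Integrable (moll (n := n) 1) (volume.restrict (Metric.ball 0 1)) :=
    ((isTest_moll_zero one_pos).continuous.integrable_of_hasCompactSupport
      (isTest_moll_zero one_pos).2.1).restrict
  have hmollc : Continuous (moll (n := n) 1) := (isTest_moll_zero one_pos).continuous
  -- Weighted averages of the rescaled distances over the unit ball are averages of `w` at `x₀` with
  -- shrinking radius, and these converge to `c`.
  have hint : ∫ x in Metric.ball 0 1, moll 1 x * Metric.infDist (φ x) K = c := by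
    have h1 : Tendsto (fun k => ∫ x in Metric.ball 0 1,
        moll 1 x * Metric.infDist (u (x₀ + t k • x)) K) atTop
        (𝓝 (∫ x in Metric.ball 0 1, moll 1 x * Metric.infDist (φ x) K)) := by
      refine tendsto_integral_of_dominated_convergence (fun x => moll 1 x * (c + 1)) (fun k => ?_)
        (hmoll.mul_const _) (fun k => ?_) (hlim.mono fun x hx => hx.const_mul _)
      · exact hmollc.aestronglyMeasurable.mul (hcont.comp_aestronglyMeasurable
          (hN _ (Nat.le_add_left N (ns k))).2.1.1)
      · have h2 : ∀ᵐ x : Euc n, x ∈ Metric.ball 0 1 → w (x₀ + t k • x) ≤ c + 1 :=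
          ae_rescale (htδ k).1 (P := fun y => w y ≤ c + 1) (by
            filter_upwards [hδw] with y hy hyb
            exact hy (Metric.ball_subset_closedBall
              (Metric.ball_subset_ball (by rw [mul_one]; exact (htδ k).2.le) hyb)))
        filter_upwards [(ae_restrict_iff' hB).2 h2, ae_restrict_mem hB] with x hx hxb
        have hxΩ : x₀ + t k • x ∈ Ω := hδΩ (Metric.ball_subset_closedBall
          (Metric.ball_subset_ball (by rw [mul_one]; exact (htδ k).2.le)
            ((mem_ball_affine (R := 1) (htδ k).1).2 hxb)))
        rw [show w (x₀ + t k • x) = Metric.infDist (u (x₀ + t k • x)) K from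
          indicator_of_mem hxΩ _] at hx
        rw [norm_mul, Real.norm_of_nonneg (moll_nonneg one_pos x),
          Real.norm_of_nonneg Metric.infDist_nonneg]
        exact mul_le_mul_of_nonneg_left hx (moll_nonneg one_pos x)
    refine tendsto_nhds_unique h1 (((hw.tendsto_avg hx₀).comp ht).congr fun k => ?_)
    rw [Function.comp, avg_eq_setIntegral_rescale _ (htδ k).1]
    refine setIntegral_congr_fun hB fun x hxb => ?_
    have hxΩ : x₀ + t k • x ∈ Ω := hδΩ (Metric.ball_subset_closedBall
      (Metric.ball_subset_ball (by rw [mul_one]; exact (htδ k).2.le)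
        ((mem_ball_affine (R := 1) (htδ k).1).2 hxb)))
    simp only [w, indicator_of_mem hxΩ]
  have hφm : AEStronglyMeasurable (fun x => Metric.infDist (φ x) K)
      (volume.restrict (Metric.ball 0 1)) := hcont.comp_aestronglyMeasurable hφ.1.1.1
  have hφi : Integrable (fun x => moll 1 x * Metric.infDist (φ x) K)
      (volume.restrict (Metric.ball 0 1)) := by
    refine (hmoll.mul_const c).mono (hmollc.aestronglyMeasurable.mul hφm) ?_
    filter_upwards [hle] with x hx
    rw [norm_mul, norm_mul, Real.norm_of_nonneg (Metric.infDist_nonneg (x := φ x))]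
    exact mul_le_mul_of_nonneg_left (hx.trans (le_abs_self c)) (norm_nonneg _)
  -- The deficit `c - dist` is nonnegative with zero weighted integral, and the weight is positive
  -- in the open unit ball; so the deficit vanishes almost everywhere.
  have hzero : ∫ x in Metric.ball 0 1, moll 1 x * (c - Metric.infDist (φ x) K) = 0 := by
    simp_rw [mul_sub]
    rw [integral_sub (hmoll.mul_const c) hφi, hint, integral_mul_const, setIntegral_moll_one,
      one_mul, sub_self]
  have hnn : 0 ≤ᵐ[volume.restrict (Metric.ball 0 1)]
      fun x => moll 1 x * (c - Metric.infDist (φ x) K) := by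
    filter_upwards [hle] with x hx
    exact mul_nonneg (moll_nonneg one_pos x) (sub_nonneg.2 hx)
  have hi : Integrable (fun x => moll 1 x * (c - Metric.infDist (φ x) K))
      (volume.restrict (Metric.ball 0 1)) := by
    simp_rw [mul_sub]
    exact (hmoll.mul_const c).sub hφi
  have h0 := (integral_eq_zero_iff_of_nonneg_ae hnn hi).1 hzero
  filter_upwards [(ae_restrict_iff' hB).1 h0] with x hx hxb
  have h1 := hx hxb
  have h2 : 0 < moll 1 x := moll_pos one_pos (by simpa using hxb)
  have h3 : c - Metric.infDist (φ x) K = 0 := (mul_eq_zero.1 h1).resolve_left h2.ne'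
  linarith

end BlowUp

/-! ### Vanishing of the distance on the discontinuity set. -/

section Main

variable {n m : ℕ} {M : Set (Euc m)} {S : Set (Euc n) → (Euc n → Euc m) → Prop} {Ω : Set (Euc n)}
  {u : Euc n → Euc m}

/-- `M` is open, so its frontier lies in the complement; the curvature acts only where the map takes
values there. -/
lemma curvatureTerm_eq_zero (hM : IsOpen M) {x : Euc n} (hx : u x ∉ Mᶜ) :
    curvatureTerm M Ω u x = 0 := by
  refine indicator_of_notMem (fun h => hx ?_) _
  have h' : u x ∈ frontier M := h
  rw [hM.frontier_eq] at h'
  exact h'.2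

lemma FConditions.integral_lap_mul_infDist_nonneg (hM : IsOpen M) (hne : Mᶜ.Nonempty)
    (hconv : Convex ℝ Mᶜ) (hΩ : IsOpen Ω) (hΩb : Bornology.IsBounded Ω)
    (h : FConditions M S Ω u) {η : Euc n → ℝ} (hη : IsTest Ω η) (hη0 : ∀ x, 0 ≤ η x) :
    0 ≤ ∫ x, lap η x * Metric.infDist (u x) Mᶜ := by
  have : IsFiniteMeasure (volume.restrict Ω) := ⟨by
    rw [Measure.restrict_apply_univ]; exact hΩb.measure_lt_top⟩
  have hU : Integrable (Ω.indicator u) :=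
    (integrable_indicator_iff hΩ.measurableSet).2 (h.memW12.1.integrable (by norm_num))
  have h1 := ConstraintMap.integral_lap_mul_infDist_nonneg hne hM.isClosed_compl hconv hΩ hU
    h.eulerLagrange.2.1 (fun η hη => by
      rw [← h.eulerLagrange.integral_lap hη]
      refine integral_congr_ae (Eventually.of_forall fun x => ?_)
      by_cases hx : x ∈ Ω
      · simp only [indicator_of_mem hx]
      · simp only [hη.lap_eq_zero hx, zero_smul]) (fun x hx hxK => by
      rw [indicator_of_mem hx] at hxK
      exact curvatureTerm_eq_zero hM hxK) hη hη0
  refine h1.trans_eq (integral_congr_ae (Eventually.of_forall fun x => ?_))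
  by_cases hx : x ∈ Ω
  · simp only [indicator_of_mem hx]
  · simp only [hη.lap_eq_zero hx, zero_mul]

lemma FConditions.isDistribSubharmonic (hM : IsOpen M) (hne : Mᶜ.Nonempty)
    (hconv : Convex ℝ Mᶜ) (hΩ : IsOpen Ω) (hΩb : Bornology.IsBounded Ω)
    (h : FConditions M S Ω u) :
    IsDistribSubharmonic Ω (Ω.indicator fun x => Metric.infDist (u x) Mᶜ) := by
  have : IsFiniteMeasure (volume.restrict Ω) := ⟨by
    rw [Measure.restrict_apply_univ]; exact hΩb.measure_lt_top⟩
  refine ⟨hΩ, (integrable_indicator_iff hΩ.measurableSet).2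
    ((memLp_infDist hne h.memW12.1).integrable (by norm_num)),
    fun x => indicator_nonneg (fun _ _ => Metric.infDist_nonneg) x, fun η hη hη0 => ?_⟩
  refine (h.integral_lap_mul_infDist_nonneg hM hne hconv hΩ hΩb hη hη0).trans_eq
    (integral_congr_ae (Eventually.of_forall fun x => ?_))
  by_cases hx : x ∈ Ω
  · simp only [indicator_of_mem hx, smul_eq_mul]
  · simp only [hη.lap_eq_zero hx, zero_mul, zero_smul]

/-- At discontinuity points the energy density is bounded from below. -/
lemma FConditions.exists_energy_lower_bound (h : FConditions M S Ω u) {x₀ : Euc n}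
    (hx₀ : x₀ ∈ discontinuitySet Ω u) {ρ : ℝ} (hball : Metric.closedBall x₀ ρ ⊆ Ω) :
    ∃ Θ > 0, ∀ s ∈ Ioo 0 ρ, Θ ≤ scaledEnergy Ω u x₀ s := by
  -- If the energy were small at one scale, monotonicity would make it small at all smaller scales,
  -- and the energy criterion would give continuity.
  by_contra! hcon
  refine hx₀.2 ((h.continuity_iff x₀ hx₀.1).2 (Metric.tendsto_nhds.2 fun ε hε => ?_))
  obtain ⟨s, hs, hlt⟩ := hcon ε hε
  filter_upwards [Ioo_mem_nhdsGT hs.1] with t ht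
  rw [Real.dist_eq, sub_zero, abs_of_nonneg (scaledEnergy_nonneg ht.1.le)]
  exact (h.monotonicity x₀ hx₀.1 t s ht.1 ht.2
    ((Metric.closedBall_subset_closedBall hs.2.le).trans hball)).trans_lt hlt

/-- The distance vanishes at discontinuity points. -/
lemma FConditions.upperRep_eq_zero (hS : ∀ V v, S V v → FConditions M S V v) (hM : IsOpen M)
    (hne : Mᶜ.Nonempty) (hconv : Convex ℝ Mᶜ) (hcomp : IsCompact Mᶜ) (hΩ : IsOpen Ω)
    (hΩb : Bornology.IsBounded Ω) (h : FConditions M S Ω u) {x₀ : Euc n}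
    (hx₀ : x₀ ∈ discontinuitySet Ω u) :
    upperRep Ω (Ω.indicator fun x => Metric.infDist (u x) Mᶜ) x₀ = 0 := by
  have hw := h.isDistribSubharmonic hM hne hconv hΩ hΩb
  by_contra hc
  obtain ⟨δ, hδ, hδΩ, hδw⟩ := hw.exists_ae_le hx₀.1 one_pos
  -- Since the complement is bounded, a bound on the distance to it bounds the map, as needed for
  -- the compactness of rescalings.
  obtain ⟨B, hB⟩ := hcomp.isBounded.exists_norm_le
  have hnorm : ∀ y : Euc m, ‖y‖ ≤ Metric.infDist y Mᶜ + B := fun y => by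
    obtain ⟨z, hz, hyz⟩ := hcomp.exists_infDist_eq_dist hne y
    have h1 := norm_le_norm_add_norm_sub' y z
    rw [hyz, dist_eq_norm]
    linarith [hB z hz]
  obtain ⟨φ, hφ⟩ := exists_isTangentMap hΩ h.memW12 hδ hδΩ
    (C := upperRep Ω (Ω.indicator fun x => Metric.infDist (u x) Mᶜ) x₀ + 1 + B) (by
      filter_upwards [hδw] with y hy hyb
      have h1 := hy (Metric.ball_subset_closedBall hyb)
      rw [indicator_of_mem (hδΩ (Metric.ball_subset_closedBall hyb))] at h1
      linarith [hnorm (u y)])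
    (fun r hr hrδ => h.monotonicity x₀ hx₀.1 r δ hr hrδ hδΩ)
  -- These radii need not be those along which `φ` arose as a weak limit; the blow-up argument works
  -- along any sequence with strong convergence.
  obtain ⟨r, hr, hstrong⟩ := h.tangent_strong x₀ hx₀.1 φ hφ
  have hφS := hS _ _ (h.tangent_mem x₀ hx₀.1 φ hφ 1 one_pos)
  have hlim := hstrong 1 one_pos
  have hfin := isFiniteMeasure_ball (0 : Euc n) 1
  have hconst := infDist_blowup_eq hw hx₀.1 hr hlim
  -- The distance of `φ` to the complement is a nonzero constant almost everywhere, so the curvature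
  -- term drops out.
  have hharm : ∀ η, IsTest (Metric.ball 0 1) η → ∫ x, lap η x • φ x = 0 := fun η hη => by
    rw [hφS.eulerLagrange.integral_lap hη]
    refine integral_eq_zero_of_ae ?_
    filter_upwards [hconst] with x hx
    by_cases hxb : x ∈ Metric.ball (0 : Euc n) 1
    · have : curvatureTerm M (Metric.ball 0 1) φ x = 0 := curvatureTerm_eq_zero hM fun hxM =>
        hc (by rw [← hx hxb]; exact Metric.infDist_zero_of_mem hxM)
      simp [this]
    · simp [hη.eq_zero hxb]
  have hcontφ : EssContinuousAt (Metric.ball 0 1) φ 0 :=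
    essContinuousAt_of_harmonic Metric.isOpen_ball (hφS.memW12.1.integrable (by norm_num)) hharm
      (Metric.mem_ball_self one_pos)
  have henergy := (hφS.continuity_iff 0 (Metric.mem_ball_self one_pos)).1 hcontφ
  obtain ⟨Θ, hΘ, hlower⟩ := h.exists_energy_lower_bound hx₀ hδΩ
  -- Strong convergence and scale invariance carry the lower bound from `u` at radius `r k * s` to
  -- `φ` at radius `s`.
  have hge : ∀ s ∈ Ioo (0 : ℝ) 1, Θ ≤ scaledEnergy (Metric.ball 0 1) φ 0 s := fun s hs => by
    refine ge_of_tendsto (hlim.tendsto_scaledEnergy hs.2.le) ?_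
    filter_upwards [hr.eventually (Ioo_mem_nhdsGT hδ)] with k hk
    have hsub : Metric.ball x₀ (r k * 1) ⊆ Ω :=
      (Metric.ball_subset_ball (by rw [mul_one]; exact hk.2.le)).trans
        (Metric.ball_subset_closedBall.trans hδΩ)
    rw [scaledEnergy_rescale hΩ h.memW12 hk.1 hsub hs.2.le]
    exact hlower _ ⟨mul_pos hk.1 hs.1, (mul_le_of_le_one_right hk.1.le hs.2.le).trans_lt hk.2⟩
  have h0 : Θ ≤ 0 := ge_of_tendsto henergy (by
    filter_upwards [Ioo_mem_nhdsGT one_pos] with s hs using hge s hs)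
  linarith

/-- The distance is continuous where the map is. -/
lemma continuousAt_upperRep_of_essContinuousAt {K : Set (Euc m)}
    (hw : IsDistribSubharmonic Ω (Ω.indicator fun x => Metric.infDist (u x) K)) {x₀ : Euc n}
    (hx₀ : x₀ ∈ Ω) (h : EssContinuousAt Ω u x₀) :
    ContinuousAt (upperRep Ω (Ω.indicator fun x => Metric.infDist (u x) K)) x₀ := by
  obtain ⟨v, hv, hvc⟩ := h
  have hdc : ContinuousAt (fun x => Metric.infDist (v x) K) x₀ :=
    (Metric.continuous_infDist_pt K).continuousAt.comp hvc
  refine hw.continuousAt_of_essLimit hx₀ (c := Metric.infDist (v x₀) K) fun ε hε => ?_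
  obtain ⟨δ, hδ, hsub⟩ := Metric.mem_nhds_iff.1
    (inter_mem (hw.isOpen.mem_nhds hx₀) (Metric.tendsto_nhds.1 hdc ε hε))
  refine ⟨δ, hδ, ?_⟩
  filter_upwards [(ae_restrict_iff' hw.isOpen.measurableSet).1 hv] with y hy hyb
  obtain ⟨hyΩ, hyd⟩ := hsub hyb
  rw [indicator_of_mem hyΩ, ← hy hyΩ]
  exact le_of_lt hyd

end Main

end ConstraintMap

end

theorem lemma5p2 {n m : ℕ} (hn : 1 ≤ n) (hm : 2 ≤ m)
    (Ω : Set (ConstraintMap.Euc n)) (hΩ : IsOpen Ω) (hΩb : Bornology.IsBounded Ω)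
    (M : Set (ConstraintMap.Euc m)) (hM : ConstraintMap.IsSmoothDomain M)
    (hne : Mᶜ.Nonempty) (hconv : Convex ℝ Mᶜ) (hcomp : IsCompact Mᶜ)
    (u : ConstraintMap.Euc n → ConstraintMap.Euc m) (hu : ConstraintMap.MemF M Ω u) :
    ∃ d : ConstraintMap.Euc n → ℝ,
      (∀ᵐ x ∂(volume.restrict Ω), d x = Metric.infDist (u x) Mᶜ) ∧
      ContinuousOn d Ω ∧
      ConstraintMap.IsWeaklySubharmonic Ω d ∧
      ∀ x ∈ ConstraintMap.discontinuitySet Ω u, d x = 0 := by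
  obtain ⟨S, hS, huS⟩ := hu
  have hF := hS Ω u huS
  have hw := hF.isDistribSubharmonic hM.1 hne hconv hΩ hΩb
  have hzero := fun x hx =>
    hF.upperRep_eq_zero (x₀ := x) hS hM.1 hne hconv hcomp hΩ hΩb hx
  have hae : ∀ᵐ x ∂(volume.restrict Ω), ConstraintMap.upperRep Ω
      (Ω.indicator fun x => Metric.infDist (u x) Mᶜ) x = Metric.infDist (u x) Mᶜ := by
    rw [ae_restrict_iff' hΩ.measurableSet]
    filter_upwards [hw.ae_eq] with x hx hxΩ
    rw [hx hxΩ, indicator_of_mem hxΩ]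
  refine ⟨_, hae, fun x hx => ContinuousAt.continuousWithinAt ?_, ?_, hzero⟩
  -- At a discontinuity of `u` the representative is zero, and a nonnegative upper semicontinuous
  -- function is continuous at its zeros.
  · by_cases hc : ConstraintMap.EssContinuousAt Ω u x
    · exact ConstraintMap.continuousAt_upperRep_of_essContinuousAt hw hx hc
    · exact hw.continuousAt_of_eq_zero hx (hzero x ⟨hx, hc⟩)
  · exact (ConstraintMap.isWeaklySubharmonic_infDist hΩ hΩb hne hF.memW12 fun η hη hη0 =>
      hF.integral_lap_mul_infDist_nonneg hM.1 hne hconv hΩ hΩb hη hη0).congr hΩ hae
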